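/- Let $k$ be a field of characteristic zero, $R$ a commutative $k$-algebra, $n\ge 1$, and write $R[h]/h^N$ for the truncated polynomial ring. An $A(\infty)$ algebra over a commutative ring $S$ is a $\mathbb Z$-graded $S$-module $A$ with $S$-linear maps $m_i:A^{\otimes i}\to A$ of degree $2-i$ ($i\ge1$) such that $\sum_{r+s+t=N}(-1)^{r+st}m_{r+1+t}(1^{\otimes r}\otimes m_s\otimes 1^{\otimes t})=0$ for all $N\ge 1$; it is minimal if $m_1=0$, and a minimal one is flat if every graded piece $A^i$ is a projective $S$-module. A morphism $f:A\to A'$ is a sequence of $S$-linear maps $f_i:A^{\otimes i}\to A'$ of degree $1-i$ such that, for all $N\ge1$, $$\sum_{r+s+t=N}(-1)^{r+st}f_{r+1+t}(1^{\otimes r}\otimes m_s\otimes1^{\otimes t})=\sum_{i_1+\dots+i_r=N}(-1)^{(r-1)(i_1-1)+(r-2)(i_2-1)+\dots+(i_{r-1}-1)}m'_r(f_{i_1}\otimes\dots\otimes f_{i_r});$$ it is a quasi-isomorphism if $f_1$ induces an isomorphism on $m_1$-cohomology. The Hochschild complex $C^\bullet_S(A)$ is the complex of graded coderivations of the reduced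 tensor coalgebra $\overline T A[1]$, i.e. $C^p_S(A)=\prod_{i\ge1}\operatorname{Hom}^p_S(A[1]^{\otimes i},A[1])$, with differential $[m,-]$, and $HH^{i+1}_S(A)=H^i(C_S^\bullet(A))$. Let $(B,m)$ be a minimal flat $A(\infty)$ algebra over $R[h]/h^{n+1}$ (in particular $B$ is $h$-free), and let $(\bar B,m^{(0)})=B/h$, an $A(\infty)$ algebra over $R$. Choose any splitting $\bar B\to B$ of graded $R$-modules of the projection $B\to\bar B$; it identifies $B$ with $\bar B[h]/h^{n+1}$ as a graded $R[h]/h^{n+1}$-module, so that $m=m^{(0)}+m^{(1)}h+\dots+m^{(n)}h^n$ with $m^{(j)}$ sequences of $R$-multilinear maps on $\bar B$. Then the cochain $$\partial_hm=m^{(1)}+2m^{(2)}h+\dots+n\,m^{(n)}h^{n-1}\in C^1_{R[h]/h^n}(B/h^n)$$ is a cocycle, and its class $[\partial_hm]\in HH^2_{R[h]/h^n}(B/h^n)$ (the Kaledin class of $B$) is zero if and only if there exists a quasi-isomorphism of $A(\infty)$ $R[h]/h^{n+1}$-algebras $f:B\to\bar B[h]/h^{n+1}$ (the target being the extension of scalars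 of $(\bar B,m^{(0)})$) such that $f\equiv(\mathrm{id},0,0,\dots)\pmod h$. -/

import Mathlib

open scoped TensorProduct

noncomputable section

namespace AInf

/-- A sequence `(c₁, c₂, …)` of `S`-multilinear maps `cᵢ : A^{⊗ i} → A'`, indexed by the arity.
(The entry of arity `0` is a dummy; it is required to vanish in `IsHomog`.) -/
abbrev Coll (S A A' : Type*) [CommRing S] [AddCommGroup A] [Module S A]
    [AddCommGroup A'] [Module S A'] :=
  (i : ℕ) → MultilinearMap S (fun _ : Fin i => A) A'

section General

variable {S A A' : Type*} [CommRing S] [AddCommGroup A] [Module S A]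
  [AddCommGroup A'] [Module S A']

/-- `cᵢ : A^{⊗ i} → A'` is homogeneous of degree `p + 1 - i` for all `i ≥ 1`; equivalently the
associated maps `A[1]^{⊗ i} → A'[1]` of the shifted modules are homogeneous of degree `p`. -/
def IsHomog (𝒜 : ℤ → Submodule S A) (𝒜' : ℤ → Submodule S A') (p : ℤ) (c : Coll S A A') : Prop :=
  c 0 = 0 ∧ ∀ (i : ℕ) (d : Fin i → ℤ) (a : Fin i → A), (∀ j, a j ∈ 𝒜 (d j)) →
    c i a ∈ 𝒜' (∑ j, d j + p + 1 - i)

/-- For homogeneous elements `a₀, a₁, …` of degrees `e₀, e₁, …`, the value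
`(c_{r+1+t} (1^{⊗ r} ⊗ d_s ⊗ 1^{⊗ t})) (a₀ ⊗ ⋯ ⊗ a_{r+s+t-1})`, where `d_s` has degree `q + 1 - s`.
By the Koszul rule moving `d_s` past `a₀, …, a_{r-1}` produces `(-1)^{(q+1-s)(e₀+⋯+e_{r-1})}`. -/
def insertion (c : Coll S A A') (d : Coll S A A) (q : ℤ) (r s t : ℕ) (e : ℕ → ℤ) (a : ℕ → A) :
    A' :=
  Int.negOnePow ((q + 1 - s) * ∑ j ∈ Finset.range r, e j) •
    c (r + 1 + t) (fun j : Fin (r + 1 + t) =>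
      if (j : ℕ) < r then a j
      else if (j : ℕ) = r then d s (fun l : Fin s => a (r + l))
      else a (j + s - 1))

/-- `∑_{r+s+t=n} (-1)^{q r + (q+1-s) t} c_{r+1+t} (1^{⊗ r} ⊗ d_s ⊗ 1^{⊗ t})` on
`a₀ ⊗ ⋯ ⊗ a_{n-1}`, with `aⱼ` homogeneous of degree `eⱼ`. (Terms with `s = 0` vanish, as `d₀ = 0`.)

For `q = 1` the sign is `(-1)^{r+st}`. For general `q` it is the `n`-th component of the composite
`c · d` on the bar construction, `d` being a coderivation of degree `q`: identifying `cᵢ` with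
`s ∘ cᵢ ∘ (s^{⊗ i})⁻¹ : A[1]^{⊗ i} → A'[1]`, it is
`∑_{r+s+t=n} c_{r+1+t} (1^{⊗ r} ⊗ d_s ⊗ 1^{⊗ t})` on `A[1]^{⊗ n}`, with Koszul signs only. -/
def circ (c : Coll S A A') (d : Coll S A A) (q : ℤ) (n : ℕ) (e : ℕ → ℤ) (a : ℕ → A) : A' :=
  ∑ x ∈ Finset.HasAntidiagonal.antidiagonal n, ∑ y ∈ Finset.HasAntidiagonal.antidiagonal x.2,
    Int.negOnePow (q * x.1 + (q + 1 - y.1) * y.2) • insertion c d q x.1 y.1 y.2 e a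

/-- `m = (m₁, m₂, …)` is an `A(∞)` structure on the graded module `A = ⨁ 𝒜 i`: `mᵢ` has degree
`2 - i` and `∑_{r+s+t=n} (-1)^{r+st} m_{r+1+t} (1^{⊗ r} ⊗ m_s ⊗ 1^{⊗ t}) = 0` for all `n`. -/
structure IsAInfAlgebra (𝒜 : ℤ → Submodule S A) (m : Coll S A A) : Prop where
  isInternal : DirectSum.IsInternal 𝒜
  homog : IsHomog 𝒜 𝒜 1 m
  stasheff : ∀ (n : ℕ) (e : ℕ → ℤ) (a : ℕ → A), (∀ j, a j ∈ 𝒜 (e j)) → circ m m 1 n e a = 0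

/-- An `A(∞)` algebra is minimal if `m₁ = 0`. -/
def IsMinimal (m : Coll S A A) : Prop := m 1 = 0

/-- Flatness of a *minimal* `A(∞)` algebra: since `m₁ = 0`, the cohomology modules are the graded
pieces themselves, and these have to be projective. -/
def IsFlat (𝒜 : ℤ → Submodule S A) : Prop := ∀ i, Module.Projective S (𝒜 i)

/-- The value `(m_r (f_{i₁} ⊗ ⋯ ⊗ f_{i_r})) (a₀ ⊗ ⋯ ⊗ a_{n-1})` for a decomposition
`n = i₁ + ⋯ + i_r` into positive parts, with `aⱼ` homogeneous of degree `eⱼ` and `fᵢ` of degree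
`1 - i`: by the Koszul rule the `k`-th factor moves past all the arguments of the factors `j < k`. -/
def tensorInsertion (m : Coll S A' A') (f : Coll S A A') {n : ℕ} (c : Composition n)
    (e : ℕ → ℤ) (a : ℕ → A) : A' :=
  Int.negOnePow (∑ k : Fin c.length, ∑ j : Fin c.length,
      if j < k then
        (1 - (c.blocksFun k : ℤ)) * ∑ l : Fin (c.blocksFun j), e (c.sizeUpTo j + l)
      else 0) •
    m c.length (fun j => f (c.blocksFun j) (fun l => a (c.sizeUpTo j + l)))

/-- `f = (f₁, f₂, …)` is an `A(∞)` morphism `(A, m) → (A', m')`: `fᵢ` has degree `1 - i` and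
`∑ (-1)^{r+st} f_{r+1+t} (1^{⊗ r} ⊗ m_s ⊗ 1^{⊗ t}) = ∑ (-1)^σ m'_r (f_{i₁} ⊗ ⋯ ⊗ f_{i_r})` for all
`n`, with `σ = (r-1)(i₁-1) + (r-2)(i₂-1) + ⋯ + (i_{r-1}-1)`. -/
structure IsMorphism (𝒜 : ℤ → Submodule S A) (𝒜' : ℤ → Submodule S A')
    (m : Coll S A A) (m' : Coll S A' A') (f : Coll S A A') : Prop where
  homog : IsHomog 𝒜 𝒜' 0 f
  comm : ∀ (n : ℕ) (e : ℕ → ℤ) (a : ℕ → A), (∀ j, a j ∈ 𝒜 (e j)) →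
    circ f m 1 n e a = ∑ c : Composition n,
      Int.negOnePow (∑ j : Fin c.length, ((c.length : ℤ) - 1 - j) * ((c.blocksFun j : ℤ) - 1)) •
        tensorInsertion m' f c e a

/-- `f₁ : (A, m₁) → (A', m'₁)` induces an injective and surjective map on cohomology. -/
structure IsQuasiIso (m : Coll S A A) (m' : Coll S A' A') (f : Coll S A A') : Prop where
  injective : ∀ x, m 1 ![x] = 0 → (∃ y, f 1 ![x] = m' 1 ![y]) → ∃ z, x = m 1 ![z]
  surjective : ∀ y, m' 1 ![y] = 0 → ∃ x z, m 1 ![x] = 0 ∧ y - f 1 ![x] = m' 1 ![z]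

/-! ### Hochschild cohomology -/

/-- The value at `a₀ ⊗ ⋯ ⊗ a_{n-1}` of the `n`-th component of `[m, c] = m · c - (-1)^p c · m`,
where `c` is (the collection of components of) a coderivation of degree `p` of the bar
construction. -/
def bracket (m : Coll S A A) (p : ℤ) (c : Coll S A A) (n : ℕ) (e : ℕ → ℤ) (a : ℕ → A) : A :=
  circ m c p n e a - Int.negOnePow p • circ c m 1 n e a

section additivity

variable (c c' : Coll S A A') (d d' : Coll S A A) (q : ℤ) (n : ℕ) (e : ℕ → ℤ) (a : ℕ → A)

theorem insertion_eq (r s t : ℕ) :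
    insertion c d q r s t e a = Int.negOnePow ((q + 1 - s) * ∑ j ∈ Finset.range r, e j) •
      c (r + 1 + t) (Function.update (fun j : Fin (r + 1 + t) =>
        if (j : ℕ) < r then a j else a (j + s - 1)) ⟨r, by omega⟩
          (d s (fun l : Fin s => a (r + l)))) := by
  unfold insertion
  congr 2
  funext j
  by_cases hj : j = ⟨r, by omega⟩
  · subst hj; simp
  · have : (j : ℕ) ≠ r := fun h => hj (Fin.ext h)
    simp [Function.update_of_ne hj, this]

theorem circ_add_left : circ (c + c') d q n e a = circ c d q n e a + circ c' d q n e a := by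
  simp [circ, insertion, smul_add, Finset.sum_add_distrib]

theorem circ_smul_left (x : S) : circ (x • c) d q n e a = x • circ c d q n e a := by
  simp only [circ, insertion, Finset.smul_sum, Pi.smul_apply, smul_apply]
  refine Finset.sum_congr rfl fun _ _ => Finset.sum_congr rfl fun _ _ => ?_
  rw [smul_comm x, smul_comm x]

theorem circ_zero_left : circ (0 : Coll S A A') d q n e a = 0 := by
  simp [circ, insertion]

theorem circ_add_right : circ c (d + d') q n e a = circ c d q n e a + circ c d' q n e a := by
  simp [circ, insertion_eq, MultilinearMap.map_update_add, smul_add, Finset.sum_add_distrib]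

theorem circ_smul_right (x : S) : circ c (x • d) q n e a = x • circ c d q n e a := by
  simp only [circ, insertion_eq, Finset.smul_sum, Pi.smul_apply, smul_apply,
    MultilinearMap.map_update_smul]
  refine Finset.sum_congr rfl fun _ _ => Finset.sum_congr rfl fun _ _ => ?_
  rw [smul_comm x, smul_comm x]

theorem circ_zero_right : circ c (0 : Coll S A A) q n e a = 0 := by
  simpa using circ_smul_right c (0 : Coll S A A) q n e a 0

variable (m b b' : Coll S A A) (p : ℤ)

theorem bracket_add :
    bracket m p (b + b') n e a = bracket m p b n e a + bracket m p b' n e a := by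
  simp only [bracket, circ_add_left, circ_add_right, smul_add]; abel

theorem bracket_smul (x : S) : bracket m p (x • b) n e a = x • bracket m p b n e a := by
  simp only [bracket, circ_smul_left, circ_smul_right, smul_sub]; rw [smul_comm x]

theorem bracket_zero : bracket m p 0 n e a = 0 := by
  simp [bracket, circ_zero_left, circ_zero_right]

end additivity

/-- The module `C^p = ∏_{i ≥ 1} Hom^p (A[1]^{⊗ i}, A[1])` of Hochschild cochains, i.e. of
coderivations of degree `p` of the bar construction. -/
def cochains (𝒜 : ℤ → Submodule S A) (p : ℤ) : Submodule S (Coll S A A) where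
  carrier := {c | IsHomog 𝒜 𝒜 p c}
  zero_mem' := ⟨rfl, fun _ _ _ _ => Submodule.zero_mem _⟩
  add_mem' := fun {c c'} hc hc' => ⟨by simp [hc.1, hc'.1], fun i d a h =>
    Submodule.add_mem _ (hc.2 i d a h) (hc'.2 i d a h)⟩
  smul_mem' := fun x c hc => ⟨by simp [hc.1], fun i d a h =>
    Submodule.smul_mem _ x (hc.2 i d a h)⟩

/-- The kernel of `[m, -]` on `C^p`. -/
def cocycles (𝒜 : ℤ → Submodule S A) (m : Coll S A A) (p : ℤ) : Submodule S (Coll S A A) where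
  carrier := {c | c ∈ cochains 𝒜 p ∧ ∀ (n : ℕ) (e : ℕ → ℤ) (a : ℕ → A), (∀ j, a j ∈ 𝒜 (e j)) →
    bracket m p c n e a = 0}
  zero_mem' := ⟨Submodule.zero_mem _, fun _ _ _ _ => bracket_zero ..⟩
  add_mem' := fun hc hc' => ⟨Submodule.add_mem _ hc.1 hc'.1, fun n e a h => by
    rw [bracket_add, hc.2 n e a h, hc'.2 n e a h, add_zero]⟩
  smul_mem' := fun x _ hc => ⟨Submodule.smul_mem _ x hc.1, fun n e a h => by
    rw [bracket_smul, hc.2 n e a h, smul_zero]⟩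

/-- The image of `[m, -] : C^{p-1} → C^p`. -/
def coboundaries (𝒜 : ℤ → Submodule S A) (m : Coll S A A) (p : ℤ) : Submodule S (Coll S A A) where
  carrier := {c | c ∈ cochains 𝒜 p ∧ ∃ b ∈ cochains 𝒜 (p - 1),
    ∀ (n : ℕ) (e : ℕ → ℤ) (a : ℕ → A), (∀ j, a j ∈ 𝒜 (e j)) →
      c n (fun j => a j) = bracket m (p - 1) b n e a}
  zero_mem' := ⟨Submodule.zero_mem _, 0, Submodule.zero_mem _, fun _ _ _ _ => by
    rw [bracket_zero]; rfl⟩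
  add_mem' := by
    rintro c c' ⟨hc, b, hb, h⟩ ⟨hc', b', hb', h'⟩
    refine ⟨Submodule.add_mem _ hc hc', b + b', Submodule.add_mem _ hb hb', fun n e a ha => ?_⟩
    rw [bracket_add, ← h n e a ha, ← h' n e a ha]; rfl
  smul_mem' := by
    rintro x c ⟨hc, b, hb, h⟩
    refine ⟨Submodule.smul_mem _ x hc, x • b, Submodule.smul_mem _ x hb, fun n e a ha => ?_⟩
    rw [bracket_smul, ← h n e a ha]; rfl

/-- Hochschild cohomology `HH^i_S(A) = H^{i-1}(C^•_S(A), [m, -])`. -/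
abbrev HH (𝒜 : ℤ → Submodule S A) (m : Coll S A A) (i : ℤ) :=
  cocycles 𝒜 m (i - 1) ⧸ (coboundaries 𝒜 m (i - 1)).submoduleOf (cocycles 𝒜 m (i - 1))

/-- The class in `HH^i_S(A)` of a cocycle of `C^{i-1}_S(A)`. -/
def HH.mk (𝒜 : ℤ → Submodule S A) (m : Coll S A A) (i : ℤ) (c : cocycles 𝒜 m (i - 1)) :
    HH 𝒜 m i :=
  Submodule.Quotient.mk c

end General

/-! ### Base change -/

section BaseChange

variable (S : Type*) {R M : Type*} [CommRing R] [CommRing S] [Algebra R S]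
  [AddCommGroup M] [Module R M]

instance (i : ℕ) :
    IsScalarTower R S (MultilinearMap S (fun _ : Fin i => S ⊗[R] M) (S ⊗[R] M)) :=
  ⟨fun x y f => by ext; simp⟩

/-- The `S`-multilinear extension to `S ⊗[R] M` of an `R`-multilinear map on `M`, by recursion on
the arity; it is characterized by `baseChange_tmul`. -/
def baseChange : (i : ℕ) → MultilinearMap R (fun _ : Fin i => M) M →ₗ[R]
    MultilinearMap S (fun _ : Fin i => S ⊗[R] M) (S ⊗[R] M)
  | 0 =>
    { toFun := fun g => MultilinearMap.constOfIsEmpty S _ (1 ⊗ₜ[R] g ![])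
      map_add' := fun g g' => by ext; simp [TensorProduct.tmul_add]
      map_smul' := fun x g => by ext; simp }
  | i + 1 =>
    { toFun := fun g => LinearMap.uncurryLeft
        (LinearMap.liftBaseChange S (baseChange i ∘ₗ g.curryLeft))
      map_add' := fun g g' => by
        ext a
        simp only [LinearMap.uncurryLeft_apply, add_apply]
        rw [show (g + g').curryLeft = g.curryLeft + g'.curryLeft from rfl, LinearMap.comp_add]
        induction a 0 using TensorProduct.induction_on with
        | zero => simp
        | tmul s y => simp
        | add y z hy hz =>
          rw [LinearMap.map_add, LinearMap.map_add, LinearMap.map_add, add_apply, add_apply,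
            add_apply, hy, hz]
          abel
      map_smul' := fun x g => by
        ext a
        simp only [LinearMap.uncurryLeft_apply, RingHom.id_apply, smul_apply]
        rw [show (x • g).curryLeft = x • g.curryLeft from rfl, LinearMap.comp_smul]
        induction a 0 using TensorProduct.induction_on with
        | zero => simp
        | tmul s y => simp [smul_comm s x]
        | add y z hy hz => simp [hy, hz] }

theorem baseChange_tmul (i : ℕ) (g : MultilinearMap R (fun _ : Fin i => M) M) (s : Fin i → S)
    (a : Fin i → M) :
    baseChange S i g (fun j => s j ⊗ₜ[R] a j) = (∏ j, s j) ⊗ₜ[R] g a := by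
  induction i with
  | zero =>
    simp only [baseChange, LinearMap.coe_mk, AddHom.coe_mk, MultilinearMap.constOfIsEmpty_apply,
      Finset.univ_eq_empty, Finset.prod_empty]
    exact congrArg (fun b => (1 : S) ⊗ₜ[R] g b) (Subsingleton.elim _ _)
  | succ i ih =>
    simp only [baseChange, LinearMap.coe_mk, AddHom.coe_mk, LinearMap.uncurryLeft_apply,
      LinearMap.liftBaseChange_tmul, LinearMap.comp_apply, smul_apply]
    have := ih (g.curryLeft (a 0)) (fun j => s j.succ) (fun j => a j.succ)
    rw [show (Fin.tail fun j => s j ⊗ₜ[R] a j) = fun j => s j.succ ⊗ₜ[R] a j.succ from rfl, this,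
      TensorProduct.smul_tmul', Fin.prod_univ_succ, smul_eq_mul, MultilinearMap.curryLeft_apply]
    congr 2
    exact Fin.cons_self_tail a

/-- The base change `m ⊗ S` of a sequence of multilinear maps. -/
def baseChangeColl (m : Coll R M M) : Coll S (S ⊗[R] M) (S ⊗[R] M) :=
  fun i => baseChange S i (m i)

/-- The base change `(A ⊗ S)^i = A^i ⊗ S` of a grading (as submodules of `A ⊗ S`). -/
def baseChangeGrading (𝒜 : ℤ → Submodule R M) : ℤ → Submodule S (S ⊗[R] M) :=
  fun i => (𝒜 i).baseChange S

end BaseChange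

section Truncated

open Polynomial

/-- The ring `R[h]/h^N`. -/
def TruncPoly (R : Type*) [CommRing R] (N : ℕ) := R[X] ⧸ Ideal.span {(X : R[X]) ^ N}

instance (R : Type*) [CommRing R] (N : ℕ) : CommRing (TruncPoly R N) :=
  inferInstanceAs (CommRing (R[X] ⧸ Ideal.span {(X : R[X]) ^ N}))

instance (R : Type*) [CommRing R] (N : ℕ) : Algebra R (TruncPoly R N) :=
  inferInstanceAs (Algebra R (R[X] ⧸ Ideal.span {(X : R[X]) ^ N}))

/-- The element `h` of `R[h]/h^N`. -/
def TruncPoly.h (R : Type*) [CommRing R] (N : ℕ) : TruncPoly R N :=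
  Ideal.Quotient.mk (Ideal.span {(X : R[X]) ^ N}) X

/-- The ideal generated by `h^k` in `R[h]/h^N`. For `k ≤ N` the quotient by it is `R[h]/h^k`. -/
abbrev hIdeal (R : Type*) [CommRing R] (N k : ℕ) : Ideal (TruncPoly R N) :=
  Ideal.span {TruncPoly.h R N ^ k}

variable (R : Type*) [CommRing R] (N k : ℕ) (B : Type*) [AddCommGroup B] [Module (TruncPoly R N) B]

/-- The reduction `B/h^k = B ⊗ (R[h]/h^k)` of an `R[h]/h^N`-module `B`. -/
abbrev Reduction := (TruncPoly R N ⧸ hIdeal R N k) ⊗[TruncPoly R N] B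

/-- The projection `B → B/h^k`. -/
def toReduction : B →ₗ[TruncPoly R N] Reduction R N k B :=
  TensorProduct.mk (TruncPoly R N) (TruncPoly R N ⧸ hIdeal R N k) B 1

variable {B}

/-- The reduction modulo `h^k`, over the ring `R[h]/h^k`, of a sequence of multilinear maps. -/
abbrev redColl (m : Coll (TruncPoly R N) B B) :
    Coll (TruncPoly R N ⧸ hIdeal R N k) (Reduction R N k B) (Reduction R N k B) :=
  baseChangeColl (TruncPoly R N ⧸ hIdeal R N k) m

/-- The grading of `B/h^k`. -/
abbrev redGrading (ℬ : ℤ → Submodule (TruncPoly R N) B) :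
    ℤ → Submodule (TruncPoly R N ⧸ hIdeal R N k) (Reduction R N k B) :=
  baseChangeGrading (TruncPoly R N ⧸ hIdeal R N k) ℬ

/-- The `A(∞)` structure on the `R`-module `B̄ = B/h` (note that `(R[h]/h^N)/h = R` for `N ≥ 1`). -/
def barColl (m : Coll (TruncPoly R N) B B) : Coll R (Reduction R N 1 B) (Reduction R N 1 B) :=
  fun i => (redColl R N 1 m i).restrictScalars R

/-- The grading of the `R`-module `B̄ = B/h`. -/
def barGrading (ℬ : ℤ → Submodule (TruncPoly R N) B) : ℤ → Submodule R (Reduction R N 1 B) :=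
  fun i => (redGrading R N 1 ℬ i).restrictScalars R

variable (B) in
/-- The module `B̄[h]/h^N = B̄ ⊗_R R[h]/h^N`. -/
abbrev Constant := TruncPoly R N ⊗[R] Reduction R N 1 B

/-- The `A(∞)` structure on `B̄[h]/h^N` obtained by extension of scalars from `B̄`. -/
def constColl (m : Coll (TruncPoly R N) B B) :
    Coll (TruncPoly R N) (Constant R N B) (Constant R N B) :=
  baseChangeColl (TruncPoly R N) (barColl R N m)

/-- The grading of `B̄[h]/h^N`. -/
def constGrading (ℬ : ℤ → Submodule (TruncPoly R N) B) :
    ℤ → Submodule (TruncPoly R N) (Constant R N B) :=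
  baseChangeGrading (TruncPoly R N) (barGrading R N ℬ)

/-- `f ≡ (id, 0, 0, …) (mod h)` for a sequence `f` of multilinear maps from `B` to `B̄[h]/h^N`. -/
def IsIdModH (f : Coll (TruncPoly R N) B (Constant R N B)) : Prop :=
  (∀ x : B, f 1 ![x] - 1 ⊗ₜ[R] toReduction R N 1 B x ∈
      hIdeal R N 1 • (⊤ : Submodule (TruncPoly R N) (Constant R N B))) ∧
    ∀ i, 2 ≤ i → ∀ x : Fin i → B,
      f i x ∈ hIdeal R N 1 • (⊤ : Submodule (TruncPoly R N) (Constant R N B))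

variable [Module R B]

/-- `σ : B̄ → B` is a splitting (as graded `R`-modules) of the projection `B → B̄ = B/h`. -/
structure IsSplitting (ℬ : ℤ → Submodule (TruncPoly R N) B)
    (σ : Reduction R N 1 B →ₗ[R] B) : Prop where
  section' : ∀ x, toReduction R N 1 B (σ x) = x
  graded : ∀ i, ∀ x ∈ barGrading R N ℬ i, σ x ∈ ℬ i

/-- `c` is the cochain `∂_h m = m⁽¹⁾ + 2 m⁽²⁾ h + ⋯ + n m⁽ⁿ⁾ h^{n-1}` on `B/h^n`, where
`m = m⁽⁰⁾ + m⁽¹⁾ h + ⋯ + m⁽ⁿ⁾ h^n` is the expansion of the sequence `m` of multilinear maps on the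
`R[h]/h^{n+1}`-module `B ≅ B̄[h]/h^{n+1}` with respect to the splitting `σ : B̄ → B`. Here the
coefficients `m⁽ᵏ⁾` are sequences of `R`-multilinear maps on `B̄`. -/
def IsHDerivative (n : ℕ) {B : Type*} [AddCommGroup B] [Module (TruncPoly R (n + 1)) B] [Module R B]
    (σ : Reduction R (n + 1) 1 B →ₗ[R] B) (m : Coll (TruncPoly R (n + 1)) B B)
    (c : Coll (TruncPoly R (n + 1) ⧸ hIdeal R (n + 1) n)
      (Reduction R (n + 1) n B) (Reduction R (n + 1) n B)) : Prop :=
  ∃ μ : ℕ → Coll R (Reduction R (n + 1) 1 B) (Reduction R (n + 1) 1 B),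
    (∀ (i : ℕ) (a : Fin i → Reduction R (n + 1) 1 B),
      m i (fun j => σ (a j)) =
        ∑ k ∈ Finset.range (n + 1), TruncPoly.h R (n + 1) ^ k • σ (μ k i a)) ∧
    ∀ (i : ℕ) (a : Fin i → Reduction R (n + 1) 1 B),
      c i (fun j => toReduction R (n + 1) n B (σ (a j))) =
        toReduction R (n + 1) n B (∑ k ∈ Finset.Icc 1 n,
          k • TruncPoly.h R (n + 1) ^ (k - 1) • σ (μ k i a))

end Truncated

end AInf

end

noncomputable section

set_option linter.unusedSectionVars false

/-! Desuspension turns sequences of multilinear maps into functions on words. `toList` absorbs the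
signs of the shift, and what remains of the Koszul rule is the operator `-ε`, the parity of the
shifted grading, applied to the letters to the left of an odd insertion. In this language `ins` is
composition with a coderivation and `comp` is composition with a morphism of coalgebras; the algebra
needed is the graded pre-Lie identity `ins_ins_sub` and the chain rule `ins_comp_eq_comp_der`.

The derivation `d/dh` does not act on `R[h]/h^{n+1}`, but the Euler derivation `E = h d/dh` acts
`R`-linearly on `B ≅ B̄[h]/h^{n+1}` (`Frame.euler`). By flatness the elements of `B` killed by `h`
form `h^n B`, so multiplication by `h` embeds `B/h^n` in `B` (`toReduction_eq_iff`): an equation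
over `R[h]/h^n` is the same as `h` times that equation over `R[h]/h^{n+1}`. The commutator of `E`
with `m` is `h ∂_h m`. Hence differentiating `m · m = 0` shows that `∂_h m` is a cocycle
(`smul_ins_deriv`), and `∂_h m = [m, b]` says exactly that the connection `D = E + h b`, a
coderivation, commutes with `m`.

Given such a `b`, integration in characteristic zero produces `f ≡ id` mod `h` which is horizontal,
meaning `E ∘ f = f · D`. Then `X = f · m` and `X = m⁽⁰⁾ · f` both solve `E ∘ X = X · D` and agree
mod `h`; uniqueness of solutions (`eq_zero_of_euler`) makes them equal, so `f` is a morphism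
(`exists_morphism`). Conversely, a morphism `f ≡ id` is invertible, so `∂_h f = f · b` can be solved
for `b`. This makes `f` horizontal, hence `f · [D, m] = 0` and `[D, m] = 0` (`exists_primitive`); no
division is needed here. As `m₁ = 0`, the quasi-isomorphism condition is bijectivity of `f₁`, which
is automatic because `f₁` is the identity up to a nilpotent. -/

namespace AInf

/-! ### Words: decompositions, coderivations and morphisms of coalgebras. -/

section Lists

variable {α A M M' : Type*} [AddCommGroup A] [AddCommGroup M] [AddCommGroup M']

/-- The sum of `φ x y` over all decompositions `l = x ++ y`. -/
def splitSum (φ : List α → List α → M) : List α → M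
  | [] => φ [] []
  | a :: l => φ [] (a :: l) + splitSum (fun x y => φ (a :: x) y) l

@[simp] theorem splitSum_nil (φ : List α → List α → M) : splitSum φ [] = φ [] [] := rfl

theorem splitSum_cons (φ : List α → List α → M) (a : α) (l : List α) :
    splitSum φ (a :: l) = φ [] (a :: l) + splitSum (fun x y => φ (a :: x) y) l := rfl

theorem splitSum_congr {φ ψ : List α → List α → M} {l : List α}
    (h : ∀ x y, x ++ y = l → φ x y = ψ x y) : splitSum φ l = splitSum ψ l := by
  induction l generalizing φ ψ with
  | nil => exact h [] [] rfl
  | cons a l ih =>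
    rw [splitSum_cons, splitSum_cons, h [] (a :: l) rfl,
      ih fun x y hxy => h (a :: x) y (by simp [hxy])]

theorem splitSum_add (φ ψ : List α → List α → M) (l : List α) :
    splitSum (fun x y => φ x y + ψ x y) l = splitSum φ l + splitSum ψ l := by
  induction l generalizing φ ψ with
  | nil => rfl
  | cons a l ih => simp only [splitSum_cons, ih]; abel

theorem splitSum_zero (l : List α) : splitSum (fun _ _ => (0 : M)) l = 0 := by
  induction l with
  | nil => rfl
  | cons a l ih => simp only [splitSum_cons, ih, add_zero]

theorem map_splitSum {F : Type*} [FunLike F M M'] [AddMonoidHomClass F M M'] (g : F)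
    (φ : List α → List α → M) (l : List α) :
    g (splitSum φ l) = splitSum (fun x y => g (φ x y)) l := by
  induction l generalizing φ with
  | nil => rfl
  | cons a l ih => simp only [splitSum_cons, ih, map_add]

theorem splitSum_neg (φ : List α → List α → M) (l : List α) :
    splitSum (fun x y => -φ x y) l = -splitSum φ l :=
  (map_splitSum (negAddMonoidHom (α := M)) φ l).symm

theorem splitSum_sub (φ ψ : List α → List α → M) (l : List α) :
    splitSum (fun x y => φ x y - ψ x y) l = splitSum φ l - splitSum ψ l := by
  simp only [sub_eq_add_neg, splitSum_add, splitSum_neg]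

theorem splitSum_smul {S : Type*} [CommRing S] [Module S M] (s : S) (φ : List α → List α → M)
    (l : List α) : splitSum (fun x y => s • φ x y) l = s • splitSum φ l :=
  (map_splitSum (LinearMap.lsmul S M s) φ l).symm

theorem splitSum_mem {S : Type*} [CommRing S] [Module S M] (N : Submodule S M)
    {φ : List α → List α → M} {l : List α} (h : ∀ x y, x ++ y = l → φ x y ∈ N) :
    splitSum φ l ∈ N := by
  induction l generalizing φ with
  | nil => exact h [] [] rfl
  | cons a l ih =>
    exact N.add_mem (h [] (a :: l) rfl) (ih fun x y hxy => h (a :: x) y (by simp [hxy]))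

theorem splitSum_map {β : Type*} (g : β → α) (φ : List α → List α → M) (l : List β) :
    splitSum φ (l.map g) = splitSum (fun x y => φ (x.map g) (y.map g)) l := by
  induction l generalizing φ with
  | nil => rfl
  | cons a l ih => simp only [List.map_cons, splitSum_cons, ih, List.map_nil]

/-- The cut falls either before the marked letter `a` or after it. -/
theorem splitSum_append_cons (φ : List α → List α → M) (u : List α) (a : α) (z : List α) :
    splitSum φ (u ++ a :: z) = splitSum (fun x y => φ x (y ++ a :: z)) u +
      splitSum (fun x y => φ (u ++ a :: x) y) z := by
  induction u generalizing φ with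
  | nil => rfl
  | cons b u ih => simp only [List.cons_append, splitSum_cons, ih, add_assoc]

theorem splitSum_comm {β : Type*} (φ : List α → List α → List β → List β → M) (l : List α)
    (l' : List β) :
    splitSum (fun x y => splitSum (fun u v => φ x y u v) l') l =
      splitSum (fun u v => splitSum (fun x y => φ x y u v) l) l' := by
  induction l generalizing φ with
  | nil => rfl
  | cons a l ih => simp only [splitSum_cons, ih, splitSum_add]

theorem splitSum_assoc (φ : List α → List α → List α → M) (l : List α) :
    splitSum (fun x w => splitSum (fun u v => φ u v w) x) l =
      splitSum (fun u w => splitSum (fun v z => φ u v z) w) l := by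
  induction l generalizing φ with
  | nil => rfl
  | cons a l ih =>
    simp only [splitSum_cons, splitSum_nil, splitSum_add, add_assoc, ← ih]

/-- This lemma and the next three reindex iterated decompositions: however the cuts are nested, the
sum runs over all decompositions into four (here) or five (below) consecutive pieces. -/
theorem splitSum_shift₁ (ψ : List α → List α → List α → List α → M) (l : List α) :
    splitSum (fun x w => splitSum (fun y z => splitSum (fun a v => ψ a v y z) x) w) l =
    splitSum (fun a w => splitSum (fun v w => splitSum (fun y z => ψ a v y z) w) w) l := by
  rw [← splitSum_assoc fun a v w => splitSum (fun y z => ψ a v y z) w]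
  exact splitSum_congr fun x w _ => splitSum_comm (fun y z a v => ψ a v y z) w x

theorem splitSum_shift (ψ : List α → List α → List α → List α → List α → M) (l : List α) :
    splitSum (fun x w => splitSum (fun y z => splitSum (fun a v => splitSum (fun b c =>
      ψ a b c y z) v) x) w) l =
    splitSum (fun a w => splitSum (fun b w => splitSum (fun c w => splitSum (fun y z =>
      ψ a b c y z) w) w) w) l := by
  rw [splitSum_shift₁ fun a v y z => splitSum (fun b c => ψ a b c y z) v]
  exact splitSum_congr fun a w _ => splitSum_shift₁ (ψ a) w

theorem splitSum_inner (ψ : List α → List α → List α → List α → List α → M) (l : List α) :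
    splitSum (fun x w => splitSum (fun y z => splitSum (fun a b => splitSum (fun c d =>
      ψ a b y c d) z) x) w) l =
    splitSum (fun a w => splitSum (fun b w => splitSum (fun y w => splitSum (fun c d =>
      ψ a b y c d) w) w) w) l := by
  rw [← splitSum_assoc fun a b w => splitSum (fun y w => splitSum (fun c d => ψ a b y c d) w) w]
  exact splitSum_congr fun x w _ =>
    splitSum_comm (fun y z a b => splitSum (fun c d => ψ a b y c d) z) w x

theorem splitSum_middle (ψ : List α → List α → List α → List α → List α → M) (l : List α) :
    splitSum (fun x w => splitSum (fun p z => splitSum (fun b q => splitSum (fun y c =>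
      ψ x b y c z) q) p) w) l =
    splitSum (fun a w => splitSum (fun b w => splitSum (fun y w => splitSum (fun c d =>
      ψ a b y c d) w) w) w) l := by
  refine splitSum_congr fun x w _ => ?_
  rw [splitSum_assoc fun b q z => splitSum (fun y c => ψ x b y c z) q]
  exact splitSum_congr fun b w _ => splitSum_assoc (fun y c z => ψ x b y c z) w

theorem splitSum_eq_sum (φ : List α → List α → M) (l : List α) :
    splitSum φ l = ∑ p ∈ Finset.HasAntidiagonal.antidiagonal l.length,
      φ (l.take p.1) (l.drop p.1) := by
  induction l generalizing φ with
  | nil => simp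
  | cons a l ih => simp [splitSum_cons, ih, Finset.Nat.antidiagonal_succ]

/-- A function on words which is multilinear in the letters. -/
structure ListMultilinear (S : Type*) [CommRing S] [Module S A] [Module S M]
    (c : List A → M) : Prop where
  map_add : ∀ x a b y, c (x ++ (a + b) :: y) = c (x ++ a :: y) + c (x ++ b :: y)
  map_smul : ∀ x (s : S) a y, c (x ++ (s • a) :: y) = s • c (x ++ a :: y)

/-- `∑ c (τ x, d y, z)` over the decompositions of a word into three pieces `x, y, z`. -/
def ins (τ : A → A) (c : List A → M) (d : List A → A) (l : List A) : M :=
  splitSum (fun x w => splitSum (fun y z => c (x.map τ ++ d y :: z)) w) l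

/-- `∑ c (a₁, …, δ aⱼ, …, aₙ)`. -/
def der (δ : A → A) : (List A → M) → List A → M
  | _, [] => 0
  | c, a :: l => c (δ a :: l) + der δ (fun y => c (a :: y)) l

/-- The words of length one, mapped by `δ`. -/
def single (δ : A → A) : List A → A
  | [a] => δ a
  | _ => 0

variable {A' : Type*} [AddCommGroup A']

/-- The sum of `c (f (x ++ y₁), f y₂, …, f yᵣ)` over the decompositions of a word into `y₁` and
nonempty pieces `y₂, …, yᵣ`. -/
def compAux (f : List A → A') : (List A' → M) → List A → List A → M
  | c, x, [] => c [f x]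
  | c, x, a :: l => compAux f c (x ++ [a]) l + compAux f (fun y => c (f x :: y)) [a] l

/-- The sum of `c (f y₁, …, f yᵣ)` over the decompositions of a word into nonempty pieces
`y₁, …, yᵣ`. -/
def comp (c : List A' → M) (f : List A → A') : List A → M
  | [] => c []
  | a :: l => compAux f c [a] l

@[simp] theorem comp_nil (c : List A' → M) (f : List A → A') : comp c f [] = c [] := rfl

theorem compAux_eq (c : List A' → M) (f : List A → A') (x l : List A) :
    compAux f c x l = splitSum (fun y z => comp (fun w => c (f (x ++ y) :: w)) f z) l := by
  induction l generalizing c x with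
  | nil => simp [compAux]
  | cons a l ih => simp [compAux, splitSum_cons, ih, comp, add_comm]

theorem comp_cons (c : List A' → M) (f : List A → A') (a : A) (l : List A) :
    comp c f (a :: l) = splitSum (fun y z => comp (fun w => c (f (a :: y) :: w)) f z) l := by
  rw [comp, compAux_eq]; rfl

/-- The first piece either ends before the marked letter `a` or contains it. The letter `b` in front
keeps that piece nonempty in both cases. -/
theorem comp_append_cons (c : List A' → M) (f : List A → A') (b : A) (u : List A) (a : A)
    (z : List A) : comp c f (b :: (u ++ a :: z)) =
      splitSum (fun x y => comp (fun w => c (f (b :: x) :: w)) f (y ++ a :: z)) u +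
      splitSum (fun x y => comp (fun w => c (f (b :: (u ++ a :: x)) :: w)) f y) z := by
  rw [comp_cons, splitSum_append_cons]

namespace ListMultilinear

variable {S : Type*} [CommRing S] [Module S A] [Module S A'] [Module S M]
  {c c' : List A → M}

/-- A multilinear function, as a linear function of one letter. -/
def slot (hc : ListMultilinear S c) (x y : List A) : A →ₗ[S] M where
  toFun a := c (x ++ a :: y)
  map_add' a b := hc.map_add x a b y
  map_smul' s a := hc.map_smul x s a y

theorem slot_apply (hc : ListMultilinear S c) (x y : List A) (a : A) :
    hc.slot x y a = c (x ++ a :: y) := rfl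

theorem map_zero (hc : ListMultilinear S c) (x y : List A) : c (x ++ 0 :: y) = 0 :=
  (hc.slot x y).map_zero

theorem map_zero_cons (hc : ListMultilinear S c) (y : List A) : c (0 :: y) = 0 :=
  hc.map_zero [] y

theorem map_sub (hc : ListMultilinear S c) (x y : List A) (a b : A) :
    c (x ++ (a - b) :: y) = c (x ++ a :: y) - c (x ++ b :: y) :=
  (hc.slot x y).map_sub a b

theorem map_splitSum (hc : ListMultilinear S c) (x y : List A) (φ : List α → List α → A)
    (l : List α) :
    c (x ++ splitSum φ l :: y) = splitSum (fun u v => c (x ++ φ u v :: y)) l :=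
  AInf.map_splitSum (hc.slot x y) φ l

theorem cons (hc : ListMultilinear S c) (a : A) : ListMultilinear S fun l => c (a :: l) :=
  ⟨fun x => hc.map_add (a :: x), fun x => hc.map_smul (a :: x)⟩

theorem add (hc : ListMultilinear S c) (hc' : ListMultilinear S c') :
    ListMultilinear S fun l => c l + c' l :=
  ⟨fun x a b y => by rw [hc.map_add, hc'.map_add]; abel,
    fun x s a y => by rw [hc.map_smul, hc'.map_smul, smul_add]⟩

theorem sub (hc : ListMultilinear S c) (hc' : ListMultilinear S c') :
    ListMultilinear S fun l => c l - c' l :=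
  ⟨fun x a b y => by rw [hc.map_add, hc'.map_add]; abel,
    fun x s a y => by rw [hc.map_smul, hc'.map_smul, smul_sub]⟩

theorem zero : ListMultilinear S fun _ : List A => (0 : M) :=
  ⟨fun _ _ _ _ => by simp, fun _ _ _ _ => by simp⟩

theorem smul (hc : ListMultilinear S c) (s : S) : ListMultilinear S fun l => s • c l :=
  ⟨fun x a b y => by rw [hc.map_add, smul_add],
    fun x t a y => by rw [hc.map_smul, smul_comm]⟩

theorem linearMap_comp [Module S M'] (g : M →ₗ[S] M') (hc : ListMultilinear S c) :
    ListMultilinear S fun l => g (c l) :=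
  ⟨fun x a b y => by rw [hc.map_add, _root_.map_add],
    fun x t a y => by rw [hc.map_smul, LinearMap.map_smul]⟩

theorem restrictScalars {R : Type*} [CommRing R] [Algebra R S] [Module R A] [Module R M]
    [IsScalarTower R S A] [IsScalarTower R S M] (hc : ListMultilinear S c) :
    ListMultilinear R c :=
  ⟨hc.map_add, fun x r a y => by
    rw [← algebraMap_smul S r a, hc.map_smul, algebraMap_smul]⟩

/-- Letters are replaced by generators one at a time, those already treated being collected in the
prefix `x`. Additive generators are the right test set for functions that are linear over the base
ring `R` only, such as those involving the Euler derivation. -/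
theorem ext_of_closure (hc : ListMultilinear S c) (hc' : ListMultilinear S c') {G : Set A}
    (hG : AddSubmonoid.closure G = ⊤) (h : ∀ l : List A, (∀ a ∈ l, a ∈ G) → c l = c' l) :
    c = c' := by
  suffices H : ∀ l x : List A, (∀ a ∈ x, a ∈ G) → c (x ++ l) = c' (x ++ l) from
    funext fun l => H l [] (by simp)
  intro l
  induction l with
  | nil => intro x hx; simpa using h x hx
  | cons a l ih =>
    intro x hx
    have ha : a ∈ AddSubmonoid.closure G := hG ▸ AddSubmonoid.mem_top a
    induction ha using AddSubmonoid.closure_induction with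
    | mem g hg =>
      have := ih (x ++ [g]) (by
        intro b hb
        rcases List.mem_append.1 hb with hb | hb
        · exact hx b hb
        · rw [List.mem_singleton.1 hb]; exact hg)
      simpa using this
    | zero => rw [hc.map_zero, hc'.map_zero]
    | add u v _ _ hu hv => rw [hc.map_add, hc'.map_add, hu, hv]

theorem mem_of_span (hc : ListMultilinear S c) {G : Set A} (hG : Submodule.span S G = ⊤)
    (N : Submodule S M) (h : ∀ l : List A, (∀ a ∈ l, a ∈ G) → c l ∈ N) (l : List A) :
    c l ∈ N := by
  suffices H : ∀ l x : List A, (∀ a ∈ x, a ∈ G) → c (x ++ l) ∈ N from H l [] (by simp)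
  intro l
  induction l with
  | nil => intro x hx; simpa using h x hx
  | cons a l ih =>
    intro x hx
    have ha : a ∈ Submodule.span S G := hG ▸ Submodule.mem_top
    induction ha using Submodule.span_induction with
    | mem g hg =>
      have := ih (x ++ [g]) (by
        intro b hb
        rcases List.mem_append.1 hb with hb | hb
        · exact hx b hb
        · rw [List.mem_singleton.1 hb]; exact hg)
      simpa using this
    | zero => rw [hc.map_zero]; exact N.zero_mem
    | add u v _ _ hu hv => rw [hc.map_add]; exact N.add_mem hu hv
    | smul s u _ hu => rw [hc.map_smul]; exact N.smul_mem _ hu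

end ListMultilinear

section ins

variable {S : Type*} [CommRing S] [Module S A] [Module S A'] [Module S M]
  (τ δ : A → A) {c c' : List A → M} {d d' : List A → A}

theorem ins_nil : ins τ c d [] = c [d []] := rfl

theorem ins_cons (a : A) (l : List A) :
    ins τ c d (a :: l) = splitSum (fun y z => c (d y :: z)) (a :: l) +
      ins τ (fun l => c (τ a :: l)) d l := rfl

theorem ins_append_cons (u : List A) (a : A) (z : List A) :
    ins τ c d (u ++ a :: z) =
      splitSum (fun x v => splitSum (fun y w => c (x.map τ ++ d y :: (w ++ a :: z))) v) u +
      splitSum (fun x v => splitSum (fun y w => c (x.map τ ++ d (v ++ a :: y) :: w)) z) u +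
      splitSum (fun x v => splitSum (fun y w => c ((u ++ a :: x).map τ ++ d y :: w)) v) z := by
  simp only [ins, splitSum_append_cons, splitSum_add]

theorem ins_add_left (l : List A) :
    ins τ (fun l => c l + c' l) d l = ins τ c d l + ins τ c' d l := by
  simp only [ins, splitSum_add]

theorem ins_sub_left (l : List A) :
    ins τ (fun l => c l - c' l) d l = ins τ c d l - ins τ c' d l := by
  simp only [ins, splitSum_sub]

theorem ins_smul_left (s : S) (l : List A) :
    ins τ (fun l => s • c l) d l = s • ins τ c d l := by
  simp only [ins, splitSum_smul]

theorem ins_add_right (hc : ListMultilinear S c) (l : List A) :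
    ins τ c (fun l => d l + d' l) l = ins τ c d l + ins τ c d' l := by
  simp only [ins, hc.map_add, splitSum_add]

theorem ins_sub_right (hc : ListMultilinear S c) (l : List A) :
    ins τ c (fun l => d l - d' l) l = ins τ c d l - ins τ c d' l := by
  simp only [ins, hc.map_sub, splitSum_sub]

theorem ins_smul_right (hc : ListMultilinear S c) (s : S) (l : List A) :
    ins τ c (fun l => s • d l) l = s • ins τ c d l := by
  simp only [ins, hc.map_smul, splitSum_smul]

theorem ins_zero_right (hc : ListMultilinear S c) (l : List A) :
    ins τ c (fun _ => 0) l = 0 := by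
  simp only [ins, hc.map_zero, splitSum_zero]

theorem map_ins {F : Type*} [FunLike F M M'] [AddMonoidHomClass F M M'] (g : F) (l : List A) :
    g (ins τ c d l) = ins τ (fun l => g (c l)) d l := by
  simp only [ins, map_splitSum]

theorem ins_mem_left (N : Submodule S M) (h : ∀ l, c l ∈ N) (l : List A) : ins τ c d l ∈ N :=
  splitSum_mem N fun _ _ _ => splitSum_mem N fun _ _ _ => h _

theorem ListMultilinear.ins (τ : A →ₗ[S] A) (hc : ListMultilinear S c)
    (hd : ListMultilinear S d) : ListMultilinear S (ins τ c d) := by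
  constructor
  · intro u a b z
    simp only [ins_append_cons, hd.map_add, hc.map_add, splitSum_add, List.map_append,
      List.map_cons, _root_.map_add]
    have h1 : ∀ x v y w, c (x ++ d y :: (v ++ (a + b) :: w)) =
        c (x ++ d y :: (v ++ a :: w)) + c (x ++ d y :: (v ++ b :: w)) := fun x v y w => by
      simpa using hc.map_add (x ++ d y :: v) a b w
    have h2 : ∀ x y w, c (u.map τ ++ (τ a + τ b) :: x ++ d y :: w) =
        c (u.map τ ++ τ a :: x ++ d y :: w) + c (u.map τ ++ τ b :: x ++ d y :: w) :=
      fun x y w => by simpa using hc.map_add (u.map τ) (τ a) (τ b) (x ++ d y :: w)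
    simp only [h1, h2, splitSum_add]
    abel
  · intro u s a z
    simp only [ins_append_cons, hd.map_smul, hc.map_smul, splitSum_smul, List.map_append,
      List.map_cons, LinearMap.map_smul]
    have h1 : ∀ x v y w, c (x ++ d y :: (v ++ (s • a) :: w)) =
        s • c (x ++ d y :: (v ++ a :: w)) := fun x v y w => by
      simpa using hc.map_smul (x ++ d y :: v) s a w
    have h2 : ∀ x y w, c (u.map τ ++ (s • τ a) :: x ++ d y :: w) =
        s • c (u.map τ ++ τ a :: x ++ d y :: w) :=
      fun x y w => by simpa using hc.map_smul (u.map τ) s (τ a) (x ++ d y :: w)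
    simp only [h1, h2, splitSum_smul, smul_add]

/-- The composites of coderivations satisfy the (graded) pre-Lie identity. -/
theorem ins_ins_sub (hc : ListMultilinear S c) (hd : ∀ l, d (l.map τ) = τ (d l)) (l : List A) :
    ins τ (ins id c d) d' l - ins id (ins τ c d') d l =
      ins τ c (fun y => ins τ d d' y - ins id d' d y) l := by
  -- The three sums correspond to `d` on the left of `d'`, `d'` nested inside `d`, and `d'` on the
  -- left of `d`. In the first one `hd` moves `τ` out of `d`.
  have h₁ : ins τ (ins id c d) d' l =
      splitSum (fun x w => splitSum (fun y w => splitSum (fun z w => splitSum (fun u v =>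
        c (x.map τ ++ τ (d y) :: (z.map τ ++ d' u :: v))) w) w) w) l +
      ins τ c (ins τ d d') l +
      splitSum (fun x w => splitSum (fun y w => splitSum (fun z w => splitSum (fun u v =>
        c (x.map τ ++ d' y :: (z ++ d u :: v))) w) w) w) l := by
    rw [ins]
    simp only [ins_append_cons, splitSum_add, splitSum_map, List.map_id, hd]
    congr 2
    · rw [splitSum_shift fun x y z u v => c (x.map τ ++ τ (d y) :: (z.map τ ++ d' u :: v))]
    · rw [splitSum_inner fun x y z u v => c (x.map τ ++ d (y.map τ ++ d' z :: u) :: v),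
        ← splitSum_middle]
      simp only [ins, hc.map_splitSum]
    · simp
  -- The same two sums with disjoint insertions appear here, so only the nested ones survive in the
  -- difference.
  have h₂ : ins id (ins τ c d') d l =
      splitSum (fun x w => splitSum (fun y w => splitSum (fun z w => splitSum (fun u v =>
        c (x.map τ ++ d' y :: (z ++ d u :: v))) w) w) w) l +
      ins τ c (ins id d' d) l +
      splitSum (fun x w => splitSum (fun y w => splitSum (fun z w => splitSum (fun u v =>
        c (x.map τ ++ τ (d y) :: (z.map τ ++ d' u :: v))) w) w) w) l := by
    rw [ins]
    simp only [ins_append_cons, splitSum_add, List.map_id]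
    congr 2
    · rw [splitSum_shift fun x y z u v => c (x.map τ ++ d' y :: (z ++ d u :: v))]
    · rw [splitSum_inner fun x y z u v => c (x.map τ ++ d' (y ++ d z :: u) :: v),
        ← splitSum_middle]
      simp only [ins, hc.map_splitSum, List.map_id]
    · simp
  rw [h₁, h₂, ins_sub_right τ hc]
  abel

theorem der_cons (a : A) (l : List A) :
    der δ c (a :: l) = c (δ a :: l) + der δ (fun y => c (a :: y)) l := rfl

theorem ins_single (hc : ListMultilinear S c) (l : List A) :
    ins id c (single δ) l = der δ c l := by
  induction l generalizing c with
  | nil => simpa [ins_nil, single, der] using hc.map_zero_cons []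
  | cons a l ih =>
    rw [ins_cons, der_cons, id, ih (hc.cons a)]
    congr 1
    rw [splitSum_cons]
    cases l with
    | nil => simp [single, hc.map_zero_cons]
    | cons b l =>
      rw [splitSum_cons]
      simp [single, hc.map_zero_cons, splitSum_zero]

theorem single_ins (l : List A) :
    ins τ (single δ) d l = δ (d l) := by
  cases l with
  | nil => simp [ins_nil, single]
  | cons a l =>
    rw [ins_cons]
    have h₁ : ∀ (φ : List A → A) (l : List A),
        splitSum (fun y z => single δ (φ y :: z)) l = δ (φ l) := by
      intro φ l
      induction l generalizing φ with
      | nil => simp [single]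
      | cons a l ih =>
        rw [splitSum_cons, ih fun l => φ (a :: l)]
        simp [single]
    have h₂ : ∀ l : List A, ins τ (fun l => single δ (τ a :: l)) d l = 0 := by
      intro l
      rw [ins, ← splitSum_zero l]
      refine splitSum_congr fun x w _ => ?_
      rw [← splitSum_zero w]
      refine splitSum_congr fun y z _ => ?_
      cases x <;> rfl
    rw [h₁, h₂, add_zero]

theorem ListMultilinear.single (δ : A →ₗ[S] A) : ListMultilinear S (single δ) := by
  constructor
  · rintro (_ | ⟨a, x⟩) b b' (_ | ⟨c, y⟩) <;> simp [AInf.single]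
  · rintro (_ | ⟨a, x⟩) s b (_ | ⟨c, y⟩) <;> simp [AInf.single]

theorem ListMultilinear.der (δ : A →ₗ[S] A) (hc : ListMultilinear S c) :
    ListMultilinear S (der δ c) := by
  rw [← funext (ins_single (S := S) δ hc)]
  exact hc.ins LinearMap.id (ListMultilinear.single δ)

end ins

section comp

variable {S : Type*} [CommRing S] [Module S A] [Module S A'] [Module S M]
  {c c' : List A' → M} {f : List A → A'}

theorem compAux_add (x l : List A) :
    compAux f (fun l => c l + c' l) x l = compAux f c x l + compAux f c' x l := by
  induction l generalizing c c' x with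
  | nil => rfl
  | cons a l ih => simp only [compAux, ih]; abel

theorem comp_add_left (l : List A) :
    comp (fun l => c l + c' l) f l = comp c f l + comp c' f l := by
  cases l with
  | nil => rfl
  | cons a l => exact compAux_add _ _

theorem compAux_smul (s : S) (x l : List A) :
    compAux f (fun l => s • c l) x l = s • compAux f c x l := by
  induction l generalizing c x with
  | nil => rfl
  | cons a l ih => simp only [compAux, ih, smul_add]

theorem comp_smul_left (s : S) (l : List A) : comp (fun l => s • c l) f l = s • comp c f l := by
  cases l with
  | nil => rfl
  | cons a l => exact compAux_smul _ _ _

theorem compAux_mem (N : Submodule S M) (h : ∀ l, c l ∈ N) (x l : List A) :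
    compAux f c x l ∈ N := by
  induction l generalizing c x with
  | nil => exact h _
  | cons a l ih => exact N.add_mem (ih h _) (ih (fun l => h _) _)

theorem comp_mem (N : Submodule S M) (h : ∀ l, c l ∈ N) (l : List A) : comp c f l ∈ N := by
  cases l with
  | nil => exact h _
  | cons a l => exact compAux_mem N h _ _

/-- `comp` as a linear function of a letter put in front of the arguments of `c`. -/
def ListMultilinear.compCons (hc : ListMultilinear S c) (f : List A → A') (l : List A) :
    A' →ₗ[S] M where
  toFun a := comp (fun w => c (a :: w)) f l
  map_add' a b := by
    rw [← comp_add_left]; congr 1; funext w; exact hc.map_add [] a b w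
  map_smul' s a := by
    rw [RingHom.id_apply, ← comp_smul_left]; congr 1; funext w; exact hc.map_smul [] s a w

theorem ListMultilinear.compCons_apply (hc : ListMultilinear S c) (f : List A → A') (l : List A)
    (a : A') : hc.compCons f l a = comp (fun w => c (a :: w)) f l := rfl

theorem ListMultilinear.comp (hc : ListMultilinear S c) (hf : ListMultilinear S f) :
    ListMultilinear S (comp c f) := by
  constructor
  · intro x a b y
    -- The induction is strong because splitting off the first piece shortens the prefix by an
    -- arbitrary amount.
    induction hn : x.length using Nat.strong_induction_on generalizing x c with
    | _ n ih =>
    cases x with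
    | nil =>
      simp only [List.nil_append, comp_cons, ← hc.compCons_apply, ← splitSum_add,
        ← _root_.map_add]
      exact splitSum_congr fun u v _ => congrArg _ (hf.map_add [] a b u)
    | cons g x =>
      simp only [List.cons_append, comp_append_cons]
      rw [add_add_add_comm, ← splitSum_add, ← splitSum_add]
      congr 1
      · refine splitSum_congr fun u v huv => ih v.length ?_ (hc.cons _) v rfl
        have := congrArg List.length huv
        simp at this hn
        omega
      · refine splitSum_congr fun u v _ => ?_
        simp only [← hc.compCons_apply, ← _root_.map_add]
        rw [← List.cons_append, hf.map_add]; rfl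
  · intro x s a y
    induction hn : x.length using Nat.strong_induction_on generalizing x c with
    | _ n ih =>
    cases x with
    | nil =>
      simp only [List.nil_append, comp_cons, ← hc.compCons_apply, ← splitSum_smul,
        ← LinearMap.map_smul]
      exact splitSum_congr fun u v _ => congrArg _ (hf.map_smul [] s a u)
    | cons g x =>
      simp only [List.cons_append, comp_append_cons]
      rw [smul_add, ← splitSum_smul, ← splitSum_smul]
      congr 1
      · refine splitSum_congr fun u v huv => ih v.length ?_ (hc.cons _) v rfl
        have := congrArg List.length huv
        simp at this hn
        omega
      · refine splitSum_congr fun u v _ => ?_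
        simp only [← hc.compCons_apply, ← LinearMap.map_smul]
        rw [← List.cons_append, hf.map_smul]; rfl

/-- If `f` intertwines the coderivation with components `d` and `δ`, then so does the morphism of
coalgebras with components `f`. -/
theorem ins_comp_eq_comp_der (hc : ListMultilinear S c) (hf : ListMultilinear S f)
    {d : List A → A} (hd : d [] = 0) (δ : A' →ₗ[S] A') (h : ∀ l, ins id f d l = δ (f l))
    (l : List A) : ins id (comp c f) d l = comp (der δ c) f l := by
  induction hn : l.length using Nat.strong_induction_on generalizing l c with
  | _ n ih =>
  cases l with
  | nil =>
    have := h []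
    rw [ins_nil, hd, hf.map_zero_cons] at this
    rw [ins_nil, hd, (hc.comp hf).map_zero_cons]; rfl
  | cons a l =>
    -- Insertions at the front of the word. The term in which the first piece is just `d []`
    -- vanishes, so the first piece can be taken to use up `a :: u`.
    have h₁ : splitSum (fun y z => comp c f (d y :: z)) (a :: l) =
        splitSum (fun u v => splitSum (fun y z => hc.compCons f v (f (d y :: z))) (a :: u)) l := by
      simp only [comp_cons, ← hc.compCons_apply]
      rw [← splitSum_assoc fun y z v => hc.compCons f v (f (d y :: z)), splitSum_cons]
      simp [hd, hf.map_zero_cons]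
    -- Insertions behind the letter `a`: into a later piece, where the induction hypothesis applies,
    -- or into the first piece, where they complete `h₁` to `ins id f d (a :: u)`.
    have h₂ : ins id (fun l => comp c f (a :: l)) d l =
        splitSum (fun u v => ins id (comp (fun w => c (f (a :: u) :: w)) f) d v) l +
        splitSum (fun u v => ins id (fun w => hc.compCons f v (f (a :: w))) d u) l := by
      simp only [ins, List.map_id, comp_append_cons, splitSum_add]
      congr 1
      · exact splitSum_shift₁ (fun u x y z => comp (fun w => c (f (a :: u) :: w)) f
          (x ++ d y :: z)) l
      · rw [splitSum_assoc fun x q v => splitSum (fun y z => hc.compCons f v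
          (f (a :: (x ++ d y :: z)))) q]
        refine splitSum_congr fun x w _ => ?_
        rw [splitSum_assoc fun y z v => hc.compCons f v (f (a :: (x ++ d y :: z)))]
        rfl
    rw [ins_cons, comp_cons, h₁]
    simp only [id]
    rw [h₂, add_left_comm, ← splitSum_add, ← splitSum_add]
    refine splitSum_congr fun u v huv => ?_
    simp only [der_cons, comp_add_left]
    rw [ih v.length ?_ (hc.cons _) v rfl, add_comm, ← map_splitSum, ← map_ins, ← _root_.map_add,
      ← hc.compCons_apply, ← h, ins_cons]
    · rfl
    · have := congrArg List.length huv
      simp at this hn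
      omega

end comp

end Lists

/-! ### Words cut out of a sequence, and sums over compositions of an integer. -/

section Words

variable {A A' M : Type*} [AddCommGroup A] [AddCommGroup A'] [AddCommGroup M]

/-- The word `a 0, …, a (n - 1)`. -/
def word (a : ℕ → A) (n : ℕ) : List A := (List.range n).map a

@[simp] theorem length_word (a : ℕ → A) (n : ℕ) : (word a n).length = n := by simp [word]

theorem word_add (a : ℕ → A) (m n : ℕ) :
    word a (m + n) = word a m ++ word (fun j => a (m + j)) n := by
  simp [word, List.range_add, Function.comp_def]

theorem word_succ (a : ℕ → A) (n : ℕ) : word a (n + 1) = a 0 :: word (fun j => a (j + 1)) n := by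
  rw [add_comm, word_add]; simp [word, add_comm]

theorem getElem_word (a : ℕ → A) (n j : ℕ) (h : j < (word a n).length) : (word a n)[j] = a j := by
  simp [word]

theorem splitSum_word (φ : List A → List A → M) (a : ℕ → A) (n : ℕ) :
    splitSum φ (word a n) = ∑ p ∈ Finset.HasAntidiagonal.antidiagonal n,
      φ (word a p.1) (word (fun j => a (p.1 + j)) p.2) := by
  rw [splitSum_eq_sum, length_word]
  refine Finset.sum_congr rfl fun p hp => ?_
  obtain rfl := Finset.HasAntidiagonal.mem_antidiagonal.1 hp
  rw [word_add, List.take_left' (by simp), List.drop_left' (by simp)]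

/-- The decomposition of the word `a 0, a 1, …` into words of given lengths. -/
def wordBlocks : (ℕ → A) → List ℕ → List (List A)
  | _, [] => []
  | a, n :: ns => word a n :: wordBlocks (fun j => a (n + j)) ns

theorem length_wordBlocks (a : ℕ → A) (ns : List ℕ) :
    (wordBlocks a ns).length = ns.length := by
  induction ns generalizing a with
  | nil => rfl
  | cons n ns ih => simp [wordBlocks, ih]

theorem getElem_wordBlocks (a : ℕ → A) (ns : List ℕ) (i : ℕ) (h : i < (wordBlocks a ns).length)
    (h' : i < ns.length) :
    (wordBlocks a ns)[i] = word (fun j => a ((ns.take i).sum + j)) ns[i] := by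
  induction ns generalizing a i with
  | nil => simp at h'
  | cons n ns ih =>
    cases i with
    | zero => simp [wordBlocks]
    | succ i =>
      simp only [wordBlocks, List.getElem_cons_succ, List.take_succ_cons, List.sum_cons]
      rw [ih _ _ _ (by simpa using h')]
      simp [add_assoc]

theorem sum_composition_succ (φ : List ℕ → M) (n : ℕ) :
    ∑ κ : Composition (n + 1), φ κ.blocks =
      ∑ p ∈ Finset.HasAntidiagonal.antidiagonal n, ∑ κ : Composition p.2,
        φ ((p.1 + 1) :: κ.blocks) := by
  rw [Finset.sum_sigma']
  symm
  refine Finset.sum_bij (fun x hx => ⟨(x.1.1 + 1) :: x.2.blocks, ?_, ?_⟩) ?_ ?_ ?_ ?_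
  · intro i hi
    rcases List.mem_cons.1 hi with rfl | hi
    · omega
    · exact x.2.blocks_pos hi
  · have := Finset.HasAntidiagonal.mem_antidiagonal.1 (Finset.mem_sigma.1 hx).1
    rw [List.sum_cons, x.2.blocks_sum]; omega
  · intros; exact Finset.mem_univ _
  · rintro ⟨⟨p, q⟩, κ⟩ hx ⟨⟨p', q'⟩, κ'⟩ hx' h
    have h₁ := Finset.HasAntidiagonal.mem_antidiagonal.1 (Finset.mem_sigma.1 hx).1
    have h₂ := Finset.HasAntidiagonal.mem_antidiagonal.1 (Finset.mem_sigma.1 hx').1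
    have h₃ := congrArg Composition.blocks h
    simp only [List.cons.injEq, add_left_inj] at h₁ h₂ h₃
    obtain ⟨rfl, h₃⟩ := h₃
    obtain rfl : q = q' := by omega
    rw [Composition.ext h₃]
  · rintro ⟨_ | ⟨p, ns⟩, h₁, h₂⟩ _
    · simp at h₂
    · have hp := h₁ List.mem_cons_self
      refine ⟨⟨(p - 1, ns.sum), ⟨ns, fun h => h₁ (List.mem_cons_of_mem _ h), rfl⟩⟩, ?_, ?_⟩
      · simp only [Finset.mem_sigma, Finset.HasAntidiagonal.mem_antidiagonal, Finset.mem_univ,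
          and_true]
        rw [List.sum_cons] at h₂; omega
      · ext1
        simp only [List.cons.injEq, and_true]
        omega
  · intros; rfl

theorem comp_word (c : List A' → M) (f : List A → A') (a : ℕ → A) (n : ℕ) :
    comp c f (word a n) = ∑ κ : Composition n, c ((wordBlocks a κ.blocks).map f) := by
  induction n using Nat.strong_induction_on generalizing c a with
  | _ n ih =>
  cases n with
  | zero =>
    rw [Finset.sum_eq_single (Composition.ones 0) (fun b _ hb => (hb (Composition.ext (by
      rw [b.blocks_eq_nil.2 rfl, (Composition.ones 0).blocks_eq_nil.2 rfl]))).elim) (by simp)]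
    simp [word, wordBlocks]
  | succ n =>
    rw [sum_composition_succ fun ns => c ((wordBlocks a ns).map f), word_succ, comp_cons,
      splitSum_word]
    refine Finset.sum_congr rfl fun p hp => ?_
    have := Finset.HasAntidiagonal.mem_antidiagonal.1 hp
    rw [ih p.2 (by omega)]
    simp only [wordBlocks, List.map_cons, word_succ]
    refine Finset.sum_congr rfl fun κ _ => ?_
    congr; funext j; congr 1; omega

end Words

/-! ### Desuspension: multilinear maps as functions on words. -/

section Twist

variable {S A A' M : Type*} [CommRing S] [AddCommGroup A] [AddCommGroup A'] [AddCommGroup M]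
  [Module S A] [Module S A'] [Module S M]

/-- The function on words attached to a sequence of multilinear maps, with the signs of the
desuspension: `a₀ ⊗ ⋯ ⊗ a_{n-1} ↦ cₙ (ε^{n-1} a₀ ⊗ ⋯ ⊗ ε a_{n-2} ⊗ a_{n-1})`. -/
def toList (ε : Module.End S A) (c : Coll S A M) (l : List A) : M :=
  c l.length fun j => (ε ^ (l.length - 1 - j)) l[j]

theorem toList_eq (ε : Module.End S A) (c : Coll S A M) {l : List A} {n : ℕ} (hn : l.length = n) :
    toList ε c l = c n fun j => (ε ^ (n - 1 - j)) (l.getD j 0) := by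
  subst hn
  simp [toList]

theorem toList_multilinear (ε : Module.End S A) (c : Coll S A M) :
    ListMultilinear S (toList ε c) := by
  -- The power of `ε` applied to a letter depends only on the number of letters after it, so
  -- changing one letter changes one argument of `c`.
  have key (x : List A) (a : A) (y : List A) : toList ε c (x ++ a :: y) =
      c (x.length + (y.length + 1)) (Function.update (fun j =>
        (ε ^ (x.length + (y.length + 1) - 1 - j)) ((x ++ 0 :: y).getD j 0))
        ⟨x.length, by omega⟩ ((ε ^ y.length) a)) := by
    rw [toList_eq ε c (n := x.length + (y.length + 1)) (by simp)]
    congr 1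
    funext j
    rcases lt_trichotomy (j : ℕ) x.length with h | h | h
    · rw [Function.update_of_ne (fun h' => by simp [h'] at h)]
      simp [List.getElem_append_left h]
    · have h' : j = ⟨x.length, by omega⟩ := Fin.ext h
      rw [h', Function.update_self]
      simp only [List.getD_eq_getElem?_getD, le_refl, List.getElem?_append_right, Nat.sub_self,
        List.length_cons, Nat.zero_lt_succ, List.getElem?_eq_getElem, List.getElem_cons_zero,
        Option.getD_some]
      congr 2; omega
    · rw [Function.update_of_ne (fun h' => by simp [h'] at h)]
      obtain ⟨i, hi⟩ : ∃ i, (j : ℕ) = x.length + (i + 1) := ⟨j - x.length - 1, by omega⟩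
      simp [hi, List.getElem?_append_right]
  constructor
  · intro x a b y
    simp only [key, map_add, MultilinearMap.map_update_add]
  · intro x s a y
    simp only [key, map_smul, MultilinearMap.map_update_smul]

theorem ofFn_update {n : ℕ} (g : Fin n → A → A) (v : Fin n → A) (i : Fin n) (x : A) :
    (List.ofFn fun j => g j (Function.update v i x j)) =
      (List.ofFn fun j => g j (v j)).take i ++
        g i x :: (List.ofFn fun j => g j (v j)).drop (i + 1) := by
  have h := List.set_eq_take_append_cons_drop (l := List.ofFn fun j => g j (v j)) (i := i)
    (a := g i x)
  rw [if_pos (by simp)] at h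
  rw [← h]
  refine List.ext_getElem (by simp) fun j h₁ h₂ => ?_
  rw [List.getElem_set, List.getElem_ofFn, List.getElem_ofFn]
  by_cases hj : (i : ℕ) = j
  · subst hj; simp
  · rw [if_neg hj, Function.update_of_ne fun h => hj (by rw [← h])]

/-- The sequence of multilinear maps attached to a function on words; for `ε² = 1` it is inverse to
`toList`. -/
def ofList (ε : Module.End S A) (c : List A → M) (hc : ListMultilinear S c) : Coll S A M :=
  fun i => MultilinearMap.mk' (fun v => c (List.ofFn fun j => (ε ^ (i - 1 - j)) (v j)))
    (fun v j x y => by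
      simp only [ofFn_update (fun j : Fin i => ⇑(ε ^ (i - 1 - (j : ℕ)))), map_add, hc.map_add])
    (fun v j s x => by
      simp only [ofFn_update (fun j : Fin i => ⇑(ε ^ (i - 1 - (j : ℕ)))), map_smul, hc.map_smul])

theorem toList_ofList {ε : Module.End S A} (hε : ε * ε = 1) (c : List A → M)
    (hc : ListMultilinear S c) : toList ε (ofList ε c hc) = c := by
  funext l
  have h (k : ℕ) (x : A) : (ε ^ k) ((ε ^ k) x) = x := by
    rw [← Module.End.mul_apply, ← pow_add, ← two_mul, pow_mul, pow_two, hε, one_pow,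
      Module.End.one_apply]
  simp only [toList, ofList, MultilinearMap.mk'_apply, h]
  congr 1
  exact List.ofFn_getElem

end Twist

/-! ### Comparison with the Koszul signs of the definitions. -/

section Signs

variable {S A A' M : Type*} [CommRing S] [AddCommGroup A] [AddCommGroup A'] [AddCommGroup M]
  [Module S A] [Module S A'] [Module S M]

theorem negOnePow_sum {ι : Type*} (s : Finset ι) (f : ι → ℤ) :
    Int.negOnePow (∑ i ∈ s, f i) = ∏ i ∈ s, Int.negOnePow (f i) := by
  classical
  induction s using Finset.induction_on with
  | empty => rfl
  | insert i s hi ih => rw [Finset.sum_insert hi, Finset.prod_insert hi, Int.negOnePow_add, ih]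

theorem negOnePow_smul_smul (p q : ℤ) (x : M) :
    Int.negOnePow p • Int.negOnePow q • x = Int.negOnePow (p + q) • x := by
  rw [smul_smul, Int.negOnePow_add]

theorem units_smul_eq (u : ℤˣ) (x : M) : u • x = ((u : ℤ) : S) • x := by
  rw [Units.smul_def, Int.cast_smul_eq_zsmul]

theorem map_negOnePow_smul (g : A →ₗ[S] A') (p : ℤ) (x : A) :
    g (Int.negOnePow p • x) = Int.negOnePow p • g x := by
  rw [units_smul_eq (S := S), map_smul, ← units_smul_eq]

theorem multilinearMap_negOnePow_smul {n : ℕ} (c : MultilinearMap S (fun _ : Fin n => A) M)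
    (p : Fin n → ℤ) (v : Fin n → A) :
    c (fun j => Int.negOnePow (p j) • v j) = Int.negOnePow (∑ j, p j) • c v := by
  simp only [fun j => units_smul_eq (S := S) (Int.negOnePow (p j)) (v j)]
  rw [MultilinearMap.map_smul_univ, negOnePow_sum, units_smul_eq (S := S)]
  simp

/-- `ε` is the parity operator `(-1)^i` on the component `𝒜 i` of a grading. -/
structure IsParity (𝒜 : ℤ → Submodule S A) (ε : Module.End S A) : Prop where
  apply : ∀ i, ∀ a ∈ 𝒜 i, ε a = Int.negOnePow i • a
  span : AddSubmonoid.closure (⋃ i, (𝒜 i : Set A)) = ⊤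

namespace IsParity

variable {𝒜 : ℤ → Submodule S A} {ε : Module.End S A} (hε : IsParity 𝒜 ε)
include hε

theorem pow_apply (k : ℕ) (i : ℤ) (a : A) (ha : a ∈ 𝒜 i) :
    (ε ^ k) a = Int.negOnePow (k * i) • a := by
  induction k with
  | zero => simp
  | succ k ih =>
    rw [pow_succ', Module.End.mul_apply, ih, map_negOnePow_smul, hε.apply i a ha,
      negOnePow_smul_smul]
    congr 2; push_cast; ring

theorem mul_self : ε * ε = 1 := by
  ext a
  have ha : a ∈ AddSubmonoid.closure (⋃ i, (𝒜 i : Set A)) := hε.span ▸ AddSubmonoid.mem_top a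
  induction ha using AddSubmonoid.closure_induction with
  | mem a ha =>
    obtain ⟨i, hi⟩ := Set.mem_iUnion.1 ha
    rw [← pow_two, hε.pow_apply 2 i a hi, Int.negOnePow_even _ ⟨i, by push_cast; ring⟩]
    simp
  | zero => simp
  | add a b _ _ ha hb => rw [map_add, ha, hb, map_add]

end IsParity

/-- The exponent of the sign of the desuspension. -/
def twistExp (n : ℕ) (e : ℕ → ℤ) : ℤ := ∑ j ∈ Finset.range n, ((n : ℤ) - 1 - j) * e j

theorem toList_apply {𝒜 : ℤ → Submodule S A} {ε : Module.End S A} (hε : IsParity 𝒜 ε)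
    (c : Coll S A M) {l : List A} {n : ℕ} (hn : l.length = n) (e : Fin n → ℤ) (v : Fin n → A)
    (hl : ∀ j : Fin n, l.getD j 0 = v j) (hv : ∀ j, v j ∈ 𝒜 (e j)) :
    toList ε c l = Int.negOnePow (∑ j : Fin n, ((n : ℤ) - 1 - j) * e j) • c n v := by
  rw [toList_eq ε c hn, ← multilinearMap_negOnePow_smul]
  congr 1
  funext j
  rw [hl, hε.pow_apply _ _ _ (hv j)]
  congr 3
  have := j.2
  omega

theorem toList_word {𝒜 : ℤ → Submodule S A} {ε : Module.End S A} (hε : IsParity 𝒜 ε)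
    (c : Coll S A M) (n : ℕ) (e : ℕ → ℤ) (a : ℕ → A) (ha : ∀ j < n, a j ∈ 𝒜 (e j)) :
    toList ε c (word a n) = Int.negOnePow (twistExp n e) • c n (fun j => a j) := by
  rw [toList_apply hε c (length_word a n) (fun j => e j) (fun j => a j) _ fun j => ha j j.2,
    twistExp, Finset.sum_range]
  intro j
  rw [List.getD_eq_getElem _ _ (by simp), getElem_word]

/-- The total sign in the composite of `c` with a coderivation is that of the Koszul rule. -/
theorem twistExp_ins (q : ℤ) (r s t : ℕ) (e : ℕ → ℤ) :
    twistExp (r + 1 + t) (fun j => if j < r then e j else if j = r then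
      ∑ l ∈ Finset.range s, e (r + l) + q + 1 - s else e (j + s - 1)) +
      twistExp s (fun l => e (r + l)) + ∑ j ∈ Finset.range r, q * (e j + 1) =
    twistExp (r + (s + t)) e + (q * r + (q + 1 - s) * t) +
      (q + 1 - s) * ∑ j ∈ Finset.range r, e j := by
  have h₁ : ∀ j, r + 1 + j + s - 1 = r + (s + j) := fun j => by omega
  have h₂ : ∀ j, ¬ r + 1 + j < r := fun j => by omega
  have h₃ : ∀ j, ¬ r + 1 + j = r := fun j => by omega
  simp only [twistExp, Finset.sum_range_add, Finset.sum_range_one, h₁, h₂, h₃, if_false,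
    add_zero, lt_irrefl, if_true]
  rw [Finset.sum_congr rfl fun j hj => by rw [if_pos (Finset.mem_range.1 hj)]]
  have e₁ : ∑ j ∈ Finset.range r, (((r + 1 + t : ℕ) : ℤ) - 1 - j) * e j =
      ∑ j ∈ Finset.range r, (((r + (s + t) : ℕ) : ℤ) - 1 - j) * e j -
        (s - 1) * ∑ j ∈ Finset.range r, e j := by
    rw [Finset.mul_sum, ← Finset.sum_sub_distrib]
    exact Finset.sum_congr rfl fun j _ => by push_cast; ring
  have e₂ : ∑ j ∈ Finset.range s, (((r + (s + t) : ℕ) : ℤ) - 1 - (r + j : ℕ)) * e (r + j) =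
      ∑ j ∈ Finset.range s, ((s : ℤ) - 1 - j) * e (r + j) +
        t * ∑ j ∈ Finset.range s, e (r + j) := by
    rw [Finset.mul_sum, ← Finset.sum_add_distrib]
    exact Finset.sum_congr rfl fun j _ => by push_cast; ring
  have e₃ : ∑ j ∈ Finset.range t, (((r + 1 + t : ℕ) : ℤ) - 1 - (r + 1 + j : ℕ)) *
      e (r + (s + j)) = ∑ j ∈ Finset.range t, (((r + (s + t) : ℕ) : ℤ) - 1 - (r + (s + j) : ℕ)) *
      e (r + (s + j)) :=
    Finset.sum_congr rfl fun j _ => by push_cast; ring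
  rw [e₁, e₂, e₃, ← Finset.mul_sum, Finset.sum_add_distrib]
  simp
  ring

/-- `τ` supplies the sign for moving an operator of degree `q` past a letter of shifted degree `i -
1`, which has the parity of `i + 1`. The identity of exponents `twistExp_ins` then matches each
insertion with its term in `circ`, up to a sign depending only on the word. -/
theorem ins_toList {𝒜 : ℤ → Submodule S A} {ε : Module.End S A} (hε : IsParity 𝒜 ε)
    (c : Coll S A M) (d : Coll S A A) (q : ℤ) (hd : IsHomog 𝒜 𝒜 q d) (τ : A →ₗ[S] A)
    (hτ : ∀ i, ∀ a ∈ 𝒜 i, τ a = Int.negOnePow (q * (i + 1)) • a)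
    (n : ℕ) (e : ℕ → ℤ) (a : ℕ → A) (ha : ∀ j, a j ∈ 𝒜 (e j)) :
    ins τ (toList ε c) (toList ε d) (word a n) =
      Int.negOnePow (twistExp n e) • circ c d q n e a := by
  rw [ins, splitSum_word, circ, Finset.smul_sum]
  refine Finset.sum_congr rfl fun x hx => ?_
  rw [splitSum_word, Finset.smul_sum]
  refine Finset.sum_congr rfl fun y hy => ?_
  obtain ⟨r, w⟩ := x
  obtain ⟨s, t⟩ := y
  obtain rfl := Finset.HasAntidiagonal.mem_antidiagonal.1 hy
  obtain rfl := Finset.HasAntidiagonal.mem_antidiagonal.1 hx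
  simp only
  have hds : d s (fun l : Fin s => a (r + l)) ∈
      𝒜 (∑ l ∈ Finset.range s, e (r + l) + q + 1 - s) := by
    rw [Finset.sum_range]
    exact hd.2 s (fun l => e (r + l)) _ fun l => ha _
  have hw : (word a r).map τ ++ toList ε d (word (fun j => a (r + j)) s) ::
      word (fun j => a (r + (s + j))) t =
      word (fun j => if j < r then Int.negOnePow (q * (e j + 1)) • a j else if j = r then
        Int.negOnePow (twistExp s fun l => e (r + l)) • d s (fun l : Fin s => a (r + l))
        else a (j + s - 1)) (r + 1 + t) := by
    rw [toList_word hε d s (fun l => e (r + l)) (fun l => a (r + l)) fun j _ => ha _,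
      add_assoc, word_add, add_comm 1, word_succ]
    congr 1
    · simp only [word, List.map_map]
      refine List.map_congr_left fun j hj => ?_
      rw [if_pos (List.mem_range.1 hj), Function.comp_apply, hτ _ _ (ha j)]
    · simp only [add_zero, lt_irrefl, if_false, if_true]
      congr 1
      congr 1
      funext j
      rw [if_neg (by omega), if_neg (by omega)]
      congr 1; omega
  rw [hw, toList_word hε c (r + 1 + t) (fun j => if j < r then e j else if j = r then
      ∑ l ∈ Finset.range s, e (r + l) + q + 1 - s else e (j + s - 1)), insertion,
    negOnePow_smul_smul, negOnePow_smul_smul, ← twistExp_ins]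
  · have : (fun j : Fin (r + 1 + t) => if (j : ℕ) < r then Int.negOnePow (q * (e j + 1)) • a j
        else if (j : ℕ) = r then
        Int.negOnePow (twistExp s fun l => e (r + l)) • d s (fun l : Fin s => a (r + l))
        else a (j + s - 1)) = fun j : Fin (r + 1 + t) =>
        Int.negOnePow ((fun j : ℕ => if j < r then q * (e j + 1)
          else if j = r then twistExp s (fun l => e (r + l)) else 0) j) •
          (if (j : ℕ) < r then a j else if (j : ℕ) = r then d s (fun l : Fin s => a (r + l))
            else a (j + s - 1)) := by
      funext j
      by_cases h₁ : (j : ℕ) < r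
      · simp [h₁]
      · by_cases h₂ : (j : ℕ) = r <;> simp [h₁, h₂]
    rw [this, multilinearMap_negOnePow_smul, negOnePow_smul_smul, add_assoc (twistExp _ _)]
    congr 2
    rw [add_right_inj, ← Finset.sum_range (fun j : ℕ => if j < r then q * (e j + 1)
          else if j = r then twistExp s (fun l => e (r + l)) else 0), Finset.sum_range_add,
      Finset.sum_range_add, Finset.sum_congr rfl fun j hj => by rw [if_pos (Finset.mem_range.1 hj)]]
    rw [Finset.sum_eq_zero (s := Finset.range t) fun j _ => by
      rw [if_neg (by omega), if_neg (by omega)]]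
    simp [add_comm]
  · intro j hj
    split_ifs
    · rw [units_smul_eq (S := S)]; exact Submodule.smul_mem _ _ (ha j)
    · rw [units_smul_eq (S := S)]; exact Submodule.smul_mem _ _ hds
    · exact ha _

theorem sizeUpTo_eq_sum {n : ℕ} (κ : Composition n) (j : Fin κ.length) :
    (κ.sizeUpTo j : ℤ) = ∑ k : Fin κ.length, if k < j then (κ.blocksFun k : ℤ) else 0 := by
  rw [Composition.sizeUpTo, ← κ.ofFn_blocksFun, List.sum_take_ofFn, Finset.sum_filter]
  push_cast
  rfl

theorem sum_range_composition {n : ℕ} (κ : Composition n) (g : ℕ → M) :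
    ∑ j ∈ Finset.range n, g j = ∑ j : Fin κ.length, ∑ l ∈ Finset.range (κ.blocksFun j),
      g (κ.sizeUpTo j + l) := by
  simp only [Finset.sum_range]
  rw [← κ.blocksFinEquiv.sum_comp, Fintype.sum_sigma]
  rfl

/-- The weight of a letter in `twistExp n e` is the number of letters after it: those in its own
block plus the total size of the later blocks. The even last summand is there because `fᵢ` has
degree `1 - i` while the sign in the morphism equation involves `i - 1`. -/
theorem twistExp_composition {n : ℕ} (κ : Composition n) (e : ℕ → ℤ) :
    (∑ j : Fin κ.length, ((κ.length : ℤ) - 1 - j) *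
      (∑ l ∈ Finset.range (κ.blocksFun j), e (κ.sizeUpTo j + l) + 1 - κ.blocksFun j)) +
      ∑ j : Fin κ.length, twistExp (κ.blocksFun j) (fun l => e (κ.sizeUpTo j + l)) =
    twistExp n e + (∑ j : Fin κ.length, ((κ.length : ℤ) - 1 - j) * ((κ.blocksFun j : ℤ) - 1) +
      ∑ k : Fin κ.length, ∑ j : Fin κ.length, if j < k then
        (1 - (κ.blocksFun k : ℤ)) * ∑ l : Fin (κ.blocksFun j), e (κ.sizeUpTo j + l) else 0) +
      2 * ∑ j : Fin κ.length, ((κ.length : ℤ) - 1 - j) * (1 - (κ.blocksFun j : ℤ)) := by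
  have hr (j : Fin κ.length) : (κ.length : ℤ) - 1 - j = ∑ k, if j < k then (1 : ℤ) else 0 := by
    rw [← Finset.sum_filter, Finset.sum_const, Finset.filter_lt_eq_Ioi, Fin.card_Ioi]
    simp
    omega
  have hn (j : Fin κ.length) : (n : ℤ) = κ.sizeUpTo j + κ.blocksFun j +
      ∑ k, if j < k then (κ.blocksFun k : ℤ) else 0 := by
    have h : (n : ℤ) = ∑ k : Fin κ.length, (κ.blocksFun k : ℤ) := by
      exact_mod_cast κ.sum_blocksFun.symm
    rw [sizeUpTo_eq_sum, h, ← Fintype.sum_ite_eq j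
      (fun k => (κ.blocksFun k : ℤ)), ← Finset.sum_add_distrib, ← Finset.sum_add_distrib]
    refine Finset.sum_congr rfl fun k _ => ?_
    rcases lt_trichotomy j k with h | h | h
    · simp [h, h.not_gt, h.ne]
    · simp [h]
    · simp [h, h.not_gt, h.ne']
  have ht : twistExp n e = ∑ j : Fin κ.length, (twistExp (κ.blocksFun j)
      (fun l => e (κ.sizeUpTo j + l)) + (∑ k, if j < k then (κ.blocksFun k : ℤ) else 0) *
      ∑ l ∈ Finset.range (κ.blocksFun j), e (κ.sizeUpTo j + l)) := by
    rw [twistExp, sum_range_composition κ]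
    refine Finset.sum_congr rfl fun j _ => ?_
    rw [twistExp, Finset.mul_sum, ← Finset.sum_add_distrib]
    refine Finset.sum_congr rfl fun l _ => ?_
    rw [hn j]; push_cast; ring
  have hs : (∑ k : Fin κ.length, ∑ j : Fin κ.length, if j < k then
      (1 - (κ.blocksFun k : ℤ)) * ∑ l : Fin (κ.blocksFun j), e (κ.sizeUpTo j + l) else 0) =
      ∑ j : Fin κ.length, ((κ.length : ℤ) - 1 - j -
        ∑ k, if j < k then (κ.blocksFun k : ℤ) else 0) *
        ∑ l ∈ Finset.range (κ.blocksFun j), e (κ.sizeUpTo j + l) := by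
    rw [Finset.sum_comm]
    refine Finset.sum_congr rfl fun j _ => ?_
    rw [hr, ← Finset.sum_sub_distrib, Finset.sum_mul]
    refine Finset.sum_congr rfl fun k _ => ?_
    rw [Finset.sum_range]
    split_ifs <;> simp
  rw [ht, hs, Finset.mul_sum]
  simp only [← Finset.sum_add_distrib]
  refine Finset.sum_congr rfl fun j _ => ?_
  ring

theorem comp_toList {𝒜 : ℤ → Submodule S A} {ε : Module.End S A} (hε : IsParity 𝒜 ε)
    {𝒜' : ℤ → Submodule S A'} {ε' : Module.End S A'} (hε' : IsParity 𝒜' ε')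
    (m : Coll S A' A') (f : Coll S A A') (hf : IsHomog 𝒜 𝒜' 0 f)
    (n : ℕ) (e : ℕ → ℤ) (a : ℕ → A) (ha : ∀ j, a j ∈ 𝒜 (e j)) :
    comp (toList ε' m) (toList ε f) (word a n) = Int.negOnePow (twistExp n e) •
      ∑ κ : Composition n, Int.negOnePow
        (∑ j : Fin κ.length, ((κ.length : ℤ) - 1 - j) * ((κ.blocksFun j : ℤ) - 1)) •
        tensorInsertion m f κ e a := by
  rw [comp_word, Finset.smul_sum]
  refine Finset.sum_congr rfl fun κ _ => ?_
  have hlen : ((wordBlocks a κ.blocks).map (toList ε f)).length = κ.length := by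
    simp [length_wordBlocks]
  rw [toList_apply hε' m hlen
    (fun j => ∑ l ∈ Finset.range (κ.blocksFun j), e (κ.sizeUpTo j + l) + 1 - κ.blocksFun j)
    (fun j => Int.negOnePow (twistExp (κ.blocksFun j) fun l => e (κ.sizeUpTo j + l)) •
      f (κ.blocksFun j) fun l => a (κ.sizeUpTo j + l)), multilinearMap_negOnePow_smul,
    tensorInsertion, negOnePow_smul_smul, negOnePow_smul_smul, negOnePow_smul_smul,
    twistExp_composition, Int.negOnePow_add, Int.negOnePow_two_mul, mul_one, add_assoc]
  · intro j
    have h : (j : ℕ) < κ.blocks.length := by simp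
    rw [List.getD_eq_getElem _ _ (by rw [hlen]; exact j.2), List.getElem_map,
      getElem_wordBlocks _ _ _ _ h]
    exact toList_word hε f _ _ _ fun l _ => ha _
  · intro j
    rw [units_smul_eq (S := S)]
    refine Submodule.smul_mem _ _ ?_
    rw [Finset.sum_range]
    have := hf.2 (κ.blocksFun j) (fun l => e (κ.sizeUpTo j + l)) (fun l => a (κ.sizeUpTo j + l))
      fun l => ha _
    simpa using this

end Signs

/-! ### Homogeneous functions on words and reduction to generators. -/

section Homogeneity

variable {S A M : Type*} [CommRing S] [AddCommGroup A] [AddCommGroup M] [Module S A] [Module S M]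

/-- A function on words is homogeneous of degree `p` for the shifted gradings. -/
def ListHomog (𝒜 : ℤ → Submodule S A) (ℳ : ℤ → Submodule S M) (p : ℤ) (c : List A → M) : Prop :=
  c [] = 0 ∧ ∀ l : List (A × ℤ), (∀ u ∈ l, u.1 ∈ 𝒜 u.2) →
    c (l.map Prod.fst) ∈ ℳ ((l.map fun u => u.2 - 1).sum + p + 1)

variable {𝒜 : ℤ → Submodule S A} {ℳ : ℤ → Submodule S M} {ε : Module.End S A}

theorem sum_map_sub_one (l : List (A × ℤ)) :
    (l.map fun u => u.2 - 1).sum = ∑ j : Fin l.length, l[j].2 - l.length := by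
  induction l with
  | nil => simp
  | cons u l ih =>
    simp only [List.map_cons, List.sum_cons, ih, List.length_cons, Fin.sum_univ_succ]
    simp
    ring

theorem IsParity.pow_mem (hε : IsParity 𝒜 ε) (k : ℕ) {i : ℤ} {a : A} (ha : a ∈ 𝒜 i) :
    (ε ^ k) a ∈ 𝒜 i := by
  rw [hε.pow_apply k i a ha, units_smul_eq (S := S)]
  exact Submodule.smul_mem _ _ ha

theorem IsHomog.toList (hε : IsParity 𝒜 ε) {p : ℤ} {c : Coll S A M} (hc : IsHomog 𝒜 ℳ p c) :
    ListHomog 𝒜 ℳ p (toList ε c) := by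
  refine ⟨by simp [AInf.toList, hc.1], fun l hl => ?_⟩
  rw [toList_eq ε c (n := l.length) (by simp)]
  have := hc.2 l.length (fun j => l[j].2)
    (fun j => (ε ^ (l.length - 1 - j)) ((l.map Prod.fst).getD j 0)) fun j => by
      refine hε.pow_mem _ ?_
      rw [List.getD_eq_getElem _ _ (by simp), List.getElem_map]
      exact hl _ (List.getElem_mem _)
  convert this using 2
  rw [sum_map_sub_one]; ring

theorem ListHomog.ofList (hε : IsParity 𝒜 ε) {p : ℤ} {c : List A → M} (hc : ListHomog 𝒜 ℳ p c)
    (hc' : ListMultilinear S c) : IsHomog 𝒜 ℳ p (ofList ε c hc') := by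
  refine ⟨?_, fun i d a ha => ?_⟩
  · ext v
    simpa [AInf.ofList] using hc.1
  · have := hc.2 (List.ofFn fun j => ((ε ^ (i - 1 - (j : ℕ))) (a j), d j)) (by
      intro u hu
      obtain ⟨j, rfl⟩ := List.mem_ofFn.1 hu
      exact hε.pow_mem _ (ha j))
    rw [List.map_ofFn, List.map_ofFn, List.sum_ofFn] at this
    convert this using 2
    · simp
      ring
    · rfl

theorem ListHomog.ins {p q : ℤ} {c : List A → M} {d : List A → A} (hc : ListHomog 𝒜 ℳ p c)
    (hd : ListHomog 𝒜 𝒜 q d) (hc' : ListMultilinear S c) : ListHomog 𝒜 ℳ (p + q) (ins id c d) := by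
  refine ⟨by rw [ins_nil, hd.1, hc'.map_zero_cons], fun l hl => ?_⟩
  rw [AInf.ins, splitSum_map]
  refine splitSum_mem _ fun x w hxw => ?_
  rw [splitSum_map]
  refine splitSum_mem _ fun y z hyz => ?_
  subst hyz hxw
  have hy := hd.2 y fun u hu => hl u (by simp [hu])
  have := hc.2 (x ++ (d (y.map Prod.fst), (y.map fun u => u.2 - 1).sum + q + 1) :: z) (by
    intro u hu
    simp only [List.mem_append, List.mem_cons] at hu
    rcases hu with hu | rfl | hu
    · exact hl u (by simp [hu])
    · exact hy
    · exact hl u (by simp [hu]))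
  simp only [List.map_append, List.map_cons, List.map_id] at this ⊢
  convert this using 2
  simp
  ring

theorem ListHomog.single (u : A →ₗ[S] A) (hu : ∀ i, ∀ a ∈ 𝒜 i, u a ∈ 𝒜 i) :
    ListHomog 𝒜 𝒜 0 (single u) := by
  refine ⟨rfl, ?_⟩
  rintro (_ | ⟨a, _ | ⟨b, l⟩⟩) hl
  · exact Submodule.zero_mem _
  · simpa [AInf.single] using hu _ _ (hl a (by simp))
  · exact Submodule.zero_mem _

theorem exists_pairs {l : List A} (hl : ∀ a ∈ l, a ∈ ⋃ i, (𝒜 i : Set A)) :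
    ∃ l' : List (A × ℤ), l'.map Prod.fst = l ∧ ∀ u ∈ l', u.1 ∈ 𝒜 u.2 := by
  induction l with
  | nil => exact ⟨[], rfl, by simp⟩
  | cons a l ih =>
    obtain ⟨l', rfl, h⟩ := ih fun b hb => hl b (List.mem_cons_of_mem _ hb)
    obtain ⟨i, hi⟩ := Set.mem_iUnion.1 (hl a List.mem_cons_self)
    exact ⟨(a, i) :: l', rfl, by simpa using ⟨hi, fun a b hab => h _ hab⟩⟩

theorem ListMultilinear.map_linearMap {c : List A → M} (hc : ListMultilinear S c)
    (τ : A →ₗ[S] A) : ListMultilinear S fun l => c (l.map τ) :=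
  ⟨fun x a b y => by simp [hc.map_add], fun x s a y => by simp [hc.map_smul]⟩

theorem ListMultilinear.map_parity (hε : IsParity 𝒜 ε) {c : List A → M}
    (hc : ListMultilinear S c) (l : List (A × ℤ)) (hl : ∀ u ∈ l, u.1 ∈ 𝒜 u.2) :
    c ((l.map Prod.fst).map (-ε)) =
      Int.negOnePow (l.map fun u => u.2 - 1).sum • c (l.map Prod.fst) := by
  induction l generalizing c with
  | nil => simp
  | cons u l ih =>
    have hu : (-ε) u.1 = Int.negOnePow (u.2 - 1) • u.1 := by
      rw [LinearMap.neg_apply, hε.apply _ _ (hl u List.mem_cons_self), Int.negOnePow_sub]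
      simp [Units.smul_def]
    simp only [List.map_cons, List.sum_cons]
    rw [ih (hc.cons _) fun v hv => hl v (List.mem_cons_of_mem _ hv), hu,
      ← List.nil_append (_ :: _), ← hc.slot_apply, map_negOnePow_smul, negOnePow_smul_smul,
      add_comm]
    rfl

/-- A function of degree zero commutes with the parity operator of the shifted grading. -/
theorem ListHomog.map_neg_parity (hε : IsParity 𝒜 ε) {d : List A → A} (hd : ListHomog 𝒜 𝒜 0 d)
    (hd' : ListMultilinear S d) (l : List A) : d (l.map (-ε)) = (-ε) (d l) := by
  refine congrFun ((hd'.map_linearMap (-ε)).ext_of_closure (hd'.linearMap_comp (-ε)) hε.span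
    fun l hl => ?_) l
  obtain ⟨l, rfl, hl'⟩ := exists_pairs hl
  rw [hd'.map_parity hε l hl', LinearMap.neg_apply, hε.apply _ _ (hd.2 l hl'), add_zero,
    Int.negOnePow_succ]
  simp [Units.smul_def]

/-- The identities in the definitions are imposed on homogeneous arguments only; this extends them
to all words, where no degrees need to be tracked. -/
theorem ListMultilinear.ext_of_word (hε : IsParity 𝒜 ε) {c c' : List A → M}
    (hc : ListMultilinear S c) (hc' : ListMultilinear S c')
    (h : ∀ (n : ℕ) (e : ℕ → ℤ) (a : ℕ → A), (∀ j, a j ∈ 𝒜 (e j)) → c (word a n) = c' (word a n)) :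
    c = c' := by
  refine hc.ext_of_closure hc' hε.span fun l hl => ?_
  obtain ⟨l, rfl, hl'⟩ := exists_pairs hl
  have := h l.length (fun j => (l.getD j 0).2) (fun j => (l.getD j 0).1) fun j => by
    by_cases hj : j < l.length
    · rw [List.getD_eq_getElem _ _ hj]; exact hl' _ (List.getElem_mem _)
    -- Past the end of the word the default letter is zero, which lies in every degree.
    · rw [List.getD_eq_default _ _ (not_lt.1 hj)]; exact Submodule.zero_mem _
  rwa [show word (fun j => (l.getD j 0).1) l.length = l.map Prod.fst from by
    refine List.ext_getElem (by simp) fun j h₁ h₂ => ?_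
    rw [getElem_word, List.getElem_map, List.getD_eq_getElem]] at this

/-- The arguments are expanded one slot at a time. The sets `W j` vary with the slot so that
arguments of different degrees can be treated. -/
theorem multilinearMap_mem_of_span {n : ℕ} (c : MultilinearMap S (fun _ : Fin n => A) M)
    (N : Submodule S M) (W : Fin n → Set A) (h : ∀ v, (∀ j, v j ∈ W j) → c v ∈ N)
    (v : Fin n → A) (hv : ∀ j, v j ∈ Submodule.span S (W j)) : c v ∈ N := by
  suffices H : ∀ (s : Finset (Fin n)) (v : Fin n → A), (∀ j ∈ s, v j ∈ Submodule.span S (W j)) →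
      (∀ j ∉ s, v j ∈ W j) → c v ∈ N from H Finset.univ v (fun j _ => hv j) (by simp)
  intro s
  induction s using Finset.induction_on with
  | empty => exact fun v _ hv => h v fun j => hv j (by simp)
  | insert i s hi ih =>
    intro v hv hv'
    rw [← Function.update_eq_self i v]
    have hx := hv i (by simp)
    generalize v i = x at hx
    induction hx using Submodule.span_induction with
    | mem x hx =>
      refine ih _ (fun j hj => ?_) fun j hj => ?_
      · rw [Function.update_of_ne (by rintro rfl; exact hi hj)]
        exact hv j (by simp [hj])
      · by_cases hij : j = i
        · subst hij; simpa using hx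
        · rw [Function.update_of_ne hij]; exact hv' j (by simp [hij, hj])
    | zero => rw [MultilinearMap.map_update_zero]; exact N.zero_mem
    | add x y _ _ hx hy => rw [MultilinearMap.map_update_add]; exact N.add_mem hx hy
    | smul s x _ hx => rw [MultilinearMap.map_update_smul]; exact N.smul_mem _ hx

end Homogeneity

/-! ### Expansions in powers of `h` and the Euler derivation. -/

section Frame

variable {R S B V : Type*} [CommRing R] [CommRing S] [Algebra R S] [AddCommGroup B] [Module S B]
  [Module R B] [IsScalarTower R S B] [AddCommGroup V] [Module R V]

/-- Expansions in powers of `h` (with `h^{n+1} = 0`) of the elements of a graded `S`-module `B`: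
an isomorphism `Φ : S ⊗ V ≅ B` together with the coefficient maps `π j : B → V`. -/
structure Frame (R : Type*) {S B V : Type*} [CommRing R] [CommRing S] [Algebra R S]
    [AddCommGroup B] [Module S B] [Module R B] [IsScalarTower R S B] [AddCommGroup V] [Module R V]
    (h : S) (n : ℕ) (ℬ : ℤ → Submodule S B) (𝒱 : ℤ → Submodule R V) where
  σ : V →ₗ[R] B
  π : ℕ → B →ₗ[R] V
  Φ : S ⊗[R] V ≃ₗ[S] B
  pow_eq_zero : h ^ (n + 1) = 0
  expand : ∀ b, b = ∑ j ∈ Finset.range (n + 1), h ^ j • σ (π j b)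
  coeff : ∀ j i v, j ≤ n → i ≤ n → π j (h ^ i • σ v) = if j = i then v else 0
  Φ_one_tmul : ∀ v, Φ (1 ⊗ₜ v) = σ v
  σ_mem : ∀ i, ∀ v ∈ 𝒱 i, σ v ∈ ℬ i
  π_mem : ∀ j i, ∀ b ∈ ℬ i, π j b ∈ 𝒱 i

variable (B) in
/-- The submodule `h^j B`. -/
def hpow (h : S) (j : ℕ) : Submodule S B := LinearMap.range (LinearMap.lsmul S B (h ^ j))

theorem mem_hpow {h : S} {j : ℕ} {b : B} : b ∈ hpow B h j ↔ ∃ y, h ^ j • y = b := Iff.rfl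

theorem smul_mem_hpow {h : S} {j : ℕ} {b : B} (hb : b ∈ hpow B h j) : h • b ∈ hpow B h (j + 1) := by
  obtain ⟨y, rfl⟩ := mem_hpow.1 hb
  exact mem_hpow.2 ⟨y, by rw [pow_succ', mul_smul]⟩

theorem hpow_antitone (h : S) {i j : ℕ} (hij : i ≤ j) : hpow B h j ≤ hpow B h i := by
  intro b hb
  obtain ⟨y, rfl⟩ := mem_hpow.1 hb
  exact mem_hpow.2 ⟨h ^ (j - i) • y, by rw [smul_smul, ← pow_add, Nat.add_sub_cancel' hij]⟩

variable {h : S} {n : ℕ} {ℬ : ℤ → Submodule S B} {𝒱 : ℤ → Submodule R V}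

namespace Frame

variable (F : Frame R h n ℬ 𝒱)
include F

theorem hpow_eq_bot : hpow B h (n + 1) = ⊥ := by
  refine eq_bot_iff.2 fun b hb => ?_
  obtain ⟨y, rfl⟩ := mem_hpow.1 hb
  rw [F.pow_eq_zero, zero_smul]; exact Submodule.zero_mem _

theorem pow_smul_eq_zero {j : ℕ} (hj : n < j) (b : B) : h ^ j • b = 0 := by
  rw [pow_eq_zero_of_le hj F.pow_eq_zero, zero_smul]

theorem hom_ext {X : Type*} [AddCommGroup X] [Module R X] {f g : B →ₗ[R] X}
    (hfg : ∀ j ≤ n, ∀ v, f (h ^ j • F.σ v) = g (h ^ j • F.σ v)) : f = g := by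
  ext b
  rw [F.expand b, map_sum, map_sum]
  exact Finset.sum_congr rfl fun j hj => hfg j (Nat.lt_succ_iff.1 (Finset.mem_range.1 hj)) _

/-- The `R`-linear operator `h^j v ↦ w j v`. -/
def op (w : ℕ → S) : B →ₗ[R] B :=
  ∑ j ∈ Finset.range (n + 1), w j • (F.σ ∘ₗ F.π j)

theorem op_apply (w : ℕ → S) (b : B) :
    F.op w b = ∑ j ∈ Finset.range (n + 1), w j • F.σ (F.π j b) := by
  simp [op, LinearMap.sum_apply]

theorem op_pow_smul (w : ℕ → S) {j : ℕ} (hj : j ≤ n) (v : V) :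
    F.op w (h ^ j • F.σ v) = w j • F.σ v := by
  rw [op_apply, Finset.sum_eq_single j]
  · rw [F.coeff j j v hj hj, if_pos rfl]
  · intro i hi hij
    rw [F.coeff i j v (Nat.lt_succ_iff.1 (Finset.mem_range.1 hi)) hj, if_neg hij, map_zero,
      smul_zero]
  · intro hj'; exact (hj' (Finset.mem_range.2 (Nat.lt_succ_of_le hj))).elim

theorem op_σ (w : ℕ → S) (v : V) : F.op w (F.σ v) = w 0 • F.σ v := by
  simpa using F.op_pow_smul w (Nat.zero_le n) v

theorem op_mem (w : ℕ → S) {i : ℤ} {b : B} (hb : b ∈ ℬ i) : F.op w b ∈ ℬ i := by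
  rw [op_apply]
  exact Submodule.sum_mem _ fun j _ => Submodule.smul_mem _ _ (F.σ_mem _ _ (F.π_mem _ _ _ hb))

theorem op_mem_hpow (w : ℕ → S) {j p : ℕ} (hw : ∀ i, j ≤ i → ∃ s, w i = h ^ p * s) {b : B}
    (hb : b ∈ hpow B h j) : F.op w b ∈ hpow B h p := by
  obtain ⟨y, rfl⟩ := mem_hpow.1 hb
  rw [F.expand y, Finset.smul_sum, map_sum]
  refine Submodule.sum_mem _ fun i _ => ?_
  rw [smul_smul, ← pow_add]
  by_cases hi : j + i ≤ n
  · rw [F.op_pow_smul w hi]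
    obtain ⟨s, hs⟩ := hw (j + i) (by omega)
    exact mem_hpow.2 ⟨s • F.σ (F.π i y), by rw [hs, mul_smul]⟩
  · rw [F.pow_smul_eq_zero (not_le.1 hi), map_zero]; exact Submodule.zero_mem _

/-- The derivation `h d/dh`. -/
def euler : B →ₗ[R] B := F.op fun j => j * h ^ j

/-- The derivation `d/dh`, with values considered modulo `h^n`. -/
def deriv : B →ₗ[R] B := F.op fun j => j * h ^ (j - 1)

/-- The constant term. -/
def const : B →ₗ[R] B := F.op fun j => if j = 0 then 1 else 0

theorem euler_σ (v : V) : F.euler (F.σ v) = 0 := by simp [euler, op_σ]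

theorem euler_const (b : B) : F.euler (F.const b) = 0 := by
  rw [const, op_apply, map_sum]
  refine Finset.sum_eq_zero fun j _ => ?_
  split_ifs
  · rw [one_smul, euler_σ]
  · rw [zero_smul, map_zero]

theorem sub_const_mem (b : B) : b - F.const b ∈ hpow B h 1 := by
  rw [const, op_apply]
  nth_rewrite 1 [F.expand b]
  rw [← Finset.sum_sub_distrib]
  refine Submodule.sum_mem _ fun j hj => ?_
  rcases j with _ | j
  · simp
  · refine mem_hpow.2 ⟨h ^ j • F.σ (F.π (j + 1) b), ?_⟩
    simp [smul_smul, pow_succ']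

theorem smul_deriv (b : B) : h • F.deriv b = F.euler b := by
  rw [deriv, euler, op_apply, op_apply, Finset.smul_sum]
  refine Finset.sum_congr rfl fun j _ => ?_
  rw [smul_smul]
  congr 1
  rcases j with _ | j
  · simp
  · simp only [Nat.add_sub_cancel]; ring

/-- On `h^j v` with `j = n` both sides vanish because `h^{n+1} = 0`. The analogous rule for `d/dh`
breaks down there, which is why the arguments use `h d/dh`. -/
theorem euler_smul (b : B) : F.euler (h • b) = h • b + h • F.euler b := by
  suffices H : F.euler ∘ₗ (LinearMap.lsmul S B h).restrictScalars R =
      (LinearMap.lsmul S B h).restrictScalars R + h • F.euler from LinearMap.congr_fun H b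
  refine F.hom_ext fun j hj v => ?_
  simp only [LinearMap.comp_apply, LinearMap.add_apply, LinearMap.smul_apply,
    LinearMap.coe_restrictScalars, LinearMap.lsmul_apply]
  rw [euler, F.op_pow_smul _ hj, smul_smul, ← pow_succ']
  by_cases hj' : j + 1 ≤ n
  · rw [F.op_pow_smul _ hj', smul_smul, ← add_smul]
    congr 1; push_cast; ring
  · rw [F.pow_smul_eq_zero (not_le.1 hj'), map_zero, smul_smul, zero_add,
      show h * (j * h ^ j) = j * h ^ (j + 1) by ring, mul_smul,
      F.pow_smul_eq_zero (not_le.1 hj'), smul_zero]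

theorem euler_pow_smul (j : ℕ) (b : B) :
    F.euler (h ^ j • b) = j • h ^ j • b + h ^ j • F.euler b := by
  induction j with
  | zero => simp
  | succ j ih =>
    rw [pow_succ', mul_smul, F.euler_smul, ih, smul_add, smul_comm h j, mul_smul, add_smul,
      one_smul]
    abel

theorem euler_mem (b : B) : F.euler b ∈ hpow B h 1 :=
  mem_hpow.2 ⟨F.deriv b, by rw [pow_one, smul_deriv]⟩

/-- On `h^j B` the Euler derivation is multiplication by `j` modulo `h^{j+1} B`. -/
theorem mem_hpow_succ_of_euler {j : ℕ} (hj : IsUnit ((j : ℕ) : S)) {b : B} (hb : b ∈ hpow B h j)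
    (hb' : F.euler b ∈ hpow B h (j + 1)) : b ∈ hpow B h (j + 1) := by
  obtain ⟨y, rfl⟩ := mem_hpow.1 hb
  rw [F.euler_pow_smul] at hb'
  obtain ⟨z, hz⟩ := mem_hpow.1 (F.euler_mem y)
  have h₁ : h ^ j • F.euler y ∈ hpow B h (j + 1) :=
    mem_hpow.2 ⟨z, by rw [← hz, smul_smul, ← pow_add]⟩
  have h₂ := (Submodule.add_mem_iff_left _ h₁).1 hb'
  obtain ⟨u, hu⟩ := hj
  rw [← Nat.cast_smul_eq_nsmul S, ← hu] at h₂
  have := Submodule.smul_mem _ (↑u⁻¹ : S) h₂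
  rwa [smul_smul, Units.inv_mul, one_smul] at this

/-- The homogeneous constant elements. -/
def constants : Set B := {b | ∃ i, ∃ v ∈ 𝒱 i, F.σ v = b}

theorem closure_constants {ε : Module.End S B} (hε : IsParity ℬ ε) :
    AddSubmonoid.closure {b | ∃ j : ℕ, ∃ w ∈ F.constants, h ^ j • w = b} = ⊤ := by
  rw [eq_top_iff, ← hε.span, AddSubmonoid.closure_le]
  intro b hb
  obtain ⟨i, hi⟩ := Set.mem_iUnion.1 hb
  rw [F.expand b]
  exact AddSubmonoid.sum_mem _ fun j _ => AddSubmonoid.subset_closure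
    ⟨j, _, ⟨i, _, F.π_mem j i b hi, rfl⟩, rfl⟩

theorem span_constants {ε : Module.End S B} (hε : IsParity ℬ ε) :
    Submodule.span S F.constants = ⊤ := by
  rw [eq_top_iff, ← Submodule.toAddSubmonoid_le, Submodule.top_toAddSubmonoid,
    ← F.closure_constants hε, AddSubmonoid.closure_le]
  rintro _ ⟨j, w, hw, rfl⟩
  exact Submodule.smul_mem _ _ (Submodule.subset_span hw)

theorem le_span_image (i : ℤ) : ℬ i ≤ Submodule.span S (F.σ '' 𝒱 i) := by
  intro b hb
  rw [F.expand b]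
  exact Submodule.sum_mem _ fun j _ => Submodule.smul_mem _ _
    (Submodule.subset_span ⟨_, F.π_mem j i b hb, rfl⟩)

theorem euler_constants {w : B} (hw : w ∈ F.constants) : F.euler w = 0 := by
  obtain ⟨i, v, _, rfl⟩ := hw
  exact F.euler_σ v

theorem euler_parity {ε : Module.End S B} (hε : IsParity ℬ ε) (b : B) :
    F.euler (ε b) = ε (F.euler b) := by
  have hb : b ∈ AddSubmonoid.closure (⋃ i, (ℬ i : Set B)) := hε.span ▸ AddSubmonoid.mem_top b
  induction hb using AddSubmonoid.closure_induction with
  | mem b hb =>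
    obtain ⟨i, hi⟩ := Set.mem_iUnion.1 hb
    have h := hε.apply i (F.euler b) (F.op_mem _ hi)
    rw [hε.apply i b hi, h, map_negOnePow_smul]
  | zero => simp
  | add a b _ _ ha hb => simp only [map_add, ha, hb]

/-- The `S`-multilinear extension to `B` of an `R`-multilinear map on the constant elements. -/
def lift {i : ℕ} (g : MultilinearMap R (fun _ : Fin i => V) B) :
    MultilinearMap S (fun _ : Fin i => B) B :=
  ∑ j ∈ Finset.range (n + 1), h ^ j • F.Φ.toLinearMap.compMultilinearMap
    ((baseChange S i ((F.π j).compMultilinearMap g)).compLinearMap fun _ => F.Φ.symm.toLinearMap)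

theorem lift_apply {i : ℕ} (g : MultilinearMap R (fun _ : Fin i => V) B) (v : Fin i → V) :
    F.lift g (fun j => F.σ (v j)) = g v := by
  have hΦ (v : V) : F.Φ.symm (F.σ v) = 1 ⊗ₜ v := by
    rw [LinearEquiv.symm_apply_eq, F.Φ_one_tmul]
  rw [lift, sum_apply, F.expand (g v)]
  refine Finset.sum_congr rfl fun j _ => ?_
  simp only [smul_apply, LinearMap.compMultilinearMap_apply,
    MultilinearMap.compLinearMap_apply, LinearEquiv.coe_coe, hΦ, baseChange_tmul,
    Finset.prod_const_one, F.Φ_one_tmul]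

/-- The `S`-multilinear maps which on constant elements are the composites of `u` with the given
ones. -/
def opColl (u : B →ₗ[R] B) (C : Coll S B B) : Coll S B B := fun i =>
  F.lift ((u.compMultilinearMap ((C i).restrictScalars R)).compLinearMap fun _ => F.σ)

theorem opColl_apply (u : B →ₗ[R] B) (C : Coll S B B) {i : ℕ} (v : Fin i → V) :
    F.opColl u C i (fun j => F.σ (v j)) = u (C i fun j => F.σ (v j)) :=
  F.lift_apply _ v

theorem opColl_homog (u : B →ₗ[R] B) (hu : ∀ i, ∀ b ∈ ℬ i, u b ∈ ℬ i) {C : Coll S B B} {p : ℤ}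
    (hC : IsHomog ℬ ℬ p C) : IsHomog ℬ ℬ p (F.opColl u C) := by
  refine ⟨?_, fun i d a ha => ?_⟩
  · ext v
    have := F.opColl_apply u C (i := 0) ![]
    rw [hC.1] at this
    simpa [Subsingleton.elim v fun j => F.σ (![] j)] using this
  · refine multilinearMap_mem_of_span _ _ (fun j => F.σ '' 𝒱 (d j)) (fun w hw => ?_) a
      fun j => F.le_span_image _ (ha j)
    choose v hv hvw using hw
    obtain rfl : (fun j => F.σ (v j)) = w := funext hvw
    rw [F.opColl_apply]
    exact hu _ _ (hC.2 i d _ fun j => F.σ_mem _ _ (hv j))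

theorem toList_opColl {ε : Module.End S B} (hε : IsParity ℬ ε) (u : B →ₗ[R] B) (C : Coll S B B)
    {l : List B} (hl : ∀ w ∈ l, w ∈ F.constants) :
    toList ε (F.opColl u C) l = u (toList ε C l) := by
  have h (k : ℕ) (w : B) (hw : w ∈ F.constants) : ∃ v, F.σ v = (ε ^ k) w := by
    obtain ⟨i, v, hv, rfl⟩ := hw
    refine ⟨Int.negOnePow (k * i) • v, ?_⟩
    rw [hε.pow_apply k i _ (F.σ_mem i v hv), map_negOnePow_smul]
  choose v hv using fun j : Fin l.length =>
    h (l.length - 1 - j) l[j] (hl _ (List.getElem_mem _))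
  simp only [toList, ← hv, F.opColl_apply]

/-- The Leibniz rule for the Euler derivation and a multilinear function. -/
theorem euler_eq_der_add {ε : Module.End S B} (hε : IsParity ℬ ε) {c c' : List B → B}
    (hc : ListMultilinear S c) (hc' : ListMultilinear S c')
    (hcc' : ∀ l : List B, (∀ w ∈ l, w ∈ F.constants) → c' l = F.euler (c l)) (l : List B) :
    F.euler (c l) = der F.euler c l + c' l := by
  -- The Euler derivation is linear over `R` only, so constant letters do not suffice and letters
  -- `h^j w` with `w` constant have to be tested.
  refine congrFun (ListMultilinear.ext_of_closure (S := R)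
    (hc.restrictScalars.linearMap_comp F.euler)
    ((hc.restrictScalars.der F.euler).add hc'.restrictScalars) (F.closure_constants hε)
    fun l hl => ?_) l
  -- `K` is the total exponent of `h` in the word, and `l'` is the word of its constant factors.
  have key : ∃ (K : ℕ) (l' : List B), (∀ w ∈ l', w ∈ F.constants) ∧
      ∀ c : List B → B, ListMultilinear S c →
        c l = h ^ K • c l' ∧ der F.euler c l = K • h ^ K • c l' := by
    clear hcc'
    induction l with
    | nil => exact ⟨0, [], by simp, fun c _ => by simp [der]⟩
    | cons a l ih =>
      obtain ⟨j, w, hw, rfl⟩ := hl a List.mem_cons_self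
      obtain ⟨K, l', hl', H⟩ := ih fun b hb => hl b (List.mem_cons_of_mem _ hb)
      refine ⟨j + K, w :: l', by simpa using ⟨hw, hl'⟩, fun c hc => ?_⟩
      obtain ⟨h₁, h₂⟩ := H _ (hc.cons w)
      obtain ⟨h₃, h₄⟩ := H _ (hc.cons (h ^ j • w))
      have hs : ∀ (s : S) l, c ((s • w) :: l) = s • c (w :: l) := fun s l => hc.map_smul [] s w l
      have he : F.euler (h ^ j • w) = ((j : S) * h ^ j) • w := by
        rw [F.euler_pow_smul, F.euler_constants hw, smul_zero, add_zero, mul_smul,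
          Nat.cast_smul_eq_nsmul]
      rw [der_cons, h₄, he, hs, hs, h₁, hs]
      constructor
      · rw [smul_smul, pow_add]
      · simp only [← Nat.cast_smul_eq_nsmul S, smul_smul, ← add_smul]
        congr 1; push_cast; ring
  obtain ⟨K, l', hl', H⟩ := key
  rw [(H c hc).1, (H c hc).2, (H c' hc').1, F.euler_pow_smul, hcc' l' hl']

end Frame
end Frame

/-! ### Operations on sequences of multilinear maps, and estimates modulo powers of `h`. -/

section

variable {A A' M M' : Type*} [AddCommGroup A] [AddCommGroup A'] [AddCommGroup M] [AddCommGroup M']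

theorem map_compAux {F : Type*} [FunLike F M M'] [AddMonoidHomClass F M M'] (g : F)
    (c : List A' → M) (f : List A → A') (x l : List A) :
    g (compAux f c x l) = compAux f (fun l => g (c l)) x l := by
  induction l generalizing c x with
  | nil => rfl
  | cons a l ih => simp only [compAux, map_add, ih]

theorem map_comp {F : Type*} [FunLike F M M'] [AddMonoidHomClass F M M'] (g : F)
    (c : List A' → M) (f : List A → A') (l : List A) :
    g (comp c f l) = comp (fun l => g (c l)) f l := by
  cases l with
  | nil => rfl
  | cons a l => exact map_compAux g c f _ _

variable {S : Type*} [CommRing S] [Module S A] [Module S M]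

theorem ins_single_id_left (τ : A → A) (d : List A → A) : ins τ (single id) d = d :=
  funext fun l => single_ins τ id l

theorem toList_add (ε : Module.End S A) (c c' : Coll S A M) :
    toList ε (c + c') = fun l => toList ε c l + toList ε c' l := rfl

theorem toList_smul (ε : Module.End S A) (s : S) (c : Coll S A M) :
    toList ε (s • c) = fun l => s • toList ε c l := rfl

theorem toList_sub (ε : Module.End S A) (c c' : Coll S A M) :
    toList ε (c - c') = fun l => toList ε c l - toList ε c' l := by
  funext l
  simp only [toList, Pi.sub_apply, sub_apply]

theorem IsHomog.add {𝒜 : ℤ → Submodule S A} {ℳ : ℤ → Submodule S M} {p : ℤ} {c c' : Coll S A M}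
    (hc : IsHomog 𝒜 ℳ p c) (hc' : IsHomog 𝒜 ℳ p c') : IsHomog 𝒜 ℳ p (c + c') :=
  ⟨by simp [hc.1, hc'.1], fun i d a ha => Submodule.add_mem _ (hc.2 i d a ha) (hc'.2 i d a ha)⟩

theorem IsHomog.smul {𝒜 : ℤ → Submodule S A} {ℳ : ℤ → Submodule S M} {p : ℤ} {c : Coll S A M}
    (s : S) (hc : IsHomog 𝒜 ℳ p c) : IsHomog 𝒜 ℳ p (s • c) :=
  ⟨by simp [hc.1], fun i d a ha => Submodule.smul_mem _ _ (hc.2 i d a ha)⟩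

theorem IsHomog.sub {𝒜 : ℤ → Submodule S A} {ℳ : ℤ → Submodule S M} {p : ℤ} {c c' : Coll S A M}
    (hc : IsHomog 𝒜 ℳ p c) (hc' : IsHomog 𝒜 ℳ p c') : IsHomog 𝒜 ℳ p (c - c') :=
  ⟨by simp [hc.1, hc'.1], fun i d a ha => by
    rw [Pi.sub_apply, sub_apply]
    exact Submodule.sub_mem _ (hc.2 i d a ha) (hc'.2 i d a ha)⟩

theorem IsHomog.zero {𝒜 : ℤ → Submodule S A} {ℳ : ℤ → Submodule S M} {p : ℤ} :
    IsHomog 𝒜 ℳ p (0 : Coll S A M) :=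
  ⟨rfl, fun _ _ _ _ => Submodule.zero_mem _⟩

/-- The sequence of multilinear maps `∑ c (1 ⊗ d ⊗ 1)` on the bar construction. -/
def insColl {ε : Module.End S A} (c : Coll S A M) (d : Coll S A A) : Coll S A M :=
  ofList ε (ins id (toList ε c) (toList ε d))
    ((toList_multilinear ε c).ins LinearMap.id (toList_multilinear ε d))

theorem toList_insColl {ε : Module.End S A} (hε : ε * ε = 1) (c : Coll S A M) (d : Coll S A A) :
    toList ε (insColl (ε := ε) c d) = ins id (toList ε c) (toList ε d) :=
  toList_ofList hε _ _

theorem IsHomog.insColl {𝒜 : ℤ → Submodule S A} {ℳ : ℤ → Submodule S M} {ε : Module.End S A}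
    (hε : IsParity 𝒜 ε) {p q : ℤ} {c : Coll S A M} {d : Coll S A A} (hc : IsHomog 𝒜 ℳ p c)
    (hd : IsHomog 𝒜 𝒜 q d) : IsHomog 𝒜 ℳ (p + q) (insColl (ε := ε) c d) :=
  ListHomog.ofList hε ((hc.toList hε).ins (hd.toList hε) (toList_multilinear ε c)) _

/-- The identity. -/
def idColl (ε : Module.End S A) : Coll S A A :=
  ofList ε (single id) (ListMultilinear.single (LinearMap.id : A →ₗ[S] A))

theorem toList_idColl {ε : Module.End S A} (hε : ε * ε = 1) : toList ε (idColl ε) = single id :=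
  toList_ofList hε _ _

theorem IsHomog.idColl {𝒜 : ℤ → Submodule S A} {ε : Module.End S A} (hε : IsParity 𝒜 ε) :
    IsHomog 𝒜 𝒜 0 (idColl ε) :=
  ListHomog.ofList hε (ListHomog.single LinearMap.id fun _ _ h => h) _

theorem ins_mem_hpow {h : S} {j : ℕ} (τ : A → A) {c : List A → M} {d : List A → A}
    (hc : ListMultilinear S c) (hc' : ∀ l, c l ∈ hpow M h 1) (hd : ∀ l, d l ∈ hpow A h j)
    (l : List A) : ins τ c d l ∈ hpow M h (j + 1) := by
  refine splitSum_mem _ fun x w _ => splitSum_mem _ fun y z _ => ?_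
  obtain ⟨u, hu⟩ := mem_hpow.1 (hd y)
  obtain ⟨v, hv⟩ := mem_hpow.1 (hc' (x.map τ ++ u :: z))
  rw [← hu, hc.map_smul]
  exact mem_hpow.2 ⟨v, by rw [← hv, smul_smul, pow_add]⟩

/-- Modulo `h` a piece of length one returns its letter and every longer piece contributes zero, so
only the decomposition into single letters survives. -/
theorem comp_sub_mem {h : S} (c : List A → M) (hc : ListMultilinear S c)
    (f : List A → A) (hf : ∀ l, f l - single id l ∈ hpow A h 1) (l : List A) :
    comp c f l - c l ∈ hpow M h 1 := by
  have hc₁ : ∀ (c : List A → M), ListMultilinear S c → ∀ a ∈ hpow A h 1, ∀ l,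
      comp (fun w => c (a :: w)) f l ∈ hpow M h 1 := by
    intro c hc a ha l
    obtain ⟨y, rfl⟩ := mem_hpow.1 ha
    exact comp_mem _ (fun l => mem_hpow.2 ⟨c (y :: l), (hc.map_smul [] _ y l).symm⟩) l
  induction hn : l.length using Nat.strong_induction_on generalizing l c with
  | _ n ih =>
  cases l with
  | nil => simp
  | cons a l =>
    have h₁ : comp (fun w => c (f [a] :: w)) f l - c (a :: l) ∈ hpow M h 1 := by
      have h₂ := hc₁ c hc _ (hf [a]) l
      have h₃ := ih l.length (by simp at hn; omega) (fun w => c (a :: w)) (hc.cons a) l rfl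
      rw [← hc.compCons_apply, map_sub, hc.compCons_apply, hc.compCons_apply] at h₂
      simpa [single] using Submodule.add_mem _ h₂ h₃
    rw [comp_cons]
    cases l with
    | nil => simpa using h₁
    | cons b l =>
      rw [splitSum_cons, add_sub_right_comm]
      refine Submodule.add_mem _ h₁ (splitSum_mem _ fun x y _ => ?_)
      have : f (a :: b :: x) ∈ hpow A h 1 := by simpa [single] using hf (a :: b :: x)
      exact hc₁ c hc _ this y

end

/-! ### Existence and uniqueness for linear differential equations in `h`. -/

section Core

variable {R S B V : Type*} [CommRing R] [CommRing S] [Algebra R S] [AddCommGroup B] [Module S B]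
  [Module R B] [IsScalarTower R S B] [AddCommGroup V] [Module R V]
  {h : S} {n : ℕ} {ℬ : ℤ → Submodule S B} {𝒱 : ℤ → Submodule R V}

namespace Frame

variable (F : Frame R h n ℬ 𝒱) {ε : Module.End S B} (hε : IsParity ℬ ε)
include F hε

/-- `Ψ` is a contraction for the `h`-adic topology, and `n + 1` iterations reach a fixed point
because `h^{n+1} B = 0`. -/
theorem exists_fixed_point (P : Coll S B B → Prop) (Ψ : Coll S B B → Coll S B B) (c : Coll S B B)
    (hc : P c) (hP : ∀ c, P c → P (Ψ c))
    (hΨ : ∀ (j : ℕ) (c c' : Coll S B B), (∀ l, toList ε c l - toList ε c' l ∈ hpow B h j) →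
      ∀ l, toList ε (Ψ c) l - toList ε (Ψ c') l ∈ hpow B h (j + 1)) :
    ∃ c, P c ∧ toList ε (Ψ c) = toList ε c := by
  refine ⟨Ψ^[n + 1] c, ?_, ?_⟩
  · exact Function.Iterate.rec P hc (fun c => hP c) (n + 1)
  · have H : ∀ j l, toList ε (Ψ (Ψ^[j] c)) l - toList ε (Ψ^[j] c) l ∈ hpow B h j := by
      intro j
      induction j with
      | zero => exact fun l => mem_hpow.2 ⟨_, by rw [pow_zero, one_smul]⟩
      | succ j ih =>
        rw [Function.iterate_succ_apply']
        exact hΨ j _ _ ih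
    funext l
    have := H (n + 1) l
    rw [F.hpow_eq_bot, Submodule.mem_bot] at this
    exact sub_eq_zero.1 this

/-- Uniqueness of solutions. On constant words the term `der` vanishes, so if all values of `E` lie
in `h^{j+1} B`, then the Euler derivative of a value on a constant word lies in `h^{j+2} B`.
Dividing by `j + 1` puts that value itself in `h^{j+2} B`, and `S`-linearity passes to all words. -/
theorem eq_zero_of_euler (hu : ∀ j : ℕ, 0 < j → IsUnit (j : S)) {E b : List B → B}
    (hE : ListMultilinear S E) (hE₁ : ∀ l, E l ∈ hpow B h 1)
    (H : ∀ l, F.euler (E l) = der F.euler E l + h • ins id E b l) (l : List B) : E l = 0 := by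
  have hd : ∀ (l : List B) (c : List B → B), ListMultilinear S c → (∀ w ∈ l, w ∈ F.constants) →
      der F.euler c l = 0 := by
    intro l
    induction l with
    | nil => intros; rfl
    | cons a l ih =>
      intro c hc hl
      rw [der_cons, F.euler_constants (hl a List.mem_cons_self), hc.map_zero_cons,
        ih _ (hc.cons a) fun w hw => hl w (List.mem_cons_of_mem _ hw), add_zero]
  have key : ∀ j l, E l ∈ hpow B h (j + 1) := by
    intro j
    induction j with
    | zero => exact hE₁
    | succ j ih =>
      refine hE.mem_of_span (F.span_constants hε) _ fun l hl => ?_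
      refine F.mem_hpow_succ_of_euler (hu _ j.succ_pos) (ih l) ?_
      rw [H, hd l E hE hl, zero_add]
      exact smul_mem_hpow (ins_mem_left id _ ih l)
  have := key n l
  rwa [F.hpow_eq_bot, Submodule.mem_bot] at this

theorem single_euler_map (l : List B) :
    single F.euler (l.map (-ε)) = (-ε) (single F.euler l) := by
  rcases l with _ | ⟨a, _ | ⟨b, l⟩⟩
  · simp [single]
  · simp [single, F.euler_parity hε]
  · simp [single]

/-- The commutator of a multilinear function with the coderivation of components `h d/dh + β`. -/
theorem ins_connection_sub {c c' β : List B → B} (hc : ListMultilinear S c)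
    (H : ∀ l, F.euler (c l) = der F.euler c l + c' l) (τ : B → B) (l : List B) :
    ins τ (fun l => single F.euler l + β l) c l - ins id c (fun l => single F.euler l + β l) l =
      c' l + ins τ β c l - ins id c β l := by
  rw [ins_add_left, ins_add_right id hc, single_ins, ins_single (S := S) _ hc, H]
  abel

end Frame
end Core

/-! ### Connections: from primitives to trivializations and back. -/

section Core

variable {R S B V : Type*} [CommRing R] [CommRing S] [Algebra R S] [AddCommGroup B] [Module S B]
  [Module R B] [IsScalarTower R S B] [AddCommGroup V] [Module R V]
  {h : S} {n : ℕ} {ℬ : ℤ → Submodule S B} {𝒱 : ℤ → Submodule R V}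

namespace Frame

variable (F : Frame R h n ℬ 𝒱) {ε : Module.End S B} (hε : IsParity ℬ ε)
include F hε

theorem euler_toList (C : Coll S B B) (l : List B) :
    F.euler (toList ε C l) = der F.euler (toList ε C) l +
      h • toList ε (F.opColl F.deriv C) l := by
  refine F.euler_eq_der_add hε (toList_multilinear ε C)
    ((toList_multilinear ε (F.opColl F.deriv C)).smul h) (fun l hl => ?_) l
  rw [F.toList_opColl hε _ _ hl, F.smul_deriv]

theorem euler_toList_const (C : Coll S B B) (l : List B) :
    F.euler (toList ε (F.opColl F.const C) l) = der F.euler (toList ε (F.opColl F.const C)) l := by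
  rw [F.euler_eq_der_add hε (toList_multilinear ε (F.opColl F.const C))
    (ListMultilinear.zero (S := S)) (fun l hl => ?_) l, add_zero]
  rw [F.toList_opColl hε _ _ hl, F.euler_const]

theorem toList_sub_const_mem (C : Coll S B B) (l : List B) :
    toList ε C l - toList ε (F.opColl F.const C) l ∈ hpow B h 1 := by
  refine ((toList_multilinear ε C).sub (toList_multilinear ε _)).mem_of_span
    (F.span_constants hε) _ (fun l hl => ?_) l
  rw [F.toList_opColl hε _ _ hl]
  exact F.sub_const_mem _

/-- If `f` is a horizontal section for the connection `h d/dh + β`, then precomposition with the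
connection corresponds to `h d/dh` on the composites with `f`. -/
theorem ins_comp_const {f d : List B → B} (hf : ListMultilinear S f)
    (hd : d [] = 0) (H : ∀ l, F.euler (f l) = ins id f d l) (C : Coll S B B) (l : List B) :
    ins id (comp (toList ε (F.opColl F.const C)) f) d l =
      F.euler (comp (toList ε (F.opColl F.const C)) f l) := by
  rw [map_comp, ins_comp_eq_comp_der (S := R) (toList_multilinear ε _).restrictScalars
    hf.restrictScalars hd F.euler (fun l => (H l).symm)]
  congr 1
  funext l
  rw [F.euler_toList_const hε]

/-- By horizontality the left side is `(f · d) · m`. The pre-Lie identity compares it with `(f · m)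
· d`, the difference being `f` composed with the commutator of `d` and `m`. -/
theorem ins_ins_connection {f d m : List B → B} (hf : ListMultilinear S f)
    (hd : ∀ l : List B, d (l.map (-ε)) = (-ε) (d l))
    (H : ∀ l, F.euler (f l) = ins id f d l) (l : List B) :
    F.euler (ins (-ε) f m l) = ins id (ins (-ε) f m) d l +
      ins (-ε) f (fun l => ins (-ε) d m l - ins id m d l) l := by
  rw [map_ins, ← ins_ins_sub (-ε) hf hd, add_sub_cancel]
  congr 1
  funext l
  exact H l

theorem connection_map {b : Coll S B B} (hb : IsHomog ℬ ℬ 0 b) (l : List B) :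
    single F.euler (l.map (-ε)) + toList ε b (l.map (-ε)) =
      (-ε) (single F.euler l + toList ε b l) := by
  rw [F.single_euler_map hε, (hb.toList hε).map_neg_parity hε (toList_multilinear ε b), map_add]

theorem euler_eq_ins_connection {c c' b : List B → B} (hc : ListMultilinear S c)
    (H : ∀ l, F.euler (c l) = der F.euler c l + c' l) (hc' : ∀ l, c' l = ins id c b l)
    (l : List B) :
    F.euler (c l) = ins id c (fun l => single F.euler l + b l) l := by
  rw [ins_add_right id hc, ins_single (S := R) _ hc.restrictScalars, H, hc']

/-- The operator `h^j v ↦ h^{j+1} v / (j+1)`. -/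
theorem exists_integral (hu : ∀ j : ℕ, 0 < j → IsUnit (j : S)) :
    ∃ J : B →ₗ[R] B, (∀ b, F.euler (J b) = h • b) ∧ (∀ i, ∀ b ∈ ℬ i, J b ∈ ℬ i) ∧
      ∀ j, ∀ b ∈ hpow B h j, J b ∈ hpow B h (j + 1) := by
  choose w hw using fun j : ℕ => (hu (j + 1) j.succ_pos).exists_right_inv
  -- The Euler derivation is linear over `R` only, but it commutes with the inverses in `S` of
  -- integers.
  have hw' (j : ℕ) (y : B) : F.euler (w j • y) = w j • F.euler y := by
    have : F.euler y = ((j + 1 : ℕ) : S) • F.euler (w j • y) := by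
      rw [Nat.cast_smul_eq_nsmul, ← map_nsmul, ← Nat.cast_smul_eq_nsmul S, smul_smul, hw, one_smul]
    rw [this, smul_smul, mul_comm, hw, one_smul]
  refine ⟨F.op fun j => h ^ (j + 1) * w j, fun b => ?_, fun i b => F.op_mem _, fun j b =>
    F.op_mem_hpow _ fun i hi => ⟨h ^ (i - j) * w i, ?_⟩⟩
  · suffices H : F.euler ∘ₗ F.op (fun j => h ^ (j + 1) * w j) =
        (LinearMap.lsmul S B h).restrictScalars R from LinearMap.congr_fun H b
    refine F.hom_ext fun j hj v => ?_
    simp only [LinearMap.comp_apply, LinearMap.coe_restrictScalars, LinearMap.lsmul_apply]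
    rw [F.op_pow_smul _ hj]
    by_cases hj' : j + 1 ≤ n
    · rw [mul_comm, mul_smul, hw', euler, F.op_pow_smul _ hj', smul_smul, ← mul_assoc,
        mul_comm (w j), hw, one_mul, smul_smul, ← pow_succ']
    · rw [mul_smul, smul_smul h, ← pow_succ', F.pow_smul_eq_zero (not_le.1 hj'),
        F.pow_smul_eq_zero (not_le.1 hj'), map_zero]
  · rw [← mul_assoc, ← pow_add]
    congr 2; omega

/-- A primitive of the Kaledin class yields a trivialization of the deformation. -/
theorem exists_morphism (hu : ∀ j : ℕ, 0 < j → IsUnit (j : S)) {m b : Coll S B B}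
    (hb : IsHomog ℬ ℬ 0 b)
    (H : ∀ l, h • toList ε (F.opColl F.deriv m) l =
      ins id (toList ε m) (toList ε (h • b)) l - ins (-ε) (toList ε (h • b)) (toList ε m) l) :
    ∃ f : Coll S B B, IsHomog ℬ ℬ 0 f ∧ (∀ l, toList ε f l - single id l ∈ hpow B h 1) ∧
      ∀ l, ins (-ε) (toList ε f) (toList ε m) l =
        comp (toList ε (F.opColl F.const m)) (toList ε f) l := by
  obtain ⟨J, hJ, hJ₁, hJ₂⟩ := F.exists_integral hε hu
  have hJ₃ (j : ℕ) (c c' : Coll S B B) (hcc' : ∀ l, toList ε c l - toList ε c' l ∈ hpow B h j)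
      (l : List B) :
      toList ε (F.opColl J c) l - toList ε (F.opColl J c') l ∈ hpow B h (j + 1) := by
    refine ((toList_multilinear ε _).sub (toList_multilinear ε _)).mem_of_span
      (F.span_constants hε) _ (fun l hl => ?_) l
    rw [F.toList_opColl hε _ _ hl, F.toList_opColl hε _ _ hl, ← map_sub]
    exact hJ₂ j _ (hcc' l)
  -- The equation `E ∘ f = f · D` with initial value the identity, in integral form `f = id + J (f ·
  -- b)`.
  obtain ⟨f, hf, hfix⟩ := F.exists_fixed_point hε (IsHomog ℬ ℬ 0)
    (fun f => idColl ε + F.opColl J (insColl (ε := ε) f b)) 0 IsHomog.zero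
    (fun f hf => (IsHomog.idColl hε).add (F.opColl_homog J hJ₁ (by
      simpa using IsHomog.insColl hε hf hb)))
    (fun j c c' hcc' l => by
      simp only [toList_add, add_sub_add_left_eq_sub]
      refine hJ₃ j _ _ (fun l => ?_) l
      rw [toList_insColl hε.mul_self, toList_insColl hε.mul_self, ← ins_sub_left]
      exact ins_mem_left id _ hcc' l)
  rw [toList_add, toList_idColl hε.mul_self] at hfix
  have hf₁ : ∀ l, toList ε f l - single id l ∈ hpow B h 1 := fun l => by
    rw [← hfix, add_sub_cancel_left]
    refine (toList_multilinear ε _).mem_of_span (F.span_constants hε) _ (fun l hl => ?_) l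
    rw [F.toList_opColl hε _ _ hl]
    exact hJ₂ 0 _ (mem_hpow.2 ⟨_, by rw [pow_zero, one_smul]⟩)
  have hm := toList_multilinear ε m
  have hfm := toList_multilinear ε f
  have hf₂ : ∀ l, F.euler (toList ε f l) =
      ins id (toList ε f) (fun l => single F.euler l + toList ε (h • b) l) l := by
    refine F.euler_eq_ins_connection hε hfm (c' := fun l => h • toList ε (insColl (ε := ε) f b) l)
      (F.euler_eq_der_add hε hfm ((toList_multilinear ε _).smul h) fun l hl => ?_) fun l => ?_
    · have : F.euler (single id l) = 0 := by
        rcases l with _ | ⟨a, _ | ⟨b, l⟩⟩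
        · simp [single]
        · simp [single, F.euler_constants (hl a (by simp))]
        · simp [single]
      conv_rhs => rw [← hfix]
      rw [map_add, this, zero_add, F.toList_opColl hε _ _ hl, hJ]
    · rw [toList_insColl hε.mul_self, toList_smul, ins_smul_right id hfm]
  refine ⟨f, hf, hf₁, fun l => sub_eq_zero.1 ?_⟩
  -- The defect `f · m - m⁽⁰⁾ · f` is shown to vanish mod `h` and to satisfy the linear equation of
  -- the uniqueness lemma.
  refine F.eq_zero_of_euler hε hu (b := toList ε b) ((hfm.ins (-ε) hm).sub
    ((toList_multilinear ε (F.opColl F.const m)).comp hfm)) (fun l => ?_) (fun l => ?_) l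
  -- Modulo `h` one has `f ≡ id` and `m ≡ m⁽⁰⁾`, so both composites reduce to `m⁽⁰⁾`.
  · have h₁ : ins (-ε) (toList ε f) (toList ε m) l - toList ε m l ∈ hpow B h 1 := by
      nth_rewrite 2 [← ins_single_id_left (-ε) (toList ε m)]
      rw [← ins_sub_left]
      exact ins_mem_left (⇑(-ε)) (hpow B h 1) hf₁ l
    have h₂ := F.toList_sub_const_mem hε m l
    have h₃ := comp_sub_mem _ (toList_multilinear ε (F.opColl F.const m)) _ hf₁ l
    have := Submodule.sub_mem _ (Submodule.add_mem _ h₁ h₂) h₃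
    convert this using 1
    abel
  · have hE := ((hfm.ins (-ε) hm).sub
      ((toList_multilinear ε (F.opColl F.const m)).comp hfm))
    rw [map_sub, F.ins_ins_connection hε hfm (F.connection_map hε (hb.smul h)) hf₂,
      ← F.ins_comp_const hε hfm (by simp [single, (hb.smul h).toList hε |>.1]) hf₂]
    -- The hypothesis on `b`, read as the vanishing of the commutator of the connection with `m`.
    have hz : (fun l => ins (-ε) (fun l => single F.euler l + toList ε (h • b) l) (toList ε m) l -
        ins id (toList ε m) (fun l => single F.euler l + toList ε (h • b) l) l) = fun _ => 0 := by
      funext l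
      rw [F.ins_connection_sub hε hm.restrictScalars (F.euler_toList hε m), H]
      abel
    rw [hz, ins_zero_right _ hfm, add_zero, ← ins_sub_left, ins_add_right id hE,
      ins_single (S := R) _ hE.restrictScalars, toList_smul, ins_smul_right id hE]

/-- A trivialization of the deformation yields a primitive of the Kaledin class. -/
theorem exists_primitive {m f : Coll S B B} (hf : IsHomog ℬ ℬ 0 f)
    (hf₁ : ∀ l, toList ε f l - single id l ∈ hpow B h 1)
    (H : ∀ l, ins (-ε) (toList ε f) (toList ε m) l =
        comp (toList ε (F.opColl F.const m)) (toList ε f) l) :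
    ∃ b : Coll S B B, IsHomog ℬ ℬ 0 b ∧ ∀ l, h • toList ε (F.opColl F.deriv m) l =
      ins id (toList ε m) (toList ε (h • b)) l - ins (-ε) (toList ε (h • b)) (toList ε m) l := by
  have hm := toList_multilinear ε m
  have hfm := toList_multilinear ε f
  have hfs : ListMultilinear S fun l => toList ε f l - single id l :=
    hfm.sub (ListMultilinear.single (LinearMap.id : B →ₗ[S] B))
  have hI : toList ε (f - idColl ε) = fun l => toList ε f l - single id l := by
    rw [toList_sub, toList_idColl hε.mul_self]
  -- The equation `∂_h f = f · b`, rewritten as `b = ∂_h f - (f - id) · b`; the right side is a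
  -- contraction in `b` because `f ≡ id` mod `h`.
  obtain ⟨b, hb, hfix⟩ := F.exists_fixed_point hε (IsHomog ℬ ℬ 0)
    (fun b => F.opColl F.deriv f - insColl (ε := ε) (f - idColl ε) b) 0 IsHomog.zero
    (fun b hb => (F.opColl_homog _ (fun i b => F.op_mem _) hf).sub (by
      simpa using IsHomog.insColl hε (hf.sub (IsHomog.idColl hε)) hb))
    (fun j c c' hcc' l => by
      simp only [toList_sub, sub_sub_sub_cancel_left, toList_insColl hε.mul_self]
      rw [← ins_sub_right id (by rw [← toList_sub]; exact toList_multilinear ε _)]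
      rw [toList_idColl hε.mul_self]
      refine ins_mem_hpow id hfs hf₁ (fun l => ?_) l
      rw [← neg_sub]
      exact Submodule.neg_mem _ (hcc' l))
  have hg : ∀ l, toList ε (F.opColl F.deriv f) l = ins id (toList ε f) (toList ε b) l := by
    intro l
    have := congrFun hfix l
    rw [toList_sub, toList_insColl hε.mul_self, hI] at this
    simp only [ins_sub_left, ins_single_id_left] at this
    rw [← sub_add, add_eq_right, sub_eq_zero] at this
    exact this
  refine ⟨b, hb, ?_⟩
  have hf₂ : ∀ l, F.euler (toList ε f l) =
      ins id (toList ε f) (fun l => single F.euler l + toList ε (h • b) l) l :=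
    F.euler_eq_ins_connection hε hfm (F.euler_toList hε f) fun l => by
      rw [toList_smul, ins_smul_right id hfm, hg]
  set G : List B → B := fun l =>
    ins (-ε) (fun l => single F.euler l + toList ε (h • b) l) (toList ε m) l -
      ins id (toList ε m) (fun l => single F.euler l + toList ε (h • b) l) l with hG
  -- `f · m` equals `m⁽⁰⁾ · f`, which satisfies `E ∘ X = X · D`; so the commutator term `f · G` must
  -- vanish.
  have hG₁ : ∀ l, ins (-ε) (toList ε f) G l = 0 := by
    intro l
    have h₁ := F.ins_ins_connection hε (m := toList ε m) hfm
      (F.connection_map hε (hb.smul h)) hf₂ l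
    have h₂ := F.ins_comp_const hε hfm (by simp [single, (hb.smul h).toList hε |>.1]) hf₂ m l
    rw [funext H, h₂] at h₁
    exact left_eq_add.1 h₁
  -- Left composition with `f` is injective: `G = -(f - id) · G` lies in ever higher powers of `h`.
  have hG₂ : ∀ l, G l = -ins (-ε) (fun l => toList ε f l - single id l) G l := by
    intro l
    rw [ins_sub_left, hG₁, ins_single_id_left, zero_sub, neg_neg]
  have hG₃ : ∀ j l, G l ∈ hpow B h j := by
    intro j
    induction j with
    | zero => exact fun l => mem_hpow.2 ⟨_, by rw [pow_zero, one_smul]⟩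
    | succ j ih =>
      intro l
      rw [hG₂]
      exact Submodule.neg_mem _ (ins_mem_hpow _ hfs hf₁ ih l)
  intro l
  have := hG₃ (n + 1) l
  rw [F.hpow_eq_bot, Submodule.mem_bot, hG] at this
  simp only at this
  rw [F.ins_connection_sub hε hm.restrictScalars (F.euler_toList hε m)] at this
  rw [eq_sub_iff_add_eq, ← sub_eq_zero]
  exact this

/-- The derivative of a Maurer-Cartan element is a cocycle. -/
theorem smul_ins_deriv {m : Coll S B B}
    (H : ∀ l, ins (-ε) (toList ε m) (toList ε m) l = 0) (l : List B) :
    h • (ins (-ε) (toList ε m) (toList ε (F.opColl F.deriv m)) l +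
      ins (-ε) (toList ε (F.opColl F.deriv m)) (toList ε m) l) = 0 := by
  have hm := toList_multilinear ε m
  have hmR : ListMultilinear R (toList ε m) := hm.restrictScalars
  have hT : (fun l => h • toList ε (F.opColl F.deriv m) l) =
      fun l => F.euler (toList ε m l) - der F.euler (toList ε m) l :=
    funext fun l => by rw [F.euler_toList hε, add_sub_cancel_left]
  -- The pre-Lie identity for `m`, the Euler coderivation and `m`, in which `m · m = 0` removes one
  -- term.
  have hP := ins_ins_sub (-ε) (d' := toList ε m) hmR (F.single_euler_map hε) l
  rw [funext H] at hP
  have hz : ins id (fun _ => (0 : B)) (single F.euler) l = 0 := by simp [ins, splitSum_zero]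
  rw [hz, sub_zero, funext (ins_single (S := R) _ hmR)] at hP
  simp only [single_ins] at hP
  rw [smul_add, ← ins_smul_right _ hm, ← ins_smul_left, hT, ins_sub_left, ← map_ins, H, map_zero,
    ← hP]
  abel

end Frame
end Core

/-! ### Parity operators and the existence and uniqueness of `h`-expansions. -/

theorem exists_isParity {S A : Type*} [CommRing S] [AddCommGroup A] [Module S A]
    {𝒜 : ℤ → Submodule S A} (h𝒜 : DirectSum.IsInternal 𝒜) : ∃ ε, IsParity 𝒜 ε := by
  let e := LinearEquiv.ofBijective (DirectSum.coeLinearMap 𝒜) h𝒜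
  refine ⟨DirectSum.toModule S ℤ A (fun i => ((Int.negOnePow i : ℤ) : S) • (𝒜 i).subtype) ∘ₗ
    e.symm.toLinearMap, fun i a ha => ?_, ?_⟩
  · have : e.symm a = DirectSum.lof S ℤ (fun i => 𝒜 i) i ⟨a, ha⟩ := by
      rw [LinearEquiv.symm_apply_eq]
      exact (DirectSum.coeLinearMap_lof 𝒜 i ⟨a, ha⟩).symm
    rw [LinearMap.comp_apply, LinearEquiv.coe_coe, this, DirectSum.toModule_lof,
      units_smul_eq (S := S)]
    rfl
  · rw [eq_top_iff]
    intro a _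
    obtain ⟨x, rfl⟩ := h𝒜.2 a
    induction x using DirectSum.induction_on with
    | zero => rw [map_zero]; exact AddSubmonoid.zero_mem _
    | of i x =>
      rw [DirectSum.coeAddMonoidHom_of]
      exact AddSubmonoid.subset_closure (Set.mem_iUnion.2 ⟨i, x.2⟩)
    | add x y hx hy => rw [map_add]; exact AddSubmonoid.add_mem _ (hx trivial) (hy trivial)

/-- `a` itself need not be homogeneous, but its component of degree `i` has the same multiple by
`s`. -/
theorem exists_smul_mem {S A : Type*} [CommRing S] [AddCommGroup A] [Module S A]
    {𝒜 : ℤ → Submodule S A} (h𝒜 : DirectSum.IsInternal 𝒜) (s : S) {i : ℤ} {a : A}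
    (ha : s • a ∈ 𝒜 i) : ∃ b ∈ 𝒜 i, s • a = s • b := by
  let _ := h𝒜.chooseDecomposition
  refine ⟨DirectSum.decompose 𝒜 a i, SetLike.coe_mem _, ?_⟩
  rw [← DirectSum.decompose_of_mem_same 𝒜 ha, DirectSum.decompose_smul]
  rfl

section Expansion

variable {R S V C : Type*} [CommRing R] [CommRing S] [Algebra R S] [AddCommGroup V] [Module R V]
  [AddCommGroup C] [Module S C] [Module R C] [IsScalarTower R S C]

/-- The sets `U` and `W` let one induction serve for arbitrary elements and for elements of a fixed
degree. -/
theorem exists_expansion (h : S) (σ : V → C) (U : Set V) (W : Set C)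
    (H : ∀ c ∈ W, ∃ v ∈ U, ∃ c' ∈ W, c = σ v + h • c') (j : ℕ) (c : C) (hc : c ∈ W) :
    ∃ v : ℕ → V, (∀ i < j, v i ∈ U) ∧ ∃ c' ∈ W,
      c = ∑ i ∈ Finset.range j, h ^ i • σ (v i) + h ^ j • c' := by
  induction j generalizing c with
  -- The sum is empty, and any element of `V` serves as a value of the sequence.
  | zero => exact ⟨fun _ => (H c hc).choose, by simp, c, hc, by simp⟩
  | succ j ih =>
    obtain ⟨v, hv, c', hc', rfl⟩ := H c hc
    obtain ⟨w, hw, c'', hc'', rfl⟩ := ih c' hc'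
    refine ⟨fun i => Nat.casesOn i v w, ?_, c'', hc'', ?_⟩
    · rintro (_ | i) hi
      · exact hv
      · exact hw i (by omega)
    · rw [Finset.sum_range_succ', smul_add, Finset.smul_sum]
      simp only [smul_smul, ← pow_succ', pow_zero, one_smul]
      rw [← add_assoc, add_comm (σ v)]
      rfl

/-- The projection `p` kills multiples of `h` and so detects the leading coefficient. Cancelling `h`
afterwards is possible only modulo `h^n`; the right side `h^j • c` absorbs this error and makes the
induction close. -/
theorem expansion_eq_zero {h : S} {n : ℕ} (hann : ∀ c : C, h • c = 0 → ∃ y, c = h ^ n • y)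
    (σ : V →ₗ[R] C) (p : C →+ V) (hp : ∀ v, p (σ v) = v) (hp' : ∀ c, p (h • c) = 0) {j : ℕ}
    (hj : j ≤ n + 1) (v : ℕ → V) {c : C}
    (H : ∑ i ∈ Finset.range j, h ^ i • σ (v i) = h ^ j • c) : ∀ i < j, v i = 0 := by
  induction j generalizing v c with
  | zero => intro i hi; omega
  | succ j ih =>
    rw [Finset.sum_range_succ', pow_zero, one_smul] at H
    simp only [pow_succ', mul_smul, ← Finset.smul_sum] at H
    have h₀ : v 0 = 0 := by
      have := congrArg p H
      rwa [map_add, hp', hp', zero_add, hp] at this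
    rw [h₀, map_zero, add_zero, ← sub_eq_zero, ← smul_sub] at H
    obtain ⟨y, hy⟩ := hann _ H
    have := ih (by omega) (fun i => v (i + 1)) (c := c + h ^ (n - j) • y) (by
      rw [smul_add, smul_smul, ← pow_add, Nat.add_sub_cancel' (by omega), ← hy]
      abel)
    rintro (_ | i) hi
    · exact h₀
    · exact this i (by omega)

end Expansion

/-! ### The ring `R[h]/h^N`. -/

namespace TruncPoly

open Polynomial

variable (R : Type*) [CommRing R] (N : ℕ)

/-- The projection `R[h] → R[h]/h^N`. -/
def mk : R[X] →+* TruncPoly R N := Ideal.Quotient.mk (Ideal.span {(X : R[X]) ^ N})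

theorem mk_surjective : Function.Surjective (mk R N) := Ideal.Quotient.mk_surjective

theorem mk_X : mk R N X = h R N := rfl

theorem mk_C (r : R) : mk R N (C r) = algebraMap R (TruncPoly R N) r := rfl

theorem mk_eq_zero {p : R[X]} : mk R N p = 0 ↔ X ^ N ∣ p :=
  Ideal.Quotient.eq_zero_iff_mem.trans Ideal.mem_span_singleton

theorem h_pow : h R N ^ N = 0 := by
  rw [← mk_X, ← map_pow, mk_eq_zero]

theorem exists_eq_add (s : TruncPoly R N) :
    ∃ (r : R) (t : TruncPoly R N), s = algebraMap R (TruncPoly R N) r + h R N * t := by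
  obtain ⟨p, rfl⟩ := mk_surjective R N s
  refine ⟨p.coeff 0, mk R N p.divX, ?_⟩
  rw [← mk_C, ← mk_X, ← map_mul, ← map_add, add_comm, X_mul_divX_add]

theorem exists_of_mul_eq_zero {n : ℕ} {s : TruncPoly R (n + 1)} (hs : h R (n + 1) * s = 0) :
    ∃ t, s = h R (n + 1) ^ n * t := by
  obtain ⟨p, rfl⟩ := mk_surjective R _ s
  rw [← mk_X, ← map_mul, mk_eq_zero, pow_succ'] at hs
  obtain ⟨q, hq⟩ := hs
  refine ⟨mk R _ q, ?_⟩
  rw [← mk_X, ← map_pow, ← map_mul]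
  congr 1
  ext i
  have := congrArg (fun f : R[X] => f.coeff (i + 1)) hq
  simpa [mul_assoc, coeff_X_mul] using this

/-- Characteristic zero enters the proof only through this fact. -/
theorem isUnit_natCast (k : Type*) [Field k] [CharZero k] [Algebra k R] {j : ℕ} (hj : 0 < j) :
    IsUnit (j : TruncPoly R N) := by
  have := (IsUnit.mk0 (j : k) (by exact_mod_cast hj.ne')).map
    ((algebraMap R (TruncPoly R N)).comp (algebraMap k R))
  simpa using this

end TruncPoly

/-! ### Reduction modulo `h^k`. -/

section Reduction

variable (R : Type*) [CommRing R] (N k : ℕ) {B : Type*} [AddCommGroup B]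
  [Module (TruncPoly R N) B]

theorem mem_hIdeal_smul {M : Type*} [AddCommGroup M] [Module (TruncPoly R N) M] (x : M) :
    x ∈ hIdeal R N k • (⊤ : Submodule (TruncPoly R N) M) ↔ x ∈ hpow M (TruncPoly.h R N) k := by
  rw [Submodule.ideal_span_singleton_smul, Submodule.mem_smul_pointwise_iff_exists, mem_hpow]
  simp

theorem toReduction_eq_zero (x : B) :
    toReduction R N k B x = 0 ↔ x ∈ hpow B (TruncPoly.h R N) k := by
  rw [← mem_hIdeal_smul, ← Submodule.Quotient.mk_eq_zero,
    ← (TensorProduct.quotTensorEquivQuotSMul B (hIdeal R N k)).map_eq_zero_iff]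
  have := TensorProduct.quotTensorEquivQuotSMul_mk_tmul (hIdeal R N k) 1 x
  rw [one_smul, map_one] at this
  rw [← this]
  rfl

theorem toReduction_surjective : Function.Surjective (toReduction R N k B) := by
  intro x
  induction x using TensorProduct.induction_on with
  | zero => exact ⟨0, map_zero _⟩
  | tmul s b =>
    obtain ⟨s, rfl⟩ := Ideal.Quotient.mk_surjective s
    refine ⟨s • b, ?_⟩
    rw [map_smul]
    change s • ((1 : TruncPoly R N ⧸ hIdeal R N k) ⊗ₜ[TruncPoly R N] b) = _
    rw [TensorProduct.smul_tmul', Algebra.smul_def, mul_one]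
    rfl
  | add x y hx hy =>
    obtain ⟨a, rfl⟩ := hx
    obtain ⟨b, rfl⟩ := hy
    exact ⟨a + b, map_add _ _ _⟩

theorem mem_redGrading (ℬ : ℤ → Submodule (TruncPoly R N) B) (i : ℤ) (x : Reduction R N k B) :
    x ∈ redGrading R N k ℬ i ↔ ∃ b ∈ ℬ i, toReduction R N k B b = x := by
  constructor
  · intro hx
    rw [redGrading, baseChangeGrading, Submodule.baseChange_eq_span] at hx
    induction hx using Submodule.span_induction with
    | mem x hx => exact hx
    | zero => exact ⟨0, Submodule.zero_mem _, map_zero _⟩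
    | add x y _ _ hx hy =>
      obtain ⟨a, ha, rfl⟩ := hx
      obtain ⟨b, hb, rfl⟩ := hy
      exact ⟨a + b, Submodule.add_mem _ ha hb, map_add _ _ _⟩
    | smul s x _ hx =>
      obtain ⟨b, hb, rfl⟩ := hx
      obtain ⟨s, rfl⟩ := Ideal.Quotient.mk_surjective s
      exact ⟨s • b, Submodule.smul_mem _ _ hb, map_smul _ _ _⟩
  · rintro ⟨b, hb, rfl⟩
    exact Submodule.tmul_mem_baseChange_of_mem _ hb

theorem redColl_apply (c : Coll (TruncPoly R N) B B) (i : ℕ) (a : Fin i → B) :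
    redColl R N k c i (fun j => toReduction R N k B (a j)) = toReduction R N k B (c i a) := by
  have := baseChange_tmul (TruncPoly R N ⧸ hIdeal R N k) i (c i) (fun _ => 1) a
  rwa [Finset.prod_const_one] at this

end Reduction

/-! ### Flatness and the frame attached to a splitting. -/

section TruncFrame

variable {R : Type*} [CommRing R] {n : ℕ} {B : Type*} [AddCommGroup B]
  [Module (TruncPoly R (n + 1)) B]

/-- A projective module is a direct summand of a free one, so the statement follows coordinatewise
from the one for the ring. -/
theorem exists_of_smul_eq_zero [Module.Projective (TruncPoly R (n + 1)) B] (b : B)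
    (hb : TruncPoly.h R (n + 1) • b = 0) : ∃ y, b = TruncPoly.h R (n + 1) ^ n • y := by
  obtain ⟨s, hs⟩ := Module.projective_def'.1
    (inferInstance : Module.Projective (TruncPoly R (n + 1)) B)
  have h₁ (x : B) : TruncPoly.h R (n + 1) * s b x = 0 := by
    rw [← smul_eq_mul, ← Finsupp.smul_apply, ← map_smul, hb, map_zero, Finsupp.zero_apply]
  choose t ht using fun x => TruncPoly.exists_of_mul_eq_zero R (h₁ x)
  refine ⟨∑ x ∈ (s b).support, t x • x, ?_⟩
  have := LinearMap.congr_fun hs b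
  rw [LinearMap.comp_apply, Finsupp.linearCombination_apply, Finsupp.sum, LinearMap.id_apply]
    at this
  conv_lhs => rw [← this]
  rw [Finset.smul_sum]
  refine Finset.sum_congr rfl fun x _ => ?_
  rw [ht x, mul_smul]; rfl

end TruncFrame

section TruncFrame

variable {R : Type*} [CommRing R] {n : ℕ} {B : Type*} [AddCommGroup B]
  [Module (TruncPoly R (n + 1)) B] [Module R B] [IsScalarTower R (TruncPoly R (n + 1)) B]
  {ℬ : ℤ → Submodule (TruncPoly R (n + 1)) B}

theorem toReduction_one_smul (b : B) :
    toReduction R (n + 1) 1 B (TruncPoly.h R (n + 1) • b) = 0 :=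
  (toReduction_eq_zero R (n + 1) 1 _).2 (mem_hpow.2 ⟨b, by rw [pow_one]⟩)

theorem mem_barGrading (i : ℤ) (x : Reduction R (n + 1) 1 B) :
    x ∈ barGrading R (n + 1) ℬ i ↔ ∃ b ∈ ℬ i, toReduction R (n + 1) 1 B b = x :=
  mem_redGrading R (n + 1) 1 ℬ i x

theorem IsSplitting.exists_eq_add {σ : Reduction R (n + 1) 1 B →ₗ[R] B}
    (hσ : IsSplitting R (n + 1) ℬ σ) (b : B) :
    ∃ b', b = σ (toReduction R (n + 1) 1 B b) + TruncPoly.h R (n + 1) • b' := by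
  have : b - σ (toReduction R (n + 1) 1 B b) ∈ hpow B (TruncPoly.h R (n + 1)) 1 := by
    rw [← toReduction_eq_zero, map_sub, hσ.section', sub_self]
  obtain ⟨y, hy⟩ := mem_hpow.1 this
  exact ⟨y, by rw [pow_one] at hy; rw [hy, add_sub_cancel]⟩

theorem projective_of_isFlat (hℬ : DirectSum.IsInternal ℬ) (hflat : IsFlat ℬ) :
    Module.Projective (TruncPoly R (n + 1)) B := by
  have : ∀ i, Module.Projective (TruncPoly R (n + 1)) (ℬ i) := hflat
  have : Module.Projective (TruncPoly R (n + 1)) (DirectSum ℤ fun i => ℬ i) :=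
    inferInstanceAs (Module.Projective _ (Π₀ i, ℬ i))
  exact Module.Projective.of_equiv (LinearEquiv.ofBijective (DirectSum.coeLinearMap ℬ) hℬ)

/-- Expansions exist by iterating `b = σ b̄ + h b'` until `h^{n+1} = 0`, and they are unique because
the annihilator of `h` in `B` is `h^n B`, by projectivity. -/
theorem exists_frame (hℬ : DirectSum.IsInternal ℬ) (hflat : IsFlat ℬ)
    (σ : Reduction R (n + 1) 1 B →ₗ[R] B) (hσ : IsSplitting R (n + 1) ℬ σ) :
    ∃ F : Frame R (TruncPoly.h R (n + 1)) n ℬ (barGrading R (n + 1) ℬ), F.σ = σ := by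
  have := projective_of_isFlat hℬ hflat
  set h := TruncPoly.h R (n + 1)
  have hpow : h ^ (n + 1) = 0 := TruncPoly.h_pow R (n + 1)
  have hex (b : B) : ∃ v : ℕ → Reduction R (n + 1) 1 B,
      b = ∑ j ∈ Finset.range (n + 1), h ^ j • σ (v j) := by
    obtain ⟨v, -, c, -, hv⟩ := exists_expansion h σ Set.univ Set.univ (fun c _ =>
      ⟨_, trivial, (hσ.exists_eq_add c).choose, trivial, (hσ.exists_eq_add c).choose_spec⟩)
      (n + 1) b trivial
    exact ⟨v, by rw [hv, hpow, zero_smul, add_zero]⟩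
  have hex' (i : ℤ) (b : B) (hb : b ∈ ℬ i) : ∃ v : ℕ → Reduction R (n + 1) 1 B,
      (∀ j < n + 1, v j ∈ barGrading R (n + 1) ℬ i) ∧
      b = ∑ j ∈ Finset.range (n + 1), h ^ j • σ (v j) := by
    obtain ⟨v, hv', c, -, hv⟩ := exists_expansion h σ (barGrading R (n + 1) ℬ i) (ℬ i)
      (fun c hc => by
        have hc' := (mem_barGrading i _).2 ⟨c, hc, rfl⟩
        obtain ⟨y, hy⟩ := hσ.exists_eq_add c
        -- Only `h • y` is known to be homogeneous, so `y` is replaced by its component of degree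
        -- `i`.
        have : h • y ∈ ℬ i := by
          rw [← sub_eq_iff_eq_add'.2 hy]
          exact Submodule.sub_mem _ hc (hσ.graded i _ hc')
        obtain ⟨z, hz, hyz⟩ := exists_smul_mem hℬ h this
        exact ⟨_, hc', z, hz, by rw [← hyz]; exact hy⟩)
      (n + 1) b hb
    exact ⟨v, hv', by rw [hv, hpow, zero_smul, add_zero]⟩
  have hinj (v : ℕ → Reduction R (n + 1) 1 B)
      (hv : ∑ j ∈ Finset.range (n + 1), h ^ j • σ (v j) = 0) : ∀ j < n + 1, v j = 0 :=
    expansion_eq_zero (n := n) exists_of_smul_eq_zero σ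
      (toReduction R (n + 1) 1 B).toAddMonoidHom hσ.section' toReduction_one_smul le_rfl v
      (c := 0) (by rw [hv, smul_zero])
  let E : (Fin (n + 1) → Reduction R (n + 1) 1 B) →ₗ[R] B :=
    ∑ j : Fin (n + 1), h ^ (j : ℕ) • (σ ∘ₗ LinearMap.proj j)
  have hE (v : ℕ → Reduction R (n + 1) 1 B) :
      E (fun j => v j) = ∑ j ∈ Finset.range (n + 1), h ^ j • σ (v j) := by
    simp [E, LinearMap.sum_apply, Finset.sum_range]
  have hEb : Function.Bijective E := by
    refine ⟨(injective_iff_map_eq_zero E).2 fun v hv => funext fun j => ?_, fun b => ?_⟩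
    · have h₁ := hE fun i => if hi : i < n + 1 then v ⟨i, hi⟩ else 0
      simp only [Fin.is_lt, dite_true, Fin.eta] at h₁
      rw [hv] at h₁
      have h₂ := hinj _ h₁.symm j j.2
      simpa only [Fin.is_lt, dite_true, Fin.eta, Pi.zero_apply] using h₂
    · obtain ⟨v, rfl⟩ := hex b
      exact ⟨_, hE v⟩
  let e := LinearEquiv.ofBijective E hEb
  let π : ℕ → B →ₗ[R] Reduction R (n + 1) 1 B := fun j =>
    if hj : j < n + 1 then LinearMap.proj (⟨j, hj⟩ : Fin (n + 1)) ∘ₗ e.symm.toLinearMap else 0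
  have hπ (v : ℕ → Reduction R (n + 1) 1 B) (j : ℕ) (hj : j < n + 1) :
      π j (∑ j ∈ Finset.range (n + 1), h ^ j • σ (v j)) = v j := by
    have : e.symm (∑ j ∈ Finset.range (n + 1), h ^ j • σ (v j)) = fun j : Fin (n + 1) => v j := by
      rw [LinearEquiv.symm_apply_eq, ← hE]; rfl
    simp only [π, dif_pos hj, LinearMap.comp_apply, LinearEquiv.coe_coe, this, LinearMap.proj_apply]
  let f : TruncPoly R (n + 1) ⊗[R] Reduction R (n + 1) 1 B →ₗ[TruncPoly R (n + 1)] B :=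
    LinearMap.liftBaseChange (TruncPoly R (n + 1)) σ
  have hf (v : Reduction R (n + 1) 1 B) : f (1 ⊗ₜ v) = σ v := by
    rw [LinearMap.liftBaseChange_tmul, one_smul]
  have hC (c : TruncPoly R (n + 1) ⊗[R] Reduction R (n + 1) 1 B) :
      ∃ v c', c = 1 ⊗ₜ v + h • c' := by
    induction c using TensorProduct.induction_on with
    | zero => exact ⟨0, 0, by simp⟩
    | tmul s v =>
      obtain ⟨r, t, rfl⟩ := TruncPoly.exists_eq_add R (n + 1) s
      refine ⟨r • v, t ⊗ₜ v, ?_⟩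
      rw [TensorProduct.add_tmul, TensorProduct.smul_tmul', smul_eq_mul, ← TensorProduct.smul_tmul,
        Algebra.smul_def, mul_one]
    | add x y hx hy =>
      obtain ⟨v, c, rfl⟩ := hx
      obtain ⟨w, d, rfl⟩ := hy
      exact ⟨v + w, c + d, by rw [TensorProduct.tmul_add, smul_add, add_add_add_comm]⟩
  have hfb : Function.Bijective f := by
    refine ⟨(injective_iff_map_eq_zero f).2 fun x hx => ?_, fun b => ?_⟩
    · obtain ⟨v, -, c, -, hv⟩ := exists_expansion h
        (fun v => (1 : TruncPoly R (n + 1)) ⊗ₜ[R] v) Set.univ Set.univ (fun c _ =>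
          ⟨_, trivial, (hC c).choose_spec.choose, trivial, (hC c).choose_spec.choose_spec⟩)
        (n + 1) x trivial
      rw [hpow, zero_smul, add_zero] at hv
      rw [hv, map_sum] at hx
      simp only [map_smul, hf] at hx
      rw [hv]
      refine Finset.sum_eq_zero fun j hj => ?_
      rw [hinj v hx j (Finset.mem_range.1 hj), TensorProduct.tmul_zero, smul_zero]
    · obtain ⟨v, rfl⟩ := hex b
      refine ⟨∑ j ∈ Finset.range (n + 1), h ^ j • (1 ⊗ₜ v j), ?_⟩
      rw [map_sum]
      simp only [map_smul, hf]
  refine ⟨⟨σ, π, LinearEquiv.ofBijective f hfb, hpow, fun b => ?_, fun j i v hj hi => ?_, hf,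
    hσ.graded, fun j i b hb => ?_⟩, rfl⟩
  · obtain ⟨v, hv⟩ := hex b
    conv_lhs => rw [hv]
    refine Finset.sum_congr rfl fun j hj => ?_
    rw [hv, hπ v j (Finset.mem_range.1 hj)]
  · have h₁ := hπ (fun j => if j = i then v else 0) j (Nat.lt_succ_of_le hj)
    rw [Finset.sum_eq_single i] at h₁
    · simpa using h₁
    · intro l _ hl; simp [hl]
    · intro hi'; exact (hi' (Finset.mem_range.2 (Nat.lt_succ_of_le hi))).elim
  · by_cases hj : j < n + 1
    · obtain ⟨v, hv, rfl⟩ := hex' i b hb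
      rw [hπ v j hj]
      exact hv j hj
    · rw [show π j = 0 from dif_neg hj]
      exact Submodule.zero_mem _

end TruncFrame

/-! ### Compatibility of the composites and the bracket with reduction. -/

theorem circ_map {S S₂ A A' A₂ A₂' : Type*} [CommRing S] [CommRing S₂] [AddCommGroup A]
    [AddCommGroup A'] [AddCommGroup A₂] [AddCommGroup A₂'] [Module S A] [Module S A']
    [Module S₂ A₂] [Module S₂ A₂'] {c : Coll S A A'} {d : Coll S A A} {c₂ : Coll S₂ A₂ A₂'}
    {d₂ : Coll S₂ A₂ A₂} (u : A → A₂) (w : A' →+ A₂')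
    (hc : ∀ i (a : Fin i → A), c₂ i (fun j => u (a j)) = w (c i a))
    (hd : ∀ i (a : Fin i → A), d₂ i (fun j => u (a j)) = u (d i a))
    (q : ℤ) (n : ℕ) (e : ℕ → ℤ) (a : ℕ → A) :
    circ c₂ d₂ q n e (fun j => u (a j)) = w (circ c d q n e a) := by
  simp only [circ, insertion, map_sum, Units.smul_def, map_zsmul, ← hc]
  refine Finset.sum_congr rfl fun x _ => Finset.sum_congr rfl fun y _ => ?_
  congr 3
  funext j
  rw [hd, ← apply_ite u, ← apply_ite u]

section Reduction

variable {R : Type*} [CommRing R] {N k : ℕ} {B : Type*} [AddCommGroup B]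
  [Module (TruncPoly R N) B] {ℬ : ℤ → Submodule (TruncPoly R N) B}

theorem IsHomog.redColl {p : ℤ} {c : Coll (TruncPoly R N) B B} (hc : IsHomog ℬ ℬ p c) :
    IsHomog (redGrading R N k ℬ) (redGrading R N k ℬ) p (redColl R N k c) := by
  refine ⟨?_, fun i d x hx => ?_⟩
  · rw [AInf.redColl, baseChangeColl, hc.1, map_zero]
  · choose a ha hax using fun j => (mem_redGrading R N k ℬ _ _).1 (hx j)
    obtain rfl : (fun j => toReduction R N k B (a j)) = x := funext hax
    rw [redColl_apply]
    exact (mem_redGrading R N k ℬ _ _).2 ⟨_, hc.2 i d a ha, rfl⟩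

theorem circ_redColl (c d : Coll (TruncPoly R N) B B) (q : ℤ) (n : ℕ) (e : ℕ → ℤ) (a : ℕ → B) :
    circ (redColl R N k c) (redColl R N k d) q n e (fun j => toReduction R N k B (a j)) =
      toReduction R N k B (circ c d q n e a) :=
  circ_map (toReduction R N k B) (toReduction R N k B).toAddMonoidHom
    (fun i a => redColl_apply R N k c i a) (fun i a => redColl_apply R N k d i a) q n e a

theorem bracket_redColl (m c : Coll (TruncPoly R N) B B) (p : ℤ) (n : ℕ) (e : ℕ → ℤ)
    (a : ℕ → B) :
    bracket (redColl R N k m) p (redColl R N k c) n e (fun j => toReduction R N k B (a j)) =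
      toReduction R N k B (bracket m p c n e a) := by
  rw [bracket, bracket, circ_redColl, circ_redColl, map_sub]
  simp only [Units.smul_def, map_zsmul]

end Reduction

/-! ### Passing between `B/h^n` and `B`. -/

section Truncated

variable {R : Type*} [CommRing R] {n : ℕ} {B : Type*} [AddCommGroup B]
  [Module (TruncPoly R (n + 1)) B] [Module R B] [IsScalarTower R (TruncPoly R (n + 1)) B]
  {ℬ : ℤ → Submodule (TruncPoly R (n + 1)) B}

namespace Frame

variable (F : Frame R (TruncPoly.h R (n + 1)) n ℬ (barGrading R (n + 1) ℬ))
include F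

theorem redColl_ext {c c' : Coll (TruncPoly R (n + 1) ⧸ hIdeal R (n + 1) n)
      (Reduction R (n + 1) n B) (Reduction R (n + 1) n B)}
    (H : ∀ (i : ℕ) (v : Fin i → Reduction R (n + 1) 1 B),
      c i (fun j => toReduction R (n + 1) n B (F.σ (v j))) =
        c' i (fun j => toReduction R (n + 1) n B (F.σ (v j)))) : c = c' := by
  funext i
  ext x
  have := multilinearMap_mem_of_span (c i - c' i) ⊥
    (fun _ => Set.range fun v => toReduction R (n + 1) n B (F.σ v)) (fun w hw => by
      choose v hv using hw
      obtain rfl : (fun j => toReduction R (n + 1) n B (F.σ (v j))) = w := funext hv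
      rw [sub_apply, H, sub_self]; exact Submodule.zero_mem _) x fun j => by
      obtain ⟨b, hb⟩ := toReduction_surjective R (n + 1) n (x j)
      rw [← hb, F.expand b, map_sum]
      refine Submodule.sum_mem _ fun l _ => ?_
      rw [map_smul]
      exact Submodule.smul_mem _ (Ideal.Quotient.mk _ (TruncPoly.h R (n + 1) ^ l))
        (Submodule.subset_span ⟨_, rfl⟩)
  rwa [sub_apply, Submodule.mem_bot, sub_eq_zero] at this

theorem deriv_sum (w : ℕ → Reduction R (n + 1) 1 B) :
    F.deriv (∑ k ∈ Finset.range (n + 1), TruncPoly.h R (n + 1) ^ k • F.σ (w k)) =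
      ∑ k ∈ Finset.Icc 1 n, k • TruncPoly.h R (n + 1) ^ (k - 1) • F.σ (w k) := by
  rw [map_sum, Finset.sum_range_succ', Finset.sum_congr rfl fun k hk => by
    rw [deriv, F.op_pow_smul _ (Nat.succ_le_of_lt (Finset.mem_range.1 hk))]]
  have h₀ : F.deriv (TruncPoly.h R (n + 1) ^ 0 • F.σ (w 0)) = 0 := by
    rw [deriv, F.op_pow_smul _ (Nat.zero_le n)]; simp
  have h₁ := Finset.sum_Ico_add' (fun k : ℕ => ((k : TruncPoly R (n + 1)) *
    TruncPoly.h R (n + 1) ^ (k - 1)) • F.σ (w k)) 0 n 1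
  rw [h₀, add_zero, Finset.range_eq_Ico]
  refine h₁.trans (Finset.sum_congr (by ext; simp) fun k _ => ?_)
  rw [mul_smul, Nat.cast_smul_eq_nsmul]

/-- `F.deriv` may be computed from any expansion of the values of `m`, so all admissible
coefficients `μ` give the same cochain; those of the frame show that it exists. -/
theorem isHDerivative_iff (m : Coll (TruncPoly R (n + 1)) B B)
    (c : Coll (TruncPoly R (n + 1) ⧸ hIdeal R (n + 1) n)
      (Reduction R (n + 1) n B) (Reduction R (n + 1) n B)) :
    IsHDerivative R n F.σ m c ↔ c = redColl R (n + 1) n (F.opColl F.deriv m) := by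
  constructor
  · rintro ⟨μ, hμ, hc⟩
    refine F.redColl_ext fun i v => ?_
    rw [hc, redColl_apply, F.opColl_apply, hμ, F.deriv_sum]
  · rintro rfl
    refine ⟨fun k i => ((F.π k).compMultilinearMap ((m i).restrictScalars R)).compLinearMap
      fun _ => F.σ, fun i a => F.expand _, fun i a => ?_⟩
    rw [redColl_apply, F.opColl_apply, ← F.deriv_sum]
    congr 2
    exact F.expand _

/-- The section of the projection `B → B/h^n` omitting the coefficient of `h^n`. -/
theorem exists_section : ∃ s : Reduction R (n + 1) n B →ₗ[R] B,
    (∀ x, toReduction R (n + 1) n B (s x) = x) ∧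
      ∀ i, ∀ x ∈ redGrading R (n + 1) n ℬ i, s x ∈ ℬ i := by
  let t : B →ₗ[R] B := F.op fun j => if j < n then TruncPoly.h R (n + 1) ^ j else 0
  let p := toReduction R (n + 1) n B
  have ht (b : B) (hb : p b = 0) : t b = 0 := by
    have := F.op_mem_hpow (fun j => if j < n then TruncPoly.h R (n + 1) ^ j else 0)
      (j := n) (p := n + 1) (fun i hi => ⟨0, by rw [if_neg (by omega), mul_zero]⟩)
      ((toReduction_eq_zero R (n + 1) n b).1 hb)
    rwa [F.hpow_eq_bot, Submodule.mem_bot] at this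
  have ht' (b b' : B) (hb : p b = p b') : t b = t b' := by
    rw [← sub_eq_zero, ← map_sub]
    exact ht _ (by rw [map_sub, hb, sub_self])
  have hp (b : B) : p (t b) = p b := by
    rw [eq_comm, ← sub_eq_zero, ← map_sub]
    refine (toReduction_eq_zero R (n + 1) n _).2 ?_
    simp only [t, op_apply]
    nth_rewrite 1 [F.expand b]
    rw [← Finset.sum_sub_distrib]
    refine Submodule.sum_mem _ fun j hj => ?_
    split_ifs with h
    · rw [sub_self]; exact Submodule.zero_mem _
    · rw [zero_smul, sub_zero]
      exact hpow_antitone _ (not_lt.1 h) (mem_hpow.2 ⟨_, rfl⟩)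
  -- The operator `t` depends only on the class modulo `h^n`, so composing it with a set-theoretic
  -- section gives a linear map.
  let r := Function.surjInv (toReduction_surjective R (n + 1) n (B := B))
  have hr (x) : p (r x) = x := Function.surjInv_eq _ x
  refine ⟨⟨⟨fun x => t (r x), fun x y => ?_⟩, fun c x => ?_⟩, fun x => ?_, fun i x hx => ?_⟩
  · rw [← map_add]
    exact ht' _ _ (by rw [map_add, hr, hr, hr])
  · rw [RingHom.id_apply, ← map_smul]
    exact ht' _ _ (by rw [LinearMap.map_smul_of_tower, hr, hr])
  · exact (hp _).trans (hr x)
  · obtain ⟨b, hb, rfl⟩ := (mem_redGrading R (n + 1) n ℬ i x).1 hx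
    change t (r _) ∈ ℬ i
    rw [ht' _ b (hr _)]
    exact F.op_mem _ hb

theorem exists_redColl_eq {p : ℤ} {b : Coll (TruncPoly R (n + 1) ⧸ hIdeal R (n + 1) n)
      (Reduction R (n + 1) n B) (Reduction R (n + 1) n B)}
    (hb : IsHomog (redGrading R (n + 1) n ℬ) (redGrading R (n + 1) n ℬ) p b) :
    ∃ b', IsHomog ℬ ℬ p b' ∧ redColl R (n + 1) n b' = b := by
  obtain ⟨s, hs, hs'⟩ := F.exists_section
  refine ⟨fun i => F.lift ((s.compMultilinearMap ((b i).restrictScalars R)).compLinearMap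
    fun _ => (toReduction R (n + 1) n B).restrictScalars R ∘ₗ F.σ), ⟨?_, fun i d a ha => ?_⟩, ?_⟩
  · ext v
    have h₀ : v = fun j => F.σ (![] j) := Subsingleton.elim _ _
    rw [h₀, F.lift_apply]
    simp [hb.1]
  · refine multilinearMap_mem_of_span _ _ (fun j => F.σ '' barGrading R (n + 1) ℬ (d j))
      (fun w hw => ?_) a fun j => F.le_span_image _ (ha j)
    choose v hv hvw using hw
    obtain rfl : (fun j => F.σ (v j)) = w := funext hvw
    rw [F.lift_apply]
    exact hs' _ _ (hb.2 i d _ fun j => (mem_redGrading R (n + 1) n ℬ _ _).2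
      ⟨_, F.σ_mem _ _ (hv j), rfl⟩)
  · refine F.redColl_ext fun i v => ?_
    rw [redColl_apply, F.lift_apply]
    exact hs _

end Frame

/-- The kernel of multiplication by `h` on `B` is exactly `h^n B`. Cochain equations over `R[h]/h^n`
are thereby moved to `B`. -/
theorem toReduction_eq_iff [Module.Projective (TruncPoly R (n + 1)) B] (x y : B) :
    toReduction R (n + 1) n B x = toReduction R (n + 1) n B y ↔
      TruncPoly.h R (n + 1) • x = TruncPoly.h R (n + 1) • y := by
  rw [← sub_eq_zero, ← map_sub, toReduction_eq_zero, ← sub_eq_zero (a := _ • x), ← smul_sub]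
  constructor
  · intro h
    obtain ⟨z, hz⟩ := mem_hpow.1 h
    rw [← hz, smul_smul, ← pow_succ', TruncPoly.h_pow, zero_smul]
  · intro h
    obtain ⟨z, hz⟩ := exists_of_smul_eq_zero _ h
    exact mem_hpow.2 ⟨z, hz.symm⟩

end Truncated

/-! ### The `A(∞)` relation and the Hochschild differential on words. -/

section Parity

variable {S A : Type*} [CommRing S] [AddCommGroup A] [Module S A] {𝒜 : ℤ → Submodule S A}
  {ε : Module.End S A}

theorem IsParity.neg_apply (hε : IsParity 𝒜 ε) (i : ℤ) (a : A) (ha : a ∈ 𝒜 i) :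
    (-ε) a = Int.negOnePow (1 * (i + 1)) • a := by
  rw [LinearMap.neg_apply, hε.apply i a ha, one_mul, Int.negOnePow_succ, Units.neg_smul]

theorem ins_neg_toList (hε : IsParity 𝒜 ε) {M : Type*} [AddCommGroup M] [Module S M]
    (c : Coll S A M) {d : Coll S A A} (hd : IsHomog 𝒜 𝒜 1 d)
    (n : ℕ) (e : ℕ → ℤ) (a : ℕ → A) (ha : ∀ j, a j ∈ 𝒜 (e j)) :
    ins (-ε) (toList ε c) (toList ε d) (word a n) =
      Int.negOnePow (twistExp n e) • circ c d 1 n e a :=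
  ins_toList hε c d 1 hd (-ε) hε.neg_apply n e a ha

theorem ins_neg_toList_self (hε : IsParity 𝒜 ε) {m : Coll S A A} (hm : IsAInfAlgebra 𝒜 m)
    (l : List A) : ins (-ε) (toList ε m) (toList ε m) l = 0 := by
  have hL := toList_multilinear ε m
  refine congrFun ((hL.ins (-ε) hL).ext_of_word hε ListMultilinear.zero fun n e a ha => ?_) l
  rw [ins_neg_toList hε m hm.homog n e a ha, hm.stasheff n e a ha, smul_zero]

theorem bracket_toList (hε : IsParity 𝒜 ε) {m c : Coll S A A} (hm : IsHomog 𝒜 𝒜 1 m)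
    (hc : IsHomog 𝒜 𝒜 0 c) (n : ℕ) (e : ℕ → ℤ) (a : ℕ → A) (ha : ∀ j, a j ∈ 𝒜 (e j)) :
    ins id (toList ε m) (toList ε c) (word a n) - ins (-ε) (toList ε c) (toList ε m) (word a n) =
      Int.negOnePow (twistExp n e) • bracket m 0 c n e a := by
  have h := ins_toList hε m c 0 hc LinearMap.id (by simp) n e a ha
  rw [LinearMap.id_coe] at h
  rw [h, ins_neg_toList hε c hm n e a ha, bracket, smul_sub, Int.negOnePow_zero, one_smul]

theorem toList_ofFn {M : Type*} [AddCommGroup M] [Module S M] (hε : ε * ε = 1) (c : Coll S A M)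
    {i : ℕ} (v : Fin i → A) :
    toList ε c (List.ofFn fun j => (ε ^ (i - 1 - (j : ℕ))) (v j)) = c i v := by
  have h (k : ℕ) (x : A) : (ε ^ k) ((ε ^ k) x) = x := by
    rw [← Module.End.mul_apply, ← pow_add, ← two_mul, pow_mul, pow_two, hε, one_pow,
      Module.End.one_apply]
  rw [toList_eq ε c (n := i) (by simp)]
  congr 1
  funext j
  rw [List.getD_eq_getElem _ _ (by simp), List.getElem_ofFn, h]

end Parity

/-! ### The Kaledin cochain as an equation on `B`. -/

section Hochschild

variable {R : Type*} [CommRing R] {n : ℕ} {B : Type*} [AddCommGroup B]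
  [Module (TruncPoly R (n + 1)) B] [Module R B] [IsScalarTower R (TruncPoly R (n + 1)) B]
  {ℬ : ℤ → Submodule (TruncPoly R (n + 1)) B}
  (F : Frame R (TruncPoly.h R (n + 1)) n ℬ (barGrading R (n + 1) ℬ))
  [Module.Projective (TruncPoly R (n + 1)) B] {ε : Module.End (TruncPoly R (n + 1)) B}
  (hε : IsParity ℬ ε)

theorem forall_redGrading {N k : ℕ} {B : Type*} [AddCommGroup B] [Module (TruncPoly R N) B]
    {ℬ : ℤ → Submodule (TruncPoly R N) B} {P : (ℕ → ℤ) → (ℕ → Reduction R N k B) → Prop} :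
    (∀ e a, (∀ j, a j ∈ redGrading R N k ℬ (e j)) → P e a) ↔
      ∀ e (a : ℕ → B), (∀ j, a j ∈ ℬ (e j)) → P e fun j => toReduction R N k B (a j) := by
  refine ⟨fun H e a ha => H _ _ fun j => (mem_redGrading R N k ℬ _ _).2 ⟨_, ha j, rfl⟩,
    fun H e a ha => ?_⟩
  choose b hb hba using fun j => (mem_redGrading R N k ℬ _ _).1 (ha j)
  obtain rfl : (fun j => toReduction R N k B (b j)) = a := funext hba
  exact H e b hb

include hε

/-- The bracket of two cochains of degree one is the sum of the two composites; by `smul_ins_deriv`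
this sum is killed by `h` in `B`, hence vanishes in `B/h^n`. -/
theorem Frame.redColl_deriv_mem_cocycles {m : Coll (TruncPoly R (n + 1)) B B}
    (hm : IsAInfAlgebra ℬ m) :
    redColl R (n + 1) n (F.opColl F.deriv m) ∈
      cocycles (redGrading R (n + 1) n ℬ) (redColl R (n + 1) n m) 1 := by
  have hD : IsHomog ℬ ℬ 1 (F.opColl F.deriv m) :=
    F.opColl_homog F.deriv (fun i b => F.op_mem _) hm.homog
  refine ⟨hD.redColl, fun N => forall_redGrading.2 fun e a ha => ?_⟩
  rw [bracket_redColl, ← map_zero (toReduction R (n + 1) n B), toReduction_eq_iff, smul_zero]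
  have h := F.smul_ins_deriv hε (ins_neg_toList_self hε hm) (word a N)
  rw [ins_neg_toList hε _ hD N e a ha, ins_neg_toList hε _ hm.homog N e a ha, ← smul_add,
    smul_comm, smul_eq_zero_iff_eq] at h
  rw [bracket, Int.negOnePow_one, Units.neg_smul, one_smul, sub_neg_eq_add, h]

/-- A primitive over `R[h]/h^n` lifts to `B` as a homogeneous sequence, and multiplying by `h` turns
the coboundary equation into the commutation of the connection `h d/dh + h b` with `m`. -/
theorem Frame.redColl_deriv_mem_coboundaries_iff {m : Coll (TruncPoly R (n + 1)) B B}
    (hm : IsAInfAlgebra ℬ m) :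
    redColl R (n + 1) n (F.opColl F.deriv m) ∈
      coboundaries (redGrading R (n + 1) n ℬ) (redColl R (n + 1) n m) 1 ↔
    ∃ b : Coll (TruncPoly R (n + 1)) B B, IsHomog ℬ ℬ 0 b ∧ ∀ l,
      TruncPoly.h R (n + 1) • toList ε (F.opColl F.deriv m) l =
        ins id (toList ε m) (toList ε (TruncPoly.h R (n + 1) • b)) l -
          ins (-ε) (toList ε (TruncPoly.h R (n + 1) • b)) (toList ε m) l := by
  have key (b : Coll (TruncPoly R (n + 1)) B B) (hb : IsHomog ℬ ℬ 0 b) :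
      (∀ (N : ℕ) (e : ℕ → ℤ) (a : ℕ → Reduction R (n + 1) n B),
        (∀ j, a j ∈ redGrading R (n + 1) n ℬ (e j)) →
        redColl R (n + 1) n (F.opColl F.deriv m) N (fun j => a j) =
          bracket (redColl R (n + 1) n m) 0 (redColl R (n + 1) n b) N e a) ↔
      ∀ l, TruncPoly.h R (n + 1) • toList ε (F.opColl F.deriv m) l =
        ins id (toList ε m) (toList ε (TruncPoly.h R (n + 1) • b)) l -
          ins (-ε) (toList ε (TruncPoly.h R (n + 1) • b)) (toList ε m) l := by
    have hb' := hb.smul (TruncPoly.h R (n + 1))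
    have hL := toList_multilinear ε m
    have hL' := toList_multilinear ε (TruncPoly.h R (n + 1) • b)
    have hword (N : ℕ) (e : ℕ → ℤ) (a : ℕ → B) (ha : ∀ j, a j ∈ ℬ (e j)) :
        redColl R (n + 1) n (F.opColl F.deriv m) N (fun j => toReduction R (n + 1) n B (a j)) =
          bracket (redColl R (n + 1) n m) 0 (redColl R (n + 1) n b) N e
            (fun j => toReduction R (n + 1) n B (a j)) ↔
        TruncPoly.h R (n + 1) • toList ε (F.opColl F.deriv m) (word a N) =
          ins id (toList ε m) (toList ε (TruncPoly.h R (n + 1) • b)) (word a N) -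
            ins (-ε) (toList ε (TruncPoly.h R (n + 1) • b)) (toList ε m) (word a N) := by
      rw [bracket_redColl, redColl_apply, toReduction_eq_iff, ← bracket_smul,
        bracket_toList hε hm.homog hb' N e a ha, toList_word hε _ N e a fun j _ => ha j,
        smul_comm, smul_left_cancel_iff]
    constructor
    · intro H
      refine congrFun (((toList_multilinear ε _).smul _).ext_of_word hε
        ((hL.ins LinearMap.id hL').sub (hL'.ins (-ε) hL)) fun N e a ha => ?_)
      exact (hword N e a ha).1 (forall_redGrading.1 (H N) e a ha)
    · exact fun H N => forall_redGrading.2 fun e a ha => (hword N e a ha).2 (H _)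
  constructor
  · rintro ⟨_, b, hb, H⟩
    obtain ⟨b, hb', rfl⟩ := F.exists_redColl_eq (p := 0) hb
    exact ⟨b, hb', (key b hb').1 H⟩
  · rintro ⟨b, hb, H⟩
    exact ⟨(F.redColl_deriv_mem_cocycles hε hm).1, _, hb.redColl, (key b hb).2 H⟩

end Hochschild

/-- `1 - g` raises the `h`-adic filtration by one, so it is nilpotent and `g` is a unit. -/
theorem bijective_of_sub_mem_hpow {S B : Type*} [CommRing S] [AddCommGroup B] [Module S B] {h : S}
    {n : ℕ} (hn : hpow B h n = ⊥) (g : B →ₗ[S] B) (hg : ∀ b, g b - b ∈ hpow B h 1) :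
    Function.Bijective g := by
  have hN (j : ℕ) (b : B) : ((1 - g : Module.End S B) ^ j) b ∈ hpow B h j := by
    induction j with
    | zero => exact mem_hpow.2 ⟨b, by simp⟩
    | succ j ih =>
      obtain ⟨y, hy⟩ := mem_hpow.1 ih
      obtain ⟨z, hz⟩ := mem_hpow.1 ((Submodule.neg_mem_iff _).2 (hg y))
      rw [pow_succ', Module.End.mul_apply, ← hy, map_smul]
      refine mem_hpow.2 ⟨z, ?_⟩
      rw [pow_one] at hz
      rw [pow_succ, mul_smul, hz]
      simp
  have hnil : IsNilpotent (1 - g : Module.End S B) :=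
    ⟨n, LinearMap.ext fun b => by simpa [hn] using hN n b⟩
  have := hnil.isUnit_one_sub
  rw [sub_sub_cancel] at this
  exact (Module.End.isUnit_iff g).1 this

theorem map_mem_hpow_iff {S B C : Type*} [CommRing S] [AddCommGroup B] [Module S B]
    [AddCommGroup C] [Module S C] (Φ : C ≃ₗ[S] B) {h : S} {j : ℕ} {x : C} :
    Φ x ∈ hpow B h j ↔ x ∈ hpow C h j := by
  constructor
  · intro hx
    obtain ⟨y, hy⟩ := mem_hpow.1 hx
    exact mem_hpow.2 ⟨Φ.symm y, Φ.injective (by rw [map_smul, Φ.apply_symm_apply, hy])⟩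
  · intro hx
    obtain ⟨y, rfl⟩ := mem_hpow.1 hx
    exact mem_hpow.2 ⟨Φ y, (map_smul Φ _ _).symm⟩

/-! ### Morphisms to the constant algebra `B̄[h]/h^{n+1}`. -/

section Constant

variable {R : Type*} [CommRing R] {n : ℕ} {B : Type*} [AddCommGroup B]
  [Module (TruncPoly R (n + 1)) B] [Module R B] [IsScalarTower R (TruncPoly R (n + 1)) B]
  {ℬ : ℤ → Submodule (TruncPoly R (n + 1)) B}
  (F : Frame R (TruncPoly.h R (n + 1)) n ℬ (barGrading R (n + 1) ℬ))

namespace Frame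

/-- The sequence of maps to `B̄[h]/h^{n+1}` corresponding to a sequence of maps to `B`. -/
def toConst (f : Coll (TruncPoly R (n + 1)) B B) :
    Coll (TruncPoly R (n + 1)) B (Constant R (n + 1) B) :=
  fun i => F.Φ.symm.toLinearMap.compMultilinearMap (f i)

theorem toConst_apply (f : Coll (TruncPoly R (n + 1)) B B) (i : ℕ) (a : Fin i → B) :
    F.toConst f i a = F.Φ.symm (f i a) := rfl

theorem toConst_surjective : Function.Surjective F.toConst := fun f =>
  ⟨fun i => F.Φ.toLinearMap.compMultilinearMap (f i), by
    funext i
    ext a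
    simp [toConst_apply]⟩

theorem mem_constGrading (i : ℤ) (b : B) :
    F.Φ.symm b ∈ constGrading R (n + 1) ℬ i ↔ b ∈ ℬ i := by
  constructor
  · intro hb
    have : constGrading R (n + 1) ℬ i ≤ (ℬ i).comap F.Φ.toLinearMap := by
      rw [constGrading, baseChangeGrading, Submodule.baseChange_eq_span, Submodule.span_le]
      rintro _ ⟨v, hv, rfl⟩
      change F.Φ (1 ⊗ₜ v) ∈ ℬ i
      rw [F.Φ_one_tmul]
      exact F.σ_mem i v hv
    simpa using this hb
  · intro hb
    rw [F.expand b, map_sum]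
    refine Submodule.sum_mem _ fun j _ => ?_
    rw [map_smul, ← F.Φ_one_tmul, LinearEquiv.symm_apply_apply]
    exact Submodule.smul_mem _ _ (Submodule.tmul_mem_baseChange_of_mem _ (F.π_mem j i b hb))

theorem isHomog_toConst (p : ℤ) (f : Coll (TruncPoly R (n + 1)) B B) :
    IsHomog ℬ (constGrading R (n + 1) ℬ) p (F.toConst f) ↔ IsHomog ℬ ℬ p f := by
  have h₀ : F.toConst f 0 = 0 ↔ f 0 = 0 := by
    simp only [MultilinearMap.ext_iff, toConst_apply, zero_apply,
      map_eq_zero_iff F.Φ.symm F.Φ.symm.injective]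
  simp only [IsHomog, h₀, toConst_apply, F.mem_constGrading]

variable {F}

theorem const_eq (hσ : IsSplitting R (n + 1) ℬ F.σ) (b : B) :
    F.const b = F.σ (toReduction R (n + 1) 1 B b) := by
  have h₁ : F.const b = F.σ (F.π 0 b) := by
    rw [const, F.op_apply, Finset.sum_eq_single 0 (fun j _ hj => by rw [if_neg hj, zero_smul])
      (by simp), if_pos rfl, one_smul]
  have h₂ := (toReduction_eq_zero R (n + 1) 1 _).2 (F.sub_const_mem b)
  rw [map_sub, sub_eq_zero, h₁, hσ.section'] at h₂
  rw [h₁, h₂]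

/-- Both sides are multilinear over `R[h]/h^{n+1}`, so they are compared on the image of `σ`, which
spans `B`; there each is the constant term of `m`. -/
theorem constColl_apply (hσ : IsSplitting R (n + 1) ℬ F.σ) (m : Coll (TruncPoly R (n + 1)) B B)
    (i : ℕ) (b : Fin i → B) :
    constColl R (n + 1) m i (fun j => F.Φ.symm (b j)) = F.Φ.symm (F.opColl F.const m i b) := by
  have h₀ (v : Reduction R (n + 1) 1 B) : F.Φ.symm (F.σ v) = 1 ⊗ₜ v := by
    rw [LinearEquiv.symm_apply_eq, F.Φ_one_tmul]
  have := multilinearMap_mem_of_span ((constColl R (n + 1) m i).compLinearMap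
      (fun _ => F.Φ.symm.toLinearMap) -
      F.Φ.symm.toLinearMap.compMultilinearMap (F.opColl F.const m i)) ⊥
    (fun _ => Set.range F.σ) (fun w hw => by
      choose v hv using hw
      obtain rfl : (fun j => F.σ (v j)) = w := funext hv
      rw [Submodule.mem_bot, sub_apply, sub_eq_zero, MultilinearMap.compLinearMap_apply,
        LinearMap.compMultilinearMap_apply, F.opColl_apply, const_eq hσ]
      simp only [LinearEquiv.coe_coe, h₀]
      have h₁ := baseChange_tmul (TruncPoly R (n + 1)) i (barColl R (n + 1) m i) (fun _ => 1) v
      rw [Finset.prod_const_one] at h₁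
      refine h₁.trans (congrArg _ ?_)
      have h₂ := redColl_apply R (n + 1) 1 m i fun j => F.σ (v j)
      simp only [hσ.section'] at h₂
      exact h₂) b fun j => by
      rw [F.expand (b j)]
      exact Submodule.sum_mem _ fun l _ => Submodule.smul_mem _ _ (Submodule.subset_span ⟨_, rfl⟩)
  rwa [Submodule.mem_bot, sub_apply, sub_eq_zero] at this

/-- On a homogeneous word both sides of the morphism equation acquire the same desuspension sign,
which cancels; `Φ` carries the constant structure to `F.opColl F.const m`. -/
theorem isMorphism_toConst (hσ : IsSplitting R (n + 1) ℬ F.σ)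
    {ε : Module.End (TruncPoly R (n + 1)) B} (hε : IsParity ℬ ε)
    {m : Coll (TruncPoly R (n + 1)) B B} (hm : IsHomog ℬ ℬ 1 m)
    (f : Coll (TruncPoly R (n + 1)) B B) :
    IsMorphism ℬ (constGrading R (n + 1) ℬ) m (constColl R (n + 1) m) (F.toConst f) ↔
      IsHomog ℬ ℬ 0 f ∧ ∀ l, ins (-ε) (toList ε f) (toList ε m) l =
        comp (toList ε (F.opColl F.const m)) (toList ε f) l := by
  have hword (hf : IsHomog ℬ ℬ 0 f) (N : ℕ) (e : ℕ → ℤ) (a : ℕ → B) (ha : ∀ j, a j ∈ ℬ (e j)) :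
      circ (F.toConst f) m 1 N e a = ∑ c : Composition N,
        Int.negOnePow (∑ j : Fin c.length, ((c.length : ℤ) - 1 - j) * ((c.blocksFun j : ℤ) - 1)) •
          tensorInsertion (constColl R (n + 1) m) (F.toConst f) c e a ↔
      ins (-ε) (toList ε f) (toList ε m) (word a N) =
        comp (toList ε (F.opColl F.const m)) (toList ε f) (word a N) := by
    have h₁ : circ (F.toConst f) m 1 N e a = F.Φ.symm (circ f m 1 N e a) :=
      circ_map id (F.Φ.symm : B →+ Constant R (n + 1) B) (fun _ _ => rfl) (fun _ _ => rfl) 1 N e a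
    have h₂ (c : Composition N) : tensorInsertion (constColl R (n + 1) m) (F.toConst f) c e a =
        F.Φ.symm (tensorInsertion (F.opColl F.const m) f c e a) := by
      simp only [tensorInsertion, toConst_apply, constColl_apply hσ, Units.smul_def, map_zsmul]
    rw [ins_neg_toList hε f hm N e a ha, comp_toList hε hε _ f hf N e a ha, smul_left_cancel_iff,
      h₁, ← F.Φ.symm.injective.eq_iff, map_sum]
    simp only [h₂, Units.smul_def, map_zsmul]
  constructor
  · rintro ⟨h₁, h₂⟩
    have hf := (F.isHomog_toConst 0 f).1 h₁
    refine ⟨hf, congrFun (((toList_multilinear ε f).ins (-ε) (toList_multilinear ε m)).ext_of_word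
      hε ((toList_multilinear ε _).comp (toList_multilinear ε f)) fun N e a ha =>
        (hword hf N e a ha).1 (h₂ N e a ha))⟩
  · rintro ⟨hf, h₂⟩
    exact ⟨(F.isHomog_toConst 0 f).2 hf, fun N e a ha => (hword hf N e a ha).2 (h₂ _)⟩

theorem isIdModH_toConst (hσ : IsSplitting R (n + 1) ℬ F.σ)
    {ε : Module.End (TruncPoly R (n + 1)) B} (hε : IsParity ℬ ε)
    {f : Coll (TruncPoly R (n + 1)) B B} (hf : f 0 = 0) :
    IsIdModH R (n + 1) (F.toConst f) ↔
      ∀ l, toList ε f l - single id l ∈ hpow B (TruncPoly.h R (n + 1)) 1 := by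
  have h₁ (x : B) : toList ε f [x] = f 1 ![x] := by
    rw [toList_eq ε f (n := 1) rfl]
    congr 1
    funext j
    fin_cases j
    simp
  have h₂ (x : B) : F.toConst f 1 ![x] - 1 ⊗ₜ[R] toReduction R (n + 1) 1 B x ∈
      hIdeal R (n + 1) 1 • (⊤ : Submodule (TruncPoly R (n + 1)) (Constant R (n + 1) B)) ↔
      f 1 ![x] - x ∈ hpow B (TruncPoly.h R (n + 1)) 1 := by
    rw [mem_hIdeal_smul, ← map_mem_hpow_iff F.Φ, map_sub, F.Φ_one_tmul, toConst_apply,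
      LinearEquiv.apply_symm_apply, ← const_eq hσ, ← sub_add_sub_cancel _ x]
    exact Submodule.add_mem_iff_left _ (F.sub_const_mem x)
  have h₃ (i : ℕ) (x : Fin i → B) : F.toConst f i x ∈
      hIdeal R (n + 1) 1 • (⊤ : Submodule (TruncPoly R (n + 1)) (Constant R (n + 1) B)) ↔
      f i x ∈ hpow B (TruncPoly.h R (n + 1)) 1 := by
    rw [mem_hIdeal_smul, ← map_mem_hpow_iff F.Φ, toConst_apply, LinearEquiv.apply_symm_apply]
  simp only [IsIdModH, h₂, h₃]
  constructor
  · rintro ⟨H₁, H₂⟩ (_ | ⟨a, _ | ⟨b, l⟩⟩)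
    · rw [toList_eq ε f List.length_nil, hf]
      simp [single]
    · rw [h₁]
      exact H₁ a
    · rw [single, sub_zero]
      · exact H₂ _ (by simp) _
      · simp
  · refine fun H => ⟨fun x => ?_, fun i hi x => ?_⟩
    · rw [← h₁]
      exact H [x]
    · obtain ⟨i, rfl⟩ := Nat.exists_eq_add_of_le' hi
      have := H (List.ofFn fun j => (ε ^ (i + 2 - 1 - (j : ℕ))) (x j))
      rw [toList_ofFn hε.mul_self] at this
      simpa [List.ofFn_succ, single] using this

/-- Both structures have zero differential, so it suffices that `f₁` be bijective; after transport
by `Φ` it is the identity modulo `h`. -/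
theorem isQuasiIso_of_isIdModH (hσ : IsSplitting R (n + 1) ℬ F.σ)
    {m : Coll (TruncPoly R (n + 1)) B B} (hm : IsMinimal m)
    {f : Coll (TruncPoly R (n + 1)) B (Constant R (n + 1) B)} (hf : IsIdModH R (n + 1) f) :
    IsQuasiIso m (constColl R (n + 1) m) f := by
  have hc : constColl R (n + 1) m 1 = 0 := by
    have : barColl R (n + 1) m 1 = 0 := by
      ext v
      simp [barColl, baseChangeColl, show m 1 = 0 from hm]
    rw [constColl, baseChangeColl, this, map_zero]
  let g : B →ₗ[TruncPoly R (n + 1)] B := F.Φ.toLinearMap ∘ₗ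
    (f 1).toLinearMap ![0] 0
  have hg (b : B) : g b = F.Φ (f 1 ![b]) := by
    change F.Φ (f 1 _) = _
    congr 2
    funext j
    fin_cases j
    simp
  have hgb : Function.Bijective g := by
    refine bijective_of_sub_mem_hpow F.hpow_eq_bot g fun b => ?_
    have := hf.1 b
    rw [mem_hIdeal_smul, ← map_mem_hpow_iff F.Φ, map_sub, F.Φ_one_tmul, ← const_eq hσ] at this
    rw [hg, ← sub_add_sub_cancel _ (F.const b)]
    exact Submodule.add_mem _ this (by
      rw [← neg_sub]; exact Submodule.neg_mem _ (F.sub_const_mem b))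
  refine ⟨fun x _ hx => ⟨0, ?_⟩, fun y _ => ?_⟩
  · obtain ⟨y, hy⟩ := hx
    rw [hc, zero_apply] at hy
    rw [show m 1 = 0 from hm, zero_apply]
    refine hgb.1 ?_
    rw [hg, hy, map_zero, map_zero]
  · obtain ⟨x, hx⟩ := hgb.2 (F.Φ y)
    rw [hg] at hx
    refine ⟨x, 0, by rw [show m 1 = 0 from hm, zero_apply], ?_⟩
    rw [F.Φ.injective hx, sub_self, hc, zero_apply]

end Frame

end Constant

end AInf

end

theorem proposition4p5 {k R B : Type*} [Field k] [CharZero k] [CommRing R] [Algebra k R]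
    (n : ℕ) (hn : 1 ≤ n)
    [AddCommGroup B] [Module (AInf.TruncPoly R (n + 1)) B]
    [Module R B] [IsScalarTower R (AInf.TruncPoly R (n + 1)) B]
    (ℬ : ℤ → Submodule (AInf.TruncPoly R (n + 1)) B) (m : AInf.Coll (AInf.TruncPoly R (n + 1)) B B)
    (hm : AInf.IsAInfAlgebra ℬ m) (hmin : AInf.IsMinimal m) (hflat : AInf.IsFlat ℬ)
    (σ : AInf.Reduction R (n + 1) 1 B →ₗ[R] B) (hσ : AInf.IsSplitting R (n + 1) ℬ σ) :
    ∃ κ : AInf.cocycles (AInf.redGrading R (n + 1) n ℬ) (AInf.redColl R (n + 1) n m) (2 - 1),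
      (∀ c, AInf.IsHDerivative R n σ m c ↔ c = κ) ∧
      (AInf.HH.mk (AInf.redGrading R (n + 1) n ℬ) (AInf.redColl R (n + 1) n m) 2 κ = 0 ↔
        ∃ f : AInf.Coll (AInf.TruncPoly R (n + 1)) B (AInf.Constant R (n + 1) B),
          AInf.IsMorphism ℬ (AInf.constGrading R (n + 1) ℬ) m (AInf.constColl R (n + 1) m) f ∧
          AInf.IsQuasiIso m (AInf.constColl R (n + 1) m) f ∧
          AInf.IsIdModH R (n + 1) f) := by
  have := AInf.projective_of_isFlat hm.isInternal hflat
  obtain ⟨F, rfl⟩ := AInf.exists_frame hm.isInternal hflat σ hσ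
  obtain ⟨ε, hε⟩ := AInf.exists_isParity hm.isInternal
  refine ⟨⟨_, F.redColl_deriv_mem_cocycles hε hm⟩, fun c => F.isHDerivative_iff m c, ?_⟩
  refine (Submodule.Quotient.mk_eq_zero _).trans
    (Iff.trans (F.redColl_deriv_mem_coboundaries_iff hε hm) ?_)
  constructor
  · rintro ⟨b, hb, H⟩
    obtain ⟨f, hf, hf₁, hf₂⟩ := F.exists_morphism hε
      (fun _ hj => AInf.TruncPoly.isUnit_natCast R (n + 1) k hj) hb H
    have hid := (AInf.Frame.isIdModH_toConst hσ hε hf.1).2 hf₁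
    exact ⟨F.toConst f, (AInf.Frame.isMorphism_toConst hσ hε hm.homog f).2 ⟨hf, hf₂⟩,
      AInf.Frame.isQuasiIso_of_isIdModH hσ hmin hid, hid⟩
  · rintro ⟨f, hf, -, hid⟩
    obtain ⟨f, rfl⟩ := F.toConst_surjective f
    obtain ⟨hf, H⟩ := (AInf.Frame.isMorphism_toConst hσ hε hm.homog f).1 hf
    exact F.exists_primitive hε hf ((AInf.Frame.isIdModH_toConst hσ hε hf.1).1 hid) H
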